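/- **Notation.** $\mathbb R_+=(0,\infty)$, $\mathbb R_-=(-\infty,0)$, $\langle x\rangle=(1+x^2)^{1/2}$, $\|\cdot\|$ is the norm of $L^2(\mathbb R)$, and $\lambda>0$. For $U\in L^2_{\rm loc}(\mathbb R)$, $H_U f=-f''+Uf$ is the maximal operator in $L^2(\mathbb R)$, with domain $\{f\in L^2(\mathbb R): -f''+Uf\in L^2(\mathbb R)\}$ (distributional derivatives). "$V$ is bounded at $\pm\infty$" means that $V$ is bounded near $\pm\infty$, and "unbounded at $\pm\infty$" is the negation; the two ends are treated separately. **Assumption on $V$.** Let $N\ge 1$ be an integer, $\nu_\pm\in\mathbb R$, $\varepsilon_1>0$, and let $V:\mathbb R\to\mathbb C$ be (the continuous representative of a function) in $W^{N,\infty}_{\rm loc}(\mathbb R)$ such that (a) $\limsup_{x\to-\infty}\operatorname{Im}V(x)<0<\liminf_{x\to+\infty}\operatorname{Im}V(x)$; (b) for $1\le m\le N$, as $x\to\pm\infty$, $|\operatorname{Im}V^{(m)}(x)|=O(|\operatorname{Im}V(x)|\langle x\rangle^{m\nu_\pm})$ and $|V^{(m)}(x)|=O(|V(x)|\langle x\rangle^{m\nu_\pm})$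 (for almost every $x$); (c) if $V$ is unbounded at $\pm\infty$, then $\langle x\rangle^{4(\nu_\pm+\varepsilon_1)+2}\big(\langle x\rangle^{4\nu_\pm+2}+|\operatorname{Re}V(x)|\big)=O(|\operatorname{Im}V(x)|^2)$ as $x\to\pm\infty$; if $V$ is bounded at $\pm\infty$, then $\nu_\pm<1$. **Pseudomodes.** Put $n:=N-1$. Let $\varepsilon_2>0$, with $\varepsilon_2<1-\nu_\pm$ whenever $V$ is bounded at $\pm\infty$. Set $$\delta_\pm(\lambda)=\begin{cases}\inf\{\delta\ge0:\ |\operatorname{Im}V(\pm\delta)|^2\langle\delta\rangle^{-(4\nu_\pm+2\varepsilon_1+2)}=\lambda\}& V\text{ unbounded at }\pm\infty,\\ \lambda^{(1+\varepsilon_2)/2}& V\text{ bounded at }\pm\infty,\end{cases}\qquad \Delta_\pm=\begin{cases}\tfrac14\delta_\pm^{-\nu_\pm}& V\text{ unbounded at }\pm\infty,\\ \tfrac14\delta_\pm& V\text{ bounded at }\pm\infty\end{cases}$$ (the infimum is taken over a non-empty set for all large $\lambda$). Let $\xi=\xi_\lambda$ be any family of functions such that, for all large $\lambda$, $\xi\in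 C_0^\infty(\mathbb R)$, $0\le\xi\le1$, $\xi=1$ on $(-\delta_-+\Delta_-,\delta_+-\Delta_+)$, $\xi=0$ outside $(-\delta_-,\delta_+)$, and $\|\xi^{(j)}\|_{L^\infty(\mathbb R_\pm)}\le C\Delta_\pm^{-j}$ for $j=1,2$ with $C$ independent of $\lambda$. Define $\psi_k$, $-1\le k\le n-1$, by $\psi_k(0)=0$ and $$\psi_{-1}'=i\lambda^{-1/2}(\lambda-V)^{1/2},\qquad \psi_{k+1}'=\frac1{2\psi_{-1}'}\Big(\psi_k''-\sum_{\alpha+\beta=k;\ \alpha,\beta\ge0}\psi_\alpha'\psi_\beta'\Big)$$ (principal square root), and let $g=\exp\big(-\sum_{k=-1}^{n-1}\lambda^{-k/2}\psi_k\big)$ and $f=f_\lambda=\xi g$. **Theorem.** Assume in addition that there are $\gamma,\gamma_-,\gamma_+\ge0$ such that $|\operatorname{Im}V(x)|=O(|x|^\gamma)$ as $x\to+\infty$ or as $x\to-\infty$ (at least one of the two), and $|x|^{\gamma_\pm}=O(|\operatorname{Im}V(x)|)$ as $x\to\pm\infty$ (both). Let $2\le r_\pm<\infty$ and $W\in L^{r_-}(\mathbb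 R_-)+L^{r_+}(\mathbb R_+)$, i.e. $W|_{\mathbb R_\pm}\in L^{r_\pm}(\mathbb R_\pm)$. Then for all sufficiently large $\lambda$ one has $f\ne0$, $f\in\operatorname{Dom}(H_{V+W})$ and $$\frac{\|(H_{V+W}-\lambda)f\|}{\|f\|}=\kappa(\lambda)+\sigma^{(n)}(\lambda)+\rho(\lambda),$$ where $\kappa=\kappa_-+\kappa_+$, $\sigma^{(n)}=\sigma^{(n)}_-+\sigma^{(n)}_+$, $\rho=\rho_-+\rho_+$ are real functions of $\lambda$ satisfying, as $\lambda\to+\infty$: * with some $c>0$ (which may depend on the sign $\pm$), $\kappa_\pm=O\big(\exp(-c\,\delta_\pm^{\nu_\pm+1+\varepsilon_1})\big)$ if $V$ is unbounded at $\pm\infty$, and $\kappa_\pm=O\big(\exp(-c\lambda^{\varepsilon_2/2})\big)$ if $V$ is bounded at $\pm\infty$; * if $V$ is unbounded at $\pm\infty$: $\sigma^{(n)}_\pm=O\big(\lambda^{-\frac{n+1}2}\sup_{0<\pm x<\delta_\pm}|V(x)|\langle x\rangle^{(n+1)\nu_\pm}\big)$ for $\nu_\pm<0$, and $\sigma^{(n)}_\pm=O\big(\delta_\pm^{(n+1)\nu_\pm}\lambda^{\frac{1-n}2}\big)$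 for $\nu_\pm\ge0$; * if $V$ is bounded at $\pm\infty$: $\sigma^{(n)}_\pm=O\big(\lambda^{-\frac{n+1}2}\big)$ for $\nu_\pm<0$, and $\sigma^{(n)}_\pm=O\big(\lambda^{-\frac{n+1}2(1-(1+\varepsilon_2)\nu_\pm)}\big)$ for $\nu_\pm\ge0$; * $\displaystyle \rho_\pm=O\Big(\lambda^{\frac{\gamma-\gamma_\pm-\frac2{r_\pm}(\gamma+1)}{4(\gamma_\pm+1)(\gamma+1)}}\Big).$ -/

import Mathlib

open MeasureTheory Filter Topology Set Asymptotics
open scoped ContDiff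

noncomputable section

namespace Pseudomode

/-- The Japanese bracket `⟨x⟩ = (1 + x²)^{1/2}`. -/
def jb (x : ℝ) : ℝ := Real.sqrt (1 + x ^ 2)

/-- The `L²(ℝ)` norm of a function. -/
def l2norm (f : ℝ → ℂ) : ℝ := (eLpNorm f 2 volume).toReal

/-- Test functions on the real line: real-valued, smooth, compactly supported. -/
def IsTestFunction (φ : ℝ → ℝ) : Prop := ContDiff ℝ ∞ φ ∧ HasCompactSupport φ

/-- `v` is the weak (distributional) derivative of `u` on `ℝ`. -/
def HasWeakDeriv (u v : ℝ → ℂ) : Prop :=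
  LocallyIntegrable u volume ∧ LocallyIntegrable v volume ∧
    ∀ φ : ℝ → ℝ, IsTestFunction φ →
      ∫ x, u x * ((deriv φ x : ℝ) : ℂ) = -∫ x, v x * ((φ x : ℝ) : ℂ)

/-- `V ∈ W^{N,∞}_loc(ℝ)`, witnessed by `D m = V^{(m)}` for `0 ≤ m ≤ N`: each `D (m + 1)` is the
weak derivative of `D m`, and all of them are essentially bounded on compact sets. -/
structure IsSobolevLocInfty (N : ℕ) (V : ℝ → ℂ) (D : ℕ → ℝ → ℂ) : Prop where
  zero : D 0 = V
  succ : ∀ m < N, HasWeakDeriv (D m) (D (m + 1))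
  locBounded : ∀ m ≤ N, ∀ K : Set ℝ, IsCompact K →
    MemLp (D m) ⊤ (volume.restrict K)

/-! ### The Schrödinger operator -/

/-- The graph of the maximal Schrödinger operator `H_U = -d²/dx² + U` in `L²(ℝ)`, for a potential
`U ∈ L²_loc(ℝ)`: `f` lies in the domain of `H_U` and `H_U f = h`, that is, `f, h ∈ L²(ℝ)` and
`-f'' + U f = h` in the sense of distributions. -/
def IsSchrodingerImage (U f h : ℝ → ℂ) : Prop :=
  MemLp f 2 volume ∧ MemLp h 2 volume ∧ LocallyIntegrable (fun x => U x * f x) volume ∧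
    ∀ φ : ℝ → ℝ, IsTestFunction φ →
      (-∫ x, f x * ((iteratedDeriv 2 φ x : ℝ) : ℂ)) + ∫ x, U x * f x * ((φ x : ℝ) : ℂ)
        = ∫ x, h x * ((φ x : ℝ) : ℂ)

/-! ### The assumption on the potential

Conditions at `+∞` and at `-∞` are stated for a half-line profile `U`, which is `V` itself for the
end `+∞` and the reflection `x ↦ V (-x)` for the end `-∞`. -/

/-- The reflected function `x ↦ F (-x)`. -/
def reflect {α : Type*} (F : ℝ → α) : ℝ → α := fun x => F (-x)

/-- The profile `U` is bounded at infinity. -/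
def BoundedAtInfty (U : ℝ → ℂ) : Prop := U =O[atTop] (fun _ => (1 : ℝ))

/-- The conditions at one end of the line: control of the derivatives of order `1, …, N`
(`D m` is the profile of the `m`-th derivative, and the bounds hold for almost every `x` near
infinity), and largeness of the imaginary part in the unbounded case, resp. `ν < 1` in the
bounded case. -/
structure EndAssumption (N : ℕ) (U : ℝ → ℂ) (D : ℕ → ℝ → ℂ) (ν ε₁ : ℝ) : Prop where
  im_deriv : ∀ m : ℕ, 1 ≤ m → m ≤ N →
    (fun x => (D m x).im) =O[atTop ⊓ ae volume] (fun x => |(U x).im| * jb x ^ ((m : ℝ) * ν))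
  deriv : ∀ m : ℕ, 1 ≤ m → m ≤ N →
    (fun x => D m x) =O[atTop ⊓ ae volume] (fun x => ‖U x‖ * jb x ^ ((m : ℝ) * ν))
  unbounded : ¬ BoundedAtInfty U →
    (fun x => jb x ^ (4 * (ν + ε₁) + 2) * (jb x ^ (4 * ν + 2) + |(U x).re|))
      =O[atTop] (fun x => |(U x).im| ^ 2)
  bounded : BoundedAtInfty U → ν < 1

/-- The standing assumption on `V`, with the regularity index `N` and the parameters `ν_-`, `ν_+`
and `ε₁`. An element of `W^{N,∞}_loc(ℝ)`, `N ≥ 1`, is identified with its continuous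
representative. -/
structure BasicAssumption (N : ℕ) (V : ℝ → ℂ) (νm νp ε₁ : ℝ) : Prop where
  continuous : Continuous V
  limsup_neg : limsup (fun x => (((V x).im : ℝ) : EReal)) atBot < 0
  liminf_pos : 0 < liminf (fun x => (((V x).im : ℝ) : EReal)) atTop
  exists_derivs : ∃ D : ℕ → ℝ → ℂ, IsSobolevLocInfty N V D ∧
    EndAssumption N (reflect V) (fun m => reflect (D m)) νm ε₁ ∧ EndAssumption N V D νp ε₁

/-! ### The ansatz -/

/-- `wkbDeriv V lam j` is the function `ψ'_{j-1}`, so that `j = 0, 1, 2, …` corresponds to the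
index `k = j - 1 = -1, 0, 1, …`:
`ψ'_{-1} = i λ^{-1/2} (λ - V)^{1/2}` (principal branch) and
`ψ'_{k+1} = (ψ_k'' - ∑_{α+β=k, α,β≠-1} ψ'_α ψ'_β) / (2 ψ'_{-1})`. In the sum, `a : Fin j` stands
for `α = a`, `β = k - a` with `k = j - 1`, i.e. for the shifted indices `a + 1` and `j - a`. -/
def wkbDeriv (V : ℝ → ℂ) (lam : ℝ) : ℕ → ℝ → ℂ
  | 0 => fun x =>
      Complex.I * ((lam ^ (-(1 / 2) : ℝ) : ℝ) : ℂ) * ((lam : ℂ) - V x) ^ ((1 / 2 : ℝ) : ℂ)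
  | (j + 1) => fun x =>
      (deriv (wkbDeriv V lam j) x
        - ∑ a : Fin j, wkbDeriv V lam (a.1 + 1) x * wkbDeriv V lam (j - a.1) x)
      / (2 * wkbDeriv V lam 0 x)
  decreasing_by all_goals omega

/-- `wkbPsi V lam j = ψ_{j-1}`, the primitive of `ψ'_{j-1}` that vanishes at `0`. -/
def wkbPsi (V : ℝ → ℂ) (lam : ℝ) (j : ℕ) (x : ℝ) : ℂ := ∫ t in (0 : ℝ)..x, wkbDeriv V lam j t

/-- `g = exp (-∑_{k=-1}^{n-1} λ^{-k/2} ψ_k)`, with `k = j - 1`. -/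
def wkbG (V : ℝ → ℂ) (n : ℕ) (lam : ℝ) (x : ℝ) : ℂ :=
  Complex.exp (-∑ j ∈ Finset.range (n + 1),
    ((lam ^ (-((j : ℝ) - 1) / 2) : ℝ) : ℂ) * wkbPsi V lam j x)

open Classical in
/-- The radius `δ_±` for the profile `U`. In the unbounded case the set is non-empty for all large
`λ`, which are the only ones that matter. -/
def cutRadius (U : ℝ → ℂ) (ν ε₁ ε₂ lam : ℝ) : ℝ :=
  if BoundedAtInfty U then lam ^ ((1 + ε₂) / 2)
  else sInf {δ : ℝ | 0 ≤ δ ∧ |(U δ).im| ^ 2 / jb δ ^ (4 * ν + 2 * ε₁ + 2) = lam}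

open Classical in
/-- The width `Δ_±` for the profile `U`. -/
def cutWidth (U : ℝ → ℂ) (ν ε₁ ε₂ lam : ℝ) : ℝ :=
  if BoundedAtInfty U then cutRadius U ν ε₁ ε₂ lam / 4
  else cutRadius U ν ε₁ ε₂ lam ^ (-ν) / 4

/-- `ξ` is a family of cut-offs, indexed by `λ`, for the radii `δ_±` and the widths `Δ_±`: for all
large `λ` the function `ξ λ` is smooth with compact support and values in `[0, 1]`, equals `1` on
`(-δ_- + Δ_-, δ_+ - Δ_+)`, vanishes outside `(-δ_-, δ_+)`, and its derivatives of order `j = 1, 2`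
are bounded on `ℝ_±` by `C Δ_±^{-j}`, with `C` independent of `λ`. -/
structure IsCutoffFamily (δm Δm δp Δp : ℝ → ℝ) (ξ : ℝ → ℝ → ℝ) : Prop where
  smooth : ∀ᶠ lam in atTop, ContDiff ℝ ∞ (ξ lam) ∧ HasCompactSupport (ξ lam)
  range : ∀ᶠ lam in atTop, ∀ x, 0 ≤ ξ lam x ∧ ξ lam x ≤ 1
  eq_one : ∀ᶠ lam in atTop, ∀ x ∈ Ioo (-δm lam + Δm lam) (δp lam - Δp lam), ξ lam x = 1
  eq_zero : ∀ᶠ lam in atTop, ∀ x ∉ Ioo (-δm lam) (δp lam), ξ lam x = 0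
  deriv_le : ∃ C : ℝ, ∀ᶠ lam in atTop, ∀ j : ℕ, j = 1 ∨ j = 2 →
    (∀ x < 0, |iteratedDeriv j (ξ lam) x| ≤ C / Δm lam ^ j) ∧
    (∀ x > 0, |iteratedDeriv j (ξ lam) x| ≤ C / Δp lam ^ j)

/-- The pseudomode `f = ξ g`. -/
def pseudomode (V : ℝ → ℂ) (n : ℕ) (ξ : ℝ → ℝ → ℝ) (lam : ℝ) (x : ℝ) : ℂ :=
  ((ξ lam x : ℝ) : ℂ) * wkbG V n lam x

/-! ### The rates -/

open Classical in
/-- The rate of the cut-off error `κ_±`, with the constant `c`. -/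
def kappaRate (U : ℝ → ℂ) (ν ε₁ ε₂ c lam : ℝ) : ℝ :=
  if BoundedAtInfty U then Real.exp (-c * lam ^ (ε₂ / 2))
  else Real.exp (-c * cutRadius U ν ε₁ ε₂ lam ^ (ν + 1 + ε₁))

open Classical in
/-- The rate of the expansion error `σ_±^{(n)}`. -/
def sigmaRate (U : ℝ → ℂ) (n : ℕ) (ν ε₁ ε₂ lam : ℝ) : ℝ :=
  if BoundedAtInfty U then
    if ν < 0 then lam ^ (-((n : ℝ) + 1) / 2)
    else lam ^ (-((n : ℝ) + 1) / 2 * (1 - (1 + ε₂) * ν))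
  else
    if ν < 0 then
      lam ^ (-((n : ℝ) + 1) / 2) *
        sSup ((fun x => ‖U x‖ * jb x ^ (((n : ℝ) + 1) * ν)) '' Ioo 0 (cutRadius U ν ε₁ ε₂ lam))
    else cutRadius U ν ε₁ ε₂ lam ^ (((n : ℝ) + 1) * ν) * lam ^ ((1 - (n : ℝ)) / 2)

/-- The rate of the perturbation error `ρ_±`; `γ'` stands for `γ_±` and `r` for `r_±`. -/
def rhoRate (γ γ' r lam : ℝ) : ℝ :=
  lam ^ ((γ - γ' - 2 / r * (γ + 1)) / (4 * (γ' + 1) * (γ + 1)))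

end Pseudomode

end

/-! Put `T_j = λ^{-(j-1)/2} ψ'_{j-1}` and `P = T_0 + … + T_n`, so that `g' = -P g`. Then `(H_{V+W} -
λ)(ξ g)` is the sum of `ξ (P' - P² + V - λ) g`, of `(2 ξ' P - ξ'') g` and of `W ξ g`. These three
errors are responsible for `σ`, `κ` and `ρ`.

Residual. With `S = (λ - V)^{1/2}` and `w_m = V^{(m)} / (λ - V)` one has `T_j = S^{1-j} p_j(w)`,
where for `j ≥ 1` the polynomial `p_j` has weight `j` and no constant term (`wkbDeriv_eq`,
`isSymbol_wkbSymbol`). The recurrence says `T_j' = ∑_{a+b=j+1} T_a T_b`, and `T_0² = V - λ`. Hence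
in `P' - P² + V - λ` everything cancels except `2 T_0 T_{n+1}` and the products `T_a T_b` with `a, b
≤ n`, `a + b ≥ n + 2` (`wkbResidual_eq`). Homogeneity bounds what is left by `|V| (⟨x⟩^ν /
√λ)^{n+1}` (`exists_wkb_bounds`), and this is the rate of `σ`.

Decay. Since `T_0 = i S`, one has `Re T_0 = Im V / (2 Re S)`, which is comparable to `λ^{-1/2} Im V`
as long as `Re V ≤ λ/2` and `V = O(λ)`. Beyond a fixed compact set the other terms of `P` are small
against it. So `|g|` lies between two exponentials of negative multiples of `λ^{-1/2} ∫ |Im V|`, up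
to constant factors (`EndData.exists_wkbG_bounds`). The radii `δ_±` are chosen so that these
conditions persist up to `δ_±`, while at `δ_± - Δ_±` the exponent has already reached a multiple of
`decayRate`. Compared with the resulting exponential, the factors `λ`, `δ_±`, `1/Δ_±` are
negligible, which gives `κ`. These facts about one end are collected in `EndControl` and proved in
`EndHyp.endControl`, separately for bounded and unbounded `V`; in the unbounded case they come from
the growth condition on `Im V` and Gronwall's inequality.

Perturbation. The lower power bound gives `|g| ≤ C exp(-c λ^{-1/2} |x|^{γ_± + 1})`, and Hölder's
inequality turns this into a bound for `‖W f‖`. The upper power bound, at one end, keeps `|f|`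
bounded below on an interval of length comparable to `λ^{1/(2(γ+1))}`, whence `‖f‖ ≥ c
λ^{1/(4(γ+1))}`. The quotient has the exponent of `ρ`.

Regularity. As `V` is only of class `C^{n,1}`, the function `P` is merely Lipschitz and `P'` exists
almost everywhere. The calculus therefore rests on the fundamental theorem for Lipschitz functions,
and `isSchrodingerImage_pseudomode` uses it to place `f` in the domain. Both ends are treated at
once through `x ↦ s x` with `s = ± 1`, `x ≥ 0`. -/

open scoped ENNReal

noncomputable section

namespace Pseudomode

/-! ### Lipschitz functions and weak derivatives -/

/-- Fundamental theorem of calculus for Lipschitz functions. -/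
theorem integral_eq_sub_of_locallyLipschitzOn {f f' : ℝ → ℂ} {a b : ℝ}
    (hf : LocallyLipschitzOn (uIcc a b) f)
    (hf' : ∀ᵐ x, x ∈ uIcc a b → HasDerivAt f (f' x) x) :
    IntervalIntegrable f' volume a b ∧ ∫ x in a..b, f' x = f b - f a := by
  obtain ⟨K, hK⟩ := hf.exists_lipschitzOnWith_of_compact isCompact_uIcc
  have hre : AbsolutelyContinuousOnInterval (fun x => (f x).re) a b :=
    (LipschitzOnWith.of_dist_le_mul (K := K) fun x hx y hy => by
      refine le_trans ?_ (hK.dist_le_mul x hx y hy)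
      rw [Real.dist_eq, dist_eq_norm, ← Complex.sub_re]
      exact Complex.abs_re_le_norm _).absolutelyContinuousOnInterval
  have him : AbsolutelyContinuousOnInterval (fun x => (f x).im) a b :=
    (LipschitzOnWith.of_dist_le_mul (K := K) fun x hx y hy => by
      refine le_trans ?_ (hK.dist_le_mul x hx y hy)
      rw [Real.dist_eq, dist_eq_norm, ← Complex.sub_im]
      exact Complex.abs_im_le_norm _).absolutelyContinuousOnInterval
  have h1 : (fun x => ((deriv (fun x => (f x).re) x : ℝ) : ℂ)
      + ((deriv (fun x => (f x).im) x : ℝ) : ℂ) * Complex.I)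
      =ᵐ[volume.restrict (uIoc a b)] f' := by
    rw [Filter.EventuallyEq, ae_restrict_iff' measurableSet_uIoc]
    filter_upwards [hf'] with x hx hx'
    have h := hx (uIoc_subset_uIcc hx')
    have h2 : HasDerivAt (fun x => (f x).re) (f' x).re x := 
      Complex.reCLM.hasFDerivAt.comp_hasDerivAt x h
    have h3 : HasDerivAt (fun x => (f x).im) (f' x).im x := 
      Complex.imCLM.hasFDerivAt.comp_hasDerivAt x h
    rw [h2.deriv, h3.deriv, Complex.re_add_im]
  have i1 : IntervalIntegrable (fun x => ((deriv (fun x => (f x).re) x : ℝ) : ℂ)) volume a b :=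
    ⟨hre.intervalIntegrable_deriv.1.ofReal, hre.intervalIntegrable_deriv.2.ofReal⟩
  have i2 : IntervalIntegrable (fun x => ((deriv (fun x => (f x).im) x : ℝ) : ℂ) * Complex.I)
      volume a b := IntervalIntegrable.mul_const ⟨him.intervalIntegrable_deriv.1.ofReal, him.intervalIntegrable_deriv.2.ofReal⟩ _
  refine ⟨(i1.add i2).congr_ae h1, ?_⟩
  rw [← intervalIntegral.integral_congr_ae_restrict h1, intervalIntegral.integral_add i1 i2,
    intervalIntegral.integral_mul_const, intervalIntegral.integral_ofReal,
    intervalIntegral.integral_ofReal, hre.integral_deriv_eq_sub, him.integral_deriv_eq_sub]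
  apply Complex.ext <;> simp

/-- A test function with integral zero is the derivative of a test function. Subtracting from an
arbitrary `φ` the multiple `(∫ φ) e` of a fixed bump `e` of integral one leaves such a function, so
`∫ u φ = (∫ u e) (∫ φ)`. -/
theorem HasWeakDeriv.ae_eq_const {u : ℝ → ℂ} (hu : LocallyIntegrable u volume)
    (h : ∀ φ : ℝ → ℝ, IsTestFunction φ → ∫ x, u x * ((deriv φ x : ℝ) : ℂ) = 0) :
    ∃ c : ℂ, ∀ᵐ x, u x = c := by
  obtain ⟨η⟩ : Nonempty (ContDiffBump (0 : ℝ)) := ⟨⟨1, 2, by norm_num, by norm_num⟩⟩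
  set e : ℝ → ℝ := η.normed volume with he
  have he1 : ContDiff ℝ ∞ e := η.contDiff_normed
  have he2 : HasCompactSupport e := η.hasCompactSupport_normed
  have he3 : ∫ x, e x = 1 := η.integral_normed
  refine ⟨∫ x, u x * (e x : ℂ), ?_⟩
  set c := ∫ x, u x * (e x : ℂ) with hc
  apply ae_eq_of_integral_contDiff_smul_eq hu (continuous_const.locallyIntegrable)
  intro φ hφ hφc
  set I := ∫ x, φ x with hI
  set ψ : ℝ → ℝ := fun x => φ x - I * e x with hψ
  have hψs : ContDiff ℝ ∞ ψ := hφ.sub (contDiff_const.mul he1)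
  have hψc : HasCompactSupport ψ := hφc.sub (he2.mul_left)
  have hψi : ∫ x, ψ x = 0 := by
    rw [hψ, integral_sub (hφ.continuous.integrable_of_hasCompactSupport hφc)
      ((he1.continuous.integrable_of_hasCompactSupport he2).const_mul _), integral_const_mul, he3]
    simp [hI]
  set χ : ℝ → ℝ := fun x => ∫ t in (0 : ℝ)..x, ψ t with hχ
  obtain ⟨R, hR⟩ : ∃ R : ℝ, ∀ x, R < |x| → ψ x = 0 := by
    obtain ⟨R, hR⟩ := hψc.isCompact.isBounded.subset_closedBall (0 : ℝ)
    refine ⟨R, fun x hx => ?_⟩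
    by_contra hne
    have := hR (subset_tsupport _ hne)
    simp only [Metric.mem_closedBall, dist_zero_right, Real.norm_eq_abs] at this
    linarith
  have hii : Integrable ψ := hψs.continuous.integrable_of_hasCompactSupport hψc
  have hχd : ∀ x, HasDerivAt χ (ψ x) x := fun x =>
    intervalIntegral.integral_hasDerivAt_right (hii.intervalIntegrable)
      (hψs.continuous.stronglyMeasurableAtFilter _ _) hψs.continuous.continuousAt
  -- The primitive is normalised at `-∞`: it vanishes to the left of the support of `ψ`, and to the
  -- right of it because `∫ ψ = 0`.
  set χ0 : ℝ → ℝ := fun x => χ x + ∫ t in Iic 0, ψ t with hχ0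
  have hχ0' : ∀ x, χ0 x = ∫ t in Iic x, ψ t := fun x => by
    have := intervalIntegral.integral_Iic_sub_Iic (hii.integrableOn (s := Iic 0))
      (hii.integrableOn (s := Iic x))
    simp only [hχ0, hχ, ← this]; ring
  have hd : ∀ x, HasDerivAt χ0 (ψ x) x := fun x => (hχd x).add_const _
  have hder : deriv χ0 = ψ := funext fun x => (hd x).deriv
  have htest : IsTestFunction χ0 := by
    constructor
    · rw [contDiff_infty_iff_deriv]
      exact ⟨fun x => (hd x).differentiableAt, by rw [hder]; exact hψs⟩
    · apply HasCompactSupport.of_support_subset_isCompact (K := Icc (-R) R) isCompact_Icc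
      intro x hx
      by_contra hne
      apply hx
      rw [hχ0' x]
      rw [mem_Icc, not_and_or] at hne
      by_cases hx1 : x < -R
      · apply setIntegral_eq_zero_of_forall_eq_zero
        intro t ht
        apply hR
        have : t < -R := lt_of_le_of_lt ht hx1
        have := neg_abs_le t
        linarith
      · have hx2 : R < x := by
          rcases hne with h | h <;> [exact absurd (not_le.1 h) hx1; exact not_le.1 h]
        rw [setIntegral_eq_integral_of_forall_compl_eq_zero, hψi]
        intro t ht
        apply hR
        have : x < t := not_le.1 ht
        have := le_abs_self t
        linarith
  have hz := h χ0 htest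
  rw [hder] at hz
  have i1 : Integrable (fun x => (φ x) • u x) :=
    hu.integrable_smul_left_of_hasCompactSupport hφ.continuous hφc
  have i2 : Integrable (fun x => (e x) • u x) :=
    hu.integrable_smul_left_of_hasCompactSupport he1.continuous he2
  have h3 : ∫ x, u x * ((ψ x : ℝ) : ℂ) = (∫ x, φ x • u x) - I * c := by
    have : (fun x => u x * ((ψ x : ℝ) : ℂ)) = fun x => φ x • u x - (I : ℂ) * (e x • u x) := by
      funext x; simp only [hψ, Complex.real_smul]; push_cast; ring
    rw [this, integral_sub i1 (i2.const_mul _), integral_const_mul, hc]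
    congr 3
    funext x; rw [Complex.real_smul, mul_comm]
  rw [h3, sub_eq_zero] at hz
  rw [hz, integral_smul_const, Complex.real_smul]

theorem ae_norm_le_of_memLp_top {v : ℝ → ℂ} {K : Set ℝ} (hKm : MeasurableSet K)
    (h : MemLp v ⊤ (volume.restrict K)) : ∃ C : ℝ, 0 ≤ C ∧ ∀ᵐ x, x ∈ K → ‖v x‖ ≤ C := by
  refine ⟨(eLpNorm v ⊤ (volume.restrict K)).toReal, ENNReal.toReal_nonneg, ?_⟩
  have h1 := ae_le_eLpNormEssSup (f := v) (μ := volume.restrict K)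
  rw [ae_restrict_iff' hKm] at h1
  filter_upwards [h1] with x hx hxK
  have h2 := hx hxK
  rw [eLpNorm_exponent_top]
  have h3 : eLpNormEssSup v (volume.restrict K) ≠ ⊤ := by
    have := h.2.ne; rwa [eLpNorm_exponent_top] at this
  have := ENNReal.toReal_mono h3 h2
  simpa using this

theorem _root_.LocallyLipschitz.mul_ofReal {f : ℝ → ℂ} {φ : ℝ → ℝ} (hf : LocallyLipschitz f)
    (hφ : LocallyLipschitz φ) : LocallyLipschitz (fun x => f x * ((φ x : ℝ) : ℂ)) := by
  have h1 : ContDiff ℝ 1 (fun p : ℂ × ℝ => p.1 * ((p.2 : ℝ) : ℂ)) :=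
    contDiff_fst.mul (Complex.ofRealCLM.contDiff.comp contDiff_snd)
  exact (h1.locallyLipschitz (𝕂 := ℝ)).comp (hf.prodMk hφ)

/-- The primitive `Φ` of `v` is locally Lipschitz because `v` is locally bounded. Integration by
parts shows that `u - Φ` has weak derivative zero, hence is constant. -/
theorem HasWeakDeriv.exists_locallyLipschitz {u v : ℝ → ℂ} (h : HasWeakDeriv u v)
    (hb : ∀ K : Set ℝ, IsCompact K → MemLp v ⊤ (volume.restrict K)) :
    ∃ U : ℝ → ℂ, LocallyLipschitz U ∧ (∀ᵐ x, U x = u x) ∧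
      ∀ x, U x = U 0 + ∫ t in (0 : ℝ)..x, v t := by
  obtain ⟨hu, hv, hw⟩ := h
  have hvi : ∀ a b : ℝ, IntervalIntegrable v volume a b := fun a b =>
    intervalIntegrable_iff.mpr <|
      (hv.integrableOn_isCompact isCompact_uIcc).mono_set uIoc_subset_uIcc
  set Φ : ℝ → ℂ := fun x => ∫ t in (0 : ℝ)..x, v t with hΦ
  have hΦL : LocallyLipschitz Φ := by
    intro x
    obtain ⟨C, hC0, hC⟩ := ae_norm_le_of_memLp_top measurableSet_Icc (hb (Icc (x - 1) (x + 1)) isCompact_Icc)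
    refine ⟨⟨C, hC0⟩, Icc (x - 1) (x + 1), Icc_mem_nhds (by linarith) (by linarith), ?_⟩
    apply LipschitzOnWith.of_dist_le_mul
    intro y hy z hz
    have : Φ y - Φ z = ∫ t in z..y, v t := by
      simp only [hΦ]; rw [intervalIntegral.integral_interval_sub_left (hvi _ _) (hvi _ _)]
    rw [dist_eq_norm, this, Real.dist_eq]
    apply intervalIntegral.norm_integral_le_of_norm_le_const_ae
    filter_upwards [hC] with t ht ht'
    exact ht (ordConnected_Icc.uIcc_subset hz hy (uIoc_subset_uIcc ht'))
  have hΦd := _root_.LocallyIntegrable.ae_hasDerivAt_integral hv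
  have hΦc : Continuous Φ := hΦL.continuous
  have key : ∀ φ : ℝ → ℝ, IsTestFunction φ →
      ∫ x, (u x - Φ x) * ((deriv φ x : ℝ) : ℂ) = 0 := by
    intro φ hφ
    have hφd : ∀ x, HasDerivAt φ (deriv φ x) x := fun x =>
      (hφ.1.differentiable (by simp) x).hasDerivAt
    have hdc : Continuous (deriv φ) := hφ.1.continuous_deriv (by simp)
    have hds : HasCompactSupport (deriv φ) := hφ.2.deriv
    obtain ⟨R, hR0, hR⟩ : ∃ R : ℝ, 0 ≤ R ∧ tsupport φ ⊆ Ioo (-R) R := by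
      obtain ⟨R, hR⟩ := hφ.2.isCompact.isBounded.subset_closedBall (0 : ℝ)
      refine ⟨|R| + 1, by positivity, fun x hx => ?_⟩
      have := hR hx
      simp only [Metric.mem_closedBall, dist_zero_right, Real.norm_eq_abs] at this
      have h1 := abs_le.1 this
      have h2 := le_abs_self R
      constructor <;> linarith
    have hφ0 : ∀ x, x ∉ Ioo (-R) R → φ x = 0 := fun x hx =>
      image_eq_zero_of_notMem_tsupport fun h => hx (hR h)
    have hφd0 : ∀ x, x ∉ Ioo (-R) R → deriv φ x = 0 := fun x hx =>
      image_eq_zero_of_notMem_tsupport fun h => hx (hR (tsupport_deriv_subset (𝕜 := ℝ) h))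
    have i1 : Integrable (fun x => u x * ((deriv φ x : ℝ) : ℂ)) := by
      have := hu.integrable_smul_left_of_hasCompactSupport hdc hds
      refine this.congr (Eventually.of_forall fun x => ?_)
      simp [Complex.real_smul, mul_comm]
    have i2 : Integrable (fun x => Φ x * ((deriv φ x : ℝ) : ℂ)) := by
      have := hΦc.locallyIntegrable (μ := volume) |>.integrable_smul_left_of_hasCompactSupport hdc hds
      refine this.congr (Eventually.of_forall fun x => ?_)
      simp [Complex.real_smul, mul_comm]
    have i3 : Integrable (fun x => v x * ((φ x : ℝ) : ℂ)) := by
      have := hv.integrable_smul_left_of_hasCompactSupport hφ.1.continuous hφ.2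
      refine this.congr (Eventually.of_forall fun x => ?_)
      simp [Complex.real_smul, mul_comm]
    have hφL : LocallyLipschitz φ := (hφ.1.of_le (by simp)).locallyLipschitz
    have hprod : LocallyLipschitz (fun x => Φ x * ((φ x : ℝ) : ℂ)) := hΦL.mul_ofReal hφL
    have hftc := (integral_eq_sub_of_locallyLipschitzOn (a := -R) (b := R)
      (f := fun x => Φ x * ((φ x : ℝ) : ℂ))
      (f' := fun x => v x * ((φ x : ℝ) : ℂ) + Φ x * ((deriv φ x : ℝ) : ℂ))
      (hprod.locallyLipschitzOn) (by
        filter_upwards [hΦd] with x hx _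
        exact (hx 0).mul (hφd x).ofReal_comp)).2
    rw [hφ0 R (by simp), hφ0 (-R) (by simp)] at hftc
    have hwhole : ∫ x, (v x * ((φ x : ℝ) : ℂ) + Φ x * ((deriv φ x : ℝ) : ℂ)) = 0 := by
      rw [← setIntegral_eq_integral_of_forall_compl_eq_zero (s := Ioc (-R) R),
        ← intervalIntegral.integral_of_le (by linarith), hftc]
      · simp
      · intro x hx
        have : x ∉ Ioo (-R) R := fun h => hx ⟨h.1, h.2.le⟩
        simp [hφ0 x this, hφd0 x this]
    rw [integral_add i3 i2] at hwhole
    have h4 := hw φ hφ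
    simp only [sub_mul]
    rw [integral_sub i1 i2, h4]
    linear_combination -hwhole
  obtain ⟨c, hc⟩ := HasWeakDeriv.ae_eq_const (hu.sub (hΦc.locallyIntegrable)) key
  refine ⟨fun x => c + Φ x, ?_, ?_, ?_⟩
  · have h1 : ContDiff ℝ 1 (fun z : ℂ => c + z) := contDiff_const.add contDiff_id
    exact h1.locallyLipschitz.comp hΦL
  · filter_upwards [hc] with x hx
    simp only [Pi.sub_apply] at hx
    rw [← hx]; ring
  · intro x; simp [hΦ]

/-! ### The classical derivatives of the potential -/

/-- `E 0 = V, E 1, …, E n` are the classical derivatives of a function of class `C^{n,1}_loc`, and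
`E (n + 1)` is the almost everywhere derivative of `E n`. -/
structure IsClassicalJet (n : ℕ) (V : ℝ → ℂ) (E : ℕ → ℝ → ℂ) : Prop where
  zero : E 0 = V
  hasDerivAt : ∀ m < n, ∀ x, HasDerivAt (E m) (E (m + 1) x) x
  locallyLipschitz : ∀ m ≤ n, LocallyLipschitz (E m)
  ae_hasDerivAt : ∀ᵐ x, HasDerivAt (E n) (E (n + 1) x) x
  ae_bounded : ∀ R : ℝ, ∃ C : ℝ, ∀ᵐ x, |x| ≤ R → ‖E (n + 1) x‖ ≤ C

/-- The Lipschitz representatives are primitives of one another. Below order `n` the integrand is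
continuous and the derivative exists everywhere; at order `n` it is only locally integrable, and
Lebesgue differentiation gives the derivative almost everywhere. -/
theorem IsSobolevLocInfty.exists_jet {n : ℕ} {V : ℝ → ℂ} {D : ℕ → ℝ → ℂ} (hV : Continuous V)
    (h : IsSobolevLocInfty (n + 1) V D) :
    ∃ E : ℕ → ℝ → ℂ, IsClassicalJet n V E ∧ ∀ m ≤ n + 1, ∀ᵐ x, E m x = D m x := by
  have hex : ∀ m, ∃ U : ℝ → ℂ, m ≤ n → LocallyLipschitz U ∧ (∀ᵐ x, U x = D m x) ∧
      ∀ x, U x = U 0 + ∫ t in (0 : ℝ)..x, D (m + 1) t := by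
    intro m
    by_cases hm : m ≤ n
    · obtain ⟨U, hU⟩ := (h.succ m (by omega)).exists_locallyLipschitz
        (fun K hK => h.locBounded (m + 1) (by omega) K hK)
      exact ⟨U, fun _ => hU⟩
    · exact ⟨0, fun h => absurd h hm⟩
  choose F hF using hex
  set E : ℕ → ℝ → ℂ := fun m => if m ≤ n then F m else D m with hE
  have hEm : ∀ m ≤ n, E m = F m := fun m hm => by simp [hE, hm]
  have hED : ∀ m ≤ n + 1, ∀ᵐ x, E m x = D m x := by
    intro m hm
    by_cases h1 : m ≤ n
    · rw [hEm m h1]; exact (hF m h1).2.1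
    · simp [hE, h1]
  have hprim : ∀ m ≤ n, ∀ x, E m x = E m 0 + ∫ t in (0 : ℝ)..x, E (m + 1) t := by
    intro m hm x
    rw [hEm m hm, (hF m hm).2.2 x]
    congr 1
    apply intervalIntegral.integral_congr_ae
    filter_upwards [hED (m + 1) (by omega)] with t ht _
    exact ht.symm
  have hli : ∀ m ≤ n + 1, LocallyIntegrable (D m) volume := by
    intro m hm
    rcases m with _ | m
    · exact (h.succ 0 (by omega)).1
    · exact (h.succ m (by omega)).2.1
  refine ⟨E, ⟨?_, ?_, ?_, ?_, ?_⟩, hED⟩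
  · rw [hEm 0 (by omega)]
    apply Continuous.ae_eq_iff_eq volume (hF 0 (by omega)).1.continuous hV |>.1
    filter_upwards [(hF 0 (by omega)).2.1] with x hx
    rw [hx, h.zero]
  · intro m hm x
    have hc : Continuous (E (m + 1)) := by
      rw [hEm (m + 1) hm]; exact (hF (m + 1) hm).1.continuous
    have h1 : E m = fun x => E m 0 + ∫ t in (0 : ℝ)..x, E (m + 1) t := funext (hprim m hm.le)
    rw [h1]
    simpa using (intervalIntegral.integral_hasDerivAt_right (hc.intervalIntegrable 0 x)
      (hc.stronglyMeasurableAtFilter _ _) hc.continuousAt).const_add (E m 0)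
  · intro m hm
    rw [hEm m hm]; exact (hF m hm).1
  · have h1 : E n = fun x => E n 0 + ∫ t in (0 : ℝ)..x, E (n + 1) t := funext (hprim n le_rfl)
    have h2 : E (n + 1) = D (n + 1) := by simp [hE]
    filter_upwards [_root_.LocallyIntegrable.ae_hasDerivAt_integral (hli (n + 1) le_rfl)] with x hx
    rw [h1, h2]
    simpa using (hx 0).const_add (E n 0)
  · intro R
    obtain ⟨C, _, hC⟩ := ae_norm_le_of_memLp_top measurableSet_Icc
      (h.locBounded (n + 1) le_rfl (Icc (-R) R) isCompact_Icc)
    refine ⟨C, ?_⟩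
    filter_upwards [hC, hED (n + 1) le_rfl] with x hx h1 h2
    rw [h1]
    exact hx (abs_le.1 h2)

/-! ### Weighted homogeneous symbols -/

open MvPolynomial in
/-- The derivation with `X_m ↦ X_{m+1} + X_m X_1`, which describes the differentiation of
`w_m = V^{(m)} / (λ - V)`. -/
def jetDerivation : Derivation ℂ (MvPolynomial ℕ ℂ) (MvPolynomial ℕ ℂ) :=
  mkDerivation ℂ (fun m => X (m + 1) + X m * X 1)

/-- Polynomials in `X_1, X_2, …` without constant term, homogeneous of weight `j` if `X_m` has
weight `m`. -/
inductive IsSymbol : ℕ → MvPolynomial ℕ ℂ → Prop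
  | zero (j : ℕ) : IsSymbol j 0
  | X (m : ℕ) (hm : 1 ≤ m) : IsSymbol m (MvPolynomial.X m)
  | add {j : ℕ} {p q : MvPolynomial ℕ ℂ} : IsSymbol j p → IsSymbol j q → IsSymbol j (p + q)
  | smul {j : ℕ} (c : ℂ) {p : MvPolynomial ℕ ℂ} : IsSymbol j p → IsSymbol j (MvPolynomial.C c * p)
  | mul {i j : ℕ} {p q : MvPolynomial ℕ ℂ} : IsSymbol i p → IsSymbol j q → IsSymbol (i + j) (p * q)

theorem IsSymbol.neg {j : ℕ} {p : MvPolynomial ℕ ℂ} (hp : IsSymbol j p) : IsSymbol j (-p) := by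
  have := hp.smul (-1)
  simpa using this

theorem IsSymbol.sub {j : ℕ} {p q : MvPolynomial ℕ ℂ} (hp : IsSymbol j p) (hq : IsSymbol j q) :
    IsSymbol j (p - q) := by
  rw [sub_eq_add_neg]; exact hp.add hq.neg

theorem IsSymbol.sum {ι : Type*} {j : ℕ} (s : Finset ι) {p : ι → MvPolynomial ℕ ℂ}
    (hp : ∀ i ∈ s, IsSymbol j (p i)) : IsSymbol j (∑ i ∈ s, p i) := by
  classical
  induction s using Finset.induction_on with
  | empty => simpa using IsSymbol.zero j
  | insert a s ha ih =>
    rw [Finset.sum_insert ha]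
    exact (hp a (by simp)).add (ih fun i hi => hp i (by simp [hi]))

theorem IsSymbol.jetDerivation {j : ℕ} {p : MvPolynomial ℕ ℂ} (hp : IsSymbol j p) :
    IsSymbol (j + 1) (jetDerivation p) := by
  induction hp with
  | zero j => simpa using IsSymbol.zero (j + 1)
  | X m hm =>
    rw [Pseudomode.jetDerivation, MvPolynomial.mkDerivation_X]
    exact (IsSymbol.X (m + 1) (by omega)).add ((IsSymbol.X m hm).mul (IsSymbol.X 1 le_rfl))
  | add _ _ h1 h2 => rw [map_add]; exact h1.add h2
  | smul c _ h =>
    rw [← MvPolynomial.smul_eq_C_mul, Derivation.map_smul, MvPolynomial.smul_eq_C_mul]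
    exact h.smul c
  | @mul i j p q h1 h2 h3 h4 =>
    rw [Derivation.leibniz, smul_eq_mul, smul_eq_mul]
    have e1 : IsSymbol (i + j + 1) (q * Pseudomode.jetDerivation p) := by
      have := h2.mul h3; rwa [show j + (i + 1) = i + j + 1 by ring] at this
    exact (h1.mul h4).add e1

/-- Without a constant term every monomial carries at least one factor of size `v`. Surplus factors
`v` are absorbed by `v ≤ B`, and the weights add up to `t ^ j`. -/
theorem IsSymbol.norm_eval_le {j : ℕ} {p : MvPolynomial ℕ ℂ} (hp : IsSymbol j p) {B : ℝ}
    (hB : 0 ≤ B) : ∃ C : ℝ, 0 ≤ C ∧ ∀ (w : ℕ → ℂ) (v t : ℝ), 0 ≤ v → v ≤ B → 0 ≤ t →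
      (∀ m, 1 ≤ m → m ≤ j → ‖w m‖ ≤ B * v * t ^ m) → ‖MvPolynomial.eval w p‖ ≤ C * v * t ^ j := by
  induction hp with
  | zero j => exact ⟨0, le_rfl, fun w v t _ _ _ _ => by simp⟩
  | X m hm => exact ⟨B, hB, fun w v t _ _ _ h => by simpa using h m hm le_rfl⟩
  | add _ _ h1 h2 =>
    obtain ⟨C1, hC1, h1⟩ := h1
    obtain ⟨C2, hC2, h2⟩ := h2
    refine ⟨C1 + C2, by positivity, fun w v t hv hv' ht h => ?_⟩
    rw [map_add]
    have := norm_add_le_of_le (h1 w v t hv hv' ht h) (h2 w v t hv hv' ht h)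
    linarith
  | smul c _ h1 =>
    obtain ⟨C1, hC1, h1⟩ := h1
    refine ⟨‖c‖ * C1, by positivity, fun w v t hv hv' ht h => ?_⟩
    rw [map_mul, MvPolynomial.eval_C, norm_mul, mul_assoc, mul_assoc, ← mul_assoc C1]
    exact mul_le_mul_of_nonneg_left (h1 w v t hv hv' ht h) (norm_nonneg _)
  | @mul i j p q _ _ h1 h2 =>
    obtain ⟨C1, hC1, h1⟩ := h1
    obtain ⟨C2, hC2, h2⟩ := h2
    refine ⟨C1 * C2 * B, by positivity, fun w v t hv hv' ht h => ?_⟩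
    rw [map_mul, norm_mul]
    have a1 := h1 w v t hv hv' ht fun m hm hm' => h m hm (by omega)
    have a2 := h2 w v t hv hv' ht fun m hm hm' => h m hm (by omega)
    calc _ ≤ (C1 * v * t ^ i) * (C2 * v * t ^ j) :=
          mul_le_mul a1 a2 (norm_nonneg _) (by positivity)
      _ = C1 * C2 * v * v * t ^ (i + j) := by ring
      _ ≤ C1 * C2 * B * v * t ^ (i + j) := by gcongr

/-- Only the variables of index at most `j` have to be differentiable, since no other variable
occurs in a symbol of weight `j`. This is why `n + 1` derivatives of `V` suffice for `T_n'`. -/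
theorem IsSymbol.hasDerivAt_eval {j : ℕ} {p : MvPolynomial ℕ ℂ} (hp : IsSymbol j p)
    {w : ℝ → ℕ → ℂ} {x : ℝ} (hw : ∀ m, 1 ≤ m → m ≤ j →
      HasDerivAt (fun y => w y m) (w x (m + 1) + w x m * w x 1) x) :
    HasDerivAt (fun y => MvPolynomial.eval (w y) p)
      (MvPolynomial.eval (w x) (Pseudomode.jetDerivation p)) x := by
  induction hp with
  | zero j => simpa using hasDerivAt_const x (0 : ℂ)
  | X m hm =>
    simpa [Pseudomode.jetDerivation, MvPolynomial.mkDerivation_X] using hw m hm le_rfl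
  | add _ _ h1 h2 =>
    simp only [map_add]
    exact (h1 hw).add (h2 hw)
  | smul c _ h1 =>
    rw [← MvPolynomial.smul_eq_C_mul, Derivation.map_smul, MvPolynomial.smul_eq_C_mul]
    simp only [map_mul, MvPolynomial.smul_eq_C_mul, MvPolynomial.eval_C]
    exact (h1 hw).const_mul c
  | @mul i j p q _ _ h1 h2 =>
    have a1 := h1 fun m hm hm' => hw m hm (by omega)
    have a2 := h2 fun m hm hm' => hw m hm (by omega)
    simp only [map_mul, Derivation.leibniz, smul_eq_mul, map_add]
    refine (a1.mul a2).congr_deriv ?_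
    ring

/-! ### Stability of local Lipschitz continuity -/

theorem _root_.LocallyLipschitzOn.comp_contDiffAt {E F G : Type*} [PseudoEMetricSpace E]
    [NormedAddCommGroup F] [NormedSpace ℝ F] [NormedAddCommGroup G] [NormedSpace ℝ G]
    {f : E → F} {Φ : F → G} {s : Set E} (hf : LocallyLipschitzOn s f)
    (hΦ : ∀ x ∈ s, ContDiffAt ℝ 1 Φ (f x)) : LocallyLipschitzOn s (fun x => Φ (f x)) := by
  intro x hx
  obtain ⟨K, t, ht, hK⟩ := (hΦ x hx).exists_lipschitzOnWith
  obtain ⟨L, u, hu, hL⟩ := hf hx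
  refine ⟨K * L, u ∩ f ⁻¹' t, inter_mem hu (hf.continuousOn x hx ht), ?_⟩
  exact hK.comp (hL.mono inter_subset_left) fun y hy => hy.2

theorem _root_.LocallyLipschitzOn.prodMk {E F G : Type*} [PseudoEMetricSpace E]
    [PseudoEMetricSpace F] [PseudoEMetricSpace G] {f : E → F} {g : E → G} {s : Set E}
    (hf : LocallyLipschitzOn s f) (hg : LocallyLipschitzOn s g) :
    LocallyLipschitzOn s (fun x => (f x, g x)) := by
  intro x hx
  obtain ⟨K, t, ht, hK⟩ := hf hx
  obtain ⟨L, u, hu, hL⟩ := hg hx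
  exact ⟨max K L, t ∩ u, inter_mem ht hu,
    (hK.mono inter_subset_left).prodMk (hL.mono inter_subset_right)⟩

theorem _root_.LocallyLipschitzOn.fun_mul {E : Type*} [PseudoEMetricSpace E] {f g : E → ℂ}
    {s : Set E} (hf : LocallyLipschitzOn s f) (hg : LocallyLipschitzOn s g) :
    LocallyLipschitzOn s (fun x => f x * g x) :=
  (hf.prodMk hg).comp_contDiffAt (Φ := fun p : ℂ × ℂ => p.1 * p.2)
    fun _ _ => (contDiff_fst.mul contDiff_snd).contDiffAt

theorem _root_.LocallyLipschitzOn.fun_add {E : Type*} [PseudoEMetricSpace E] {f g : E → ℂ}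
    {s : Set E} (hf : LocallyLipschitzOn s f) (hg : LocallyLipschitzOn s g) :
    LocallyLipschitzOn s (fun x => f x + g x) :=
  (hf.prodMk hg).comp_contDiffAt (Φ := fun p : ℂ × ℂ => p.1 + p.2)
    fun _ _ => (contDiff_fst.add contDiff_snd).contDiffAt

theorem locallyLipschitzOn_const {E : Type*} [PseudoEMetricSpace E] (c : ℂ) (s : Set E) :
    LocallyLipschitzOn s (fun _ => c) := fun _ _ =>
  ⟨0, univ, univ_mem, LipschitzWith.const c |>.lipschitzOnWith⟩

theorem _root_.LocallyLipschitzOn.finset_sum {ι E : Type*} [PseudoEMetricSpace E] {s : Set E}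
    (u : Finset ι) {f : ι → E → ℂ} (hf : ∀ i ∈ u, LocallyLipschitzOn s (f i)) :
    LocallyLipschitzOn s (fun x => ∑ i ∈ u, f i x) := by
  classical
  induction u using Finset.induction_on with
  | empty => simpa using locallyLipschitzOn_const 0 s
  | insert a u ha ih =>
    simp only [Finset.sum_insert ha]
    exact (hf a (by simp)).fun_add (ih fun i hi => hf i (by simp [hi]))

theorem IsSymbol.locallyLipschitzOn_eval {j : ℕ} {p : MvPolynomial ℕ ℂ} (hp : IsSymbol j p)
    {w : ℝ → ℕ → ℂ} {s : Set ℝ} (hw : ∀ m, 1 ≤ m → m ≤ j →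
      LocallyLipschitzOn s (fun y => w y m)) :
    LocallyLipschitzOn s (fun y => MvPolynomial.eval (w y) p) := by
  induction hp with
  | zero j => simpa using locallyLipschitzOn_const 0 s
  | X m hm => simpa using hw m hm le_rfl
  | add _ _ h1 h2 => simpa using (h1 hw).fun_add (h2 hw)
  | smul c _ h1 => simpa using (locallyLipschitzOn_const c s).fun_mul (h1 hw)
  | @mul i j p q _ _ h1 h2 =>
    simp only [map_mul]
    exact (h1 fun m hm hm' => hw m hm (by omega)).fun_mul (h2 fun m hm hm' => hw m hm (by omega))

/-! ### Closed form of the terms of the expansion -/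

open MvPolynomial in
/-- The polynomials `p_j` with `λ^{-(j-1)/2} ψ'_{j-1} = (λ - V)^{(1-j)/2} p_j(w)`, where
`w_m = V^{(m)} / (λ - V)`. -/
def wkbSymbol : ℕ → MvPolynomial ℕ ℂ
  | 0 => C Complex.I
  | (j + 1) => C (1 / (2 * Complex.I)) *
      (C (((j : ℂ) - 1) / 2) * (X 1 * wkbSymbol j) + jetDerivation (wkbSymbol j)
        - ∑ a : Fin j, wkbSymbol (a.1 + 1) * wkbSymbol (j - a.1))
  decreasing_by all_goals omega

theorem isSymbol_wkbSymbol : ∀ j, 1 ≤ j → IsSymbol j (wkbSymbol j) := by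
  intro j
  induction j using Nat.strong_induction_on with
  | _ j ih =>
    intro hj
    obtain ⟨j, rfl⟩ : ∃ k, j = k + 1 := ⟨j - 1, by omega⟩
    rw [wkbSymbol]
    apply IsSymbol.smul
    -- The constant `p_0 = i` is not a symbol. In `p_1` its derivation vanishes and the sum is
    -- empty, so only the multiple of `X_1` survives.
    rcases Nat.eq_zero_or_pos j with rfl | hj0
    · rw [wkbSymbol]
      have h1 : IsSymbol 1 (MvPolynomial.X 1 * MvPolynomial.C Complex.I) := by
        rw [mul_comm]; exact (IsSymbol.X 1 le_rfl).smul _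
      simpa [Pseudomode.jetDerivation, MvPolynomial.derivation_C] using h1.smul _
    · refine ((IsSymbol.smul _ ?_).add (ih j (by omega) hj0).jetDerivation).sub
        (IsSymbol.sum _ fun a _ => ?_)
      · rw [add_comm]; exact (IsSymbol.X 1 le_rfl).mul (ih j (by omega) hj0)
      · have := (ih (a.1 + 1) (by omega) (by omega)).mul (ih (j - a.1) (by omega) (by omega))
        rwa [show a.1 + 1 + (j - a.1) = j + 1 by omega] at this

/-- The square root `(λ - V)^{1/2}`. -/
def wkbSqrt (V : ℝ → ℂ) (lam : ℝ) (x : ℝ) : ℂ := ((lam : ℂ) - V x) ^ ((1 / 2 : ℝ) : ℂ)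

/-- The variables `w_m = V^{(m)} / (λ - V)`. -/
def wkbVar (V : ℝ → ℂ) (E : ℕ → ℝ → ℂ) (lam x : ℝ) (m : ℕ) : ℂ := E m x / ((lam : ℂ) - V x)

/-- The functions `λ^{-(j-1)/2} ψ'_{j-1}`, in closed form. -/
def wkbTerm (V : ℝ → ℂ) (E : ℕ → ℝ → ℂ) (lam : ℝ) (j : ℕ) (x : ℝ) : ℂ :=
  wkbSqrt V lam x ^ (1 - (j : ℤ)) * MvPolynomial.eval (wkbVar V E lam x) (wkbSymbol j)

/-- The almost everywhere derivatives of `wkbTerm`, in closed form. -/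
def wkbTermDeriv (V : ℝ → ℂ) (E : ℕ → ℝ → ℂ) (lam : ℝ) (j : ℕ) (x : ℝ) : ℂ :=
  wkbSqrt V lam x ^ (1 - (j : ℤ)) *
    (((j : ℂ) - 1) / 2 * (wkbVar V E lam x 1 * MvPolynomial.eval (wkbVar V E lam x) (wkbSymbol j))
      + MvPolynomial.eval (wkbVar V E lam x) (jetDerivation (wkbSymbol j)))

section pointwise

variable {V : ℝ → ℂ} {E : ℕ → ℝ → ℂ} {lam x : ℝ}

theorem sub_ne_zero_of_re_lt (h : (V x).re < lam) : (lam : ℂ) - V x ≠ 0 := by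
  intro h0
  have := congrArg Complex.re h0
  simp at this
  linarith

theorem sub_mem_slitPlane_of_re_lt (h : (V x).re < lam) : (lam : ℂ) - V x ∈ Complex.slitPlane := by
  left; simpa using h

theorem wkbSqrt_sq (V : ℝ → ℂ) (lam x : ℝ) : wkbSqrt V lam x ^ 2 = (lam : ℂ) - V x := by
  rw [wkbSqrt, ← Complex.cpow_nat_mul]
  simp

theorem wkbSqrt_ne_zero (h : (V x).re < lam) : wkbSqrt V lam x ≠ 0 := by
  intro h0
  have := wkbSqrt_sq V lam x
  rw [h0] at this
  exact sub_ne_zero_of_re_lt h (by rw [← this]; simp)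

theorem wkbSqrt_re_nonneg (V : ℝ → ℂ) (lam x : ℝ) : 0 ≤ (wkbSqrt V lam x).re := by
  by_cases h : (lam : ℂ) - V x = 0
  · rw [wkbSqrt, h, Complex.zero_cpow (by norm_num)]; simp
  rw [wkbSqrt, Complex.cpow_def_of_ne_zero h, Complex.exp_re]
  apply mul_nonneg (Real.exp_pos _).le
  have h1 := Complex.neg_pi_lt_arg ((lam : ℂ) - V x)
  have h2 := Complex.arg_le_pi ((lam : ℂ) - V x)
  apply Real.cos_nonneg_of_neg_pi_div_two_le_of_le
  · simp [Complex.log_im]; linarith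
  · simp [Complex.log_im]; linarith

theorem hasDerivAt_wkbSqrt (h : (V x).re < lam) (hV : E 0 = V)
    (hd : HasDerivAt (E 0) (E 1 x) x) :
    HasDerivAt (wkbSqrt V lam) (-(1 / 2) * wkbSqrt V lam x * wkbVar V E lam x 1) x := by
  rw [hV] at hd
  have h1 : HasDerivAt (fun y => (lam : ℂ) - V y) (-E 1 x) x := by
    simpa using hd.const_sub (lam : ℂ)
  have h2 := ((hasStrictDerivAt_id _).cpow_const (c := ((1 / 2 : ℝ) : ℂ))
    (sub_mem_slitPlane_of_re_lt h)).hasDerivAt.scomp x h1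
  refine h2.congr_deriv ?_
  have h0 := sub_ne_zero_of_re_lt h
  rw [wkbSqrt, wkbVar, id, Complex.cpow_sub _ _ h0, Complex.cpow_one, smul_eq_mul]
  push_cast
  field_simp

theorem hasDerivAt_wkbVar (h : (V x).re < lam) (hV : E 0 = V) {m : ℕ}
    (hd : HasDerivAt (E 0) (E 1 x) x) (hm : HasDerivAt (E m) (E (m + 1) x) x) :
    HasDerivAt (fun y => wkbVar V E lam y m)
      (wkbVar V E lam x (m + 1) + wkbVar V E lam x m * wkbVar V E lam x 1) x := by
  rw [hV] at hd
  have h1 : HasDerivAt (fun y => (lam : ℂ) - V y) (-E 1 x) x := by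
    simpa using hd.const_sub (lam : ℂ)
  have h0 := sub_ne_zero_of_re_lt h
  refine (hm.div h1 h0).congr_deriv ?_
  simp only [wkbVar]
  field_simp
  ring

/-- As `S' = -S w_1 / 2`, the power `S^{1-j}` contributes the factor `(j-1)/2 · w_1`. The rule `w_m'
= w_{m+1} + w_m w_1` is the one encoded in `jetDerivation`. -/
theorem hasDerivAt_wkbTerm (h : (V x).re < lam) (hV : E 0 = V) {j : ℕ}
    (hd : ∀ m ≤ j, HasDerivAt (E m) (E (m + 1) x) x) :
    HasDerivAt (wkbTerm V E lam j) (wkbTermDeriv V E lam j x) x := by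
  have hS := hasDerivAt_wkbSqrt h hV (hd 0 (Nat.zero_le _))
  have hS0 := wkbSqrt_ne_zero h
  have h1 : HasDerivAt (fun y => wkbSqrt V lam y ^ (1 - (j : ℤ))) (((1 - (j : ℤ) : ℤ) : ℂ) *
      wkbSqrt V lam x ^ (1 - (j : ℤ) - 1) * (-(1 / 2) * wkbSqrt V lam x * wkbVar V E lam x 1)) x := by
    have := (hasDerivAt_zpow (1 - (j : ℤ)) (wkbSqrt V lam x) (Or.inl hS0)).scomp x hS
    refine this.congr_deriv ?_
    rw [smul_eq_mul]; ring
  have h2 : HasDerivAt (fun y => MvPolynomial.eval (wkbVar V E lam y) (wkbSymbol j))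
      (MvPolynomial.eval (wkbVar V E lam x) (jetDerivation (wkbSymbol j))) x := by
    rcases Nat.eq_zero_or_pos j with rfl | hj
    · simpa [wkbSymbol, Pseudomode.jetDerivation, MvPolynomial.derivation_C] using
        hasDerivAt_const x Complex.I
    · exact (isSymbol_wkbSymbol j hj).hasDerivAt_eval fun m _ hm' =>
        hasDerivAt_wkbVar h hV (hd 0 (Nat.zero_le _)) (hd m hm')
  refine (h1.mul h2).congr_deriv ?_
  rw [wkbTermDeriv, zpow_sub_one₀ hS0]
  push_cast
  field_simp
  ring

/-- The recurrence between the terms of the expansion. -/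
theorem wkbTermDeriv_eq (h : (V x).re < lam) (j : ℕ) :
    wkbTermDeriv V E lam j x = 2 * wkbTerm V E lam 0 x * wkbTerm V E lam (j + 1) x
      + ∑ a : Fin j, wkbTerm V E lam (a.1 + 1) x * wkbTerm V E lam (j - a.1) x := by
  have hS0 := wkbSqrt_ne_zero h
  have h1 : ∀ a : Fin j, wkbTerm V E lam (a.1 + 1) x * wkbTerm V E lam (j - a.1) x
      = wkbSqrt V lam x ^ (1 - (j : ℤ)) * (MvPolynomial.eval (wkbVar V E lam x)
        (wkbSymbol (a.1 + 1) * wkbSymbol (j - a.1))) := by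
    intro a
    rw [wkbTerm, wkbTerm, map_mul, mul_mul_mul_comm, ← zpow_add₀ hS0]
    congr 2
    have := a.2
    push_cast [Nat.cast_sub this.le]
    ring
  rw [Finset.sum_congr rfl fun a _ => h1 a, ← Finset.mul_sum, ← map_sum]
  have h2 : 2 * wkbTerm V E lam 0 x * wkbTerm V E lam (j + 1) x
      = wkbSqrt V lam x ^ (1 - (j : ℤ)) * (2 * Complex.I *
        MvPolynomial.eval (wkbVar V E lam x) (wkbSymbol (j + 1))) := by
    rw [wkbTerm, wkbTerm]
    have : wkbSqrt V lam x ^ (1 - (j : ℤ)) =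
        wkbSqrt V lam x ^ (1 - ((0 : ℕ) : ℤ)) * wkbSqrt V lam x ^ (1 - ((j + 1 : ℕ) : ℤ)) := by
      rw [← zpow_add₀ hS0]; congr 1; push_cast; ring
    rw [this]
    rw [show wkbSymbol 0 = MvPolynomial.C Complex.I by rw [wkbSymbol], MvPolynomial.eval_C]
    ring
  rw [h2, wkbTermDeriv, wkbSymbol]
  simp only [map_mul, map_sub, map_add, MvPolynomial.eval_C, MvPolynomial.eval_X, map_sum]
  have hI : Complex.I ≠ 0 := Complex.I_ne_zero
  field_simp
  ring

end pointwise

/-- Each step of the recursion differentiates the preceding function, so its closed form is needed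
in a neighbourhood of `x`; the induction provides it because `Re V < λ` is an open condition. Only
indices below `n` get differentiated, where the derivatives of `V` are classical. -/
theorem wkbDeriv_eq {n : ℕ} {V : ℝ → ℂ} {E : ℕ → ℝ → ℂ} {lam : ℝ} (hlam : 0 < lam)
    (hE : IsClassicalJet n V E) :
    ∀ j ≤ n, ∀ x, (V x).re < lam →
      wkbDeriv V lam j x = ((lam ^ (((j : ℝ) - 1) / 2) : ℝ) : ℂ) * wkbTerm V E lam j x := by
  have hc : Continuous V := hE.zero ▸ (hE.locallyLipschitz 0 (Nat.zero_le _)).continuous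
  intro j
  induction j using Nat.strong_induction_on with
  | _ j ih =>
    intro hj x hx
    rcases j with _ | j
    · simp only [wkbDeriv, wkbTerm, wkbSymbol, wkbSqrt, MvPolynomial.eval_C]
      norm_num
      ring
    · have hO : ∀ᶠ y in 𝓝 x, (V y).re < lam :=
        (Complex.continuous_re.comp hc).continuousAt.eventually_lt continuousAt_const hx
      have hev : wkbDeriv V lam j =ᶠ[𝓝 x]
          fun y => ((lam ^ (((j : ℝ) - 1) / 2) : ℝ) : ℂ) * wkbTerm V E lam j y := by
        filter_upwards [hO] with y hy
        exact ih j (by omega) (by omega) y hy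
      have hd := (hasDerivAt_wkbTerm (lam := lam) hx hE.zero (j := j)
        fun m hm => hE.hasDerivAt m (by omega) x).const_mul ((lam ^ (((j : ℝ) - 1) / 2) : ℝ) : ℂ)
      have hdd := (hd.congr_of_eventuallyEq hev).deriv
      have hsum : ∀ a : Fin j, wkbDeriv V lam (a.1 + 1) x * wkbDeriv V lam (j - a.1) x =
          ((lam ^ (((j : ℝ) - 1) / 2) : ℝ) : ℂ) *
            (wkbTerm V E lam (a.1 + 1) x * wkbTerm V E lam (j - a.1) x) := by
        intro a
        rw [ih (a.1 + 1) (by omega) (by omega) x hx, ih (j - a.1) (by omega) (by omega) x hx,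
          mul_mul_mul_comm, ← Complex.ofReal_mul, ← Real.rpow_add hlam]
        congr 3
        push_cast [Nat.cast_sub a.2.le]
        ring
      have h0 : wkbDeriv V lam 0 x = ((lam ^ (-(1 / 2) : ℝ) : ℝ) : ℂ) * wkbTerm V E lam 0 x := by
        rw [ih 0 (by omega) (by omega) x hx]
        norm_num
      rw [wkbDeriv]
      beta_reduce
      rw [hdd, Finset.sum_congr rfl fun a _ => hsum a, ← Finset.mul_sum, h0,
        wkbTermDeriv_eq hx]
      have hne : wkbTerm V E lam 0 x ≠ 0 := by
        rw [wkbTerm, wkbSymbol, MvPolynomial.eval_C]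
        exact mul_ne_zero (zpow_ne_zero _ (wkbSqrt_ne_zero hx)) Complex.I_ne_zero
      have hl : ((lam ^ (((j : ℝ) - 1) / 2) : ℝ) : ℂ) = ((lam ^ (-(1 / 2) : ℝ) : ℝ) : ℂ) *
          ((lam ^ ((((j + 1 : ℕ) : ℝ) - 1) / 2) : ℝ) : ℂ) := by
        rw [← Complex.ofReal_mul, ← Real.rpow_add hlam]
        congr 2
        push_cast; ring
      have hl0 : ((lam ^ (-(1 / 2) : ℝ) : ℝ) : ℂ) ≠ 0 := by
        exact_mod_cast (Real.rpow_pos_of_pos hlam _).ne'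
      rw [hl]
      field_simp
      ring

/-! ### Regularity of the logarithmic derivative and of the ansatz -/

/-- Minus the logarithmic derivative of `wkbG`. -/
def wkbSum (V : ℝ → ℂ) (E : ℕ → ℝ → ℂ) (n : ℕ) (lam : ℝ) (x : ℝ) : ℂ :=
  ∑ j ∈ Finset.range (n + 1), wkbTerm V E lam j x

/-- The almost everywhere derivative of `wkbSum`. -/
def wkbSumDeriv (V : ℝ → ℂ) (E : ℕ → ℝ → ℂ) (n : ℕ) (lam : ℝ) (x : ℝ) : ℂ :=
  ∑ j ∈ Finset.range (n + 1), wkbTermDeriv V E lam j x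

section

variable {n : ℕ} {V : ℝ → ℂ} {E : ℕ → ℝ → ℂ} {lam : ℝ} {s : Set ℝ}

theorem IsClassicalJet.continuous (hE : IsClassicalJet n V E) : Continuous V :=
  hE.zero ▸ (hE.locallyLipschitz 0 (Nat.zero_le _)).continuous

theorem locallyLipschitzOn_wkbTerm (hE : IsClassicalJet n V E) (hs : ∀ x ∈ s, (V x).re < lam)
    {j : ℕ} (hj : j ≤ n) : LocallyLipschitzOn s (wkbTerm V E lam j) := by
  have hV : LocallyLipschitzOn s V :=
    (hE.zero ▸ hE.locallyLipschitz 0 (Nat.zero_le _)).locallyLipschitzOn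
  have hsub : LocallyLipschitzOn s (fun x => (lam : ℂ) - V x) :=
    hV.comp_contDiffAt (Φ := fun z => (lam : ℂ) - z)
      fun _ _ => (contDiff_const.sub contDiff_id).contDiffAt
  have hS : LocallyLipschitzOn s (wkbSqrt V lam) := by
    refine hsub.comp_contDiffAt (Φ := fun z : ℂ => z ^ ((1 / 2 : ℝ) : ℂ)) fun x hx => ?_
    have h1 : ContDiffAt ℂ 1 (fun z : ℂ => z ^ ((1 / 2 : ℝ) : ℂ)) ((lam : ℂ) - V x) :=
      (analyticAt_id.cpow analyticAt_const (sub_mem_slitPlane_of_re_lt (hs x hx))).contDiffAt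
    exact h1.restrict_scalars ℝ
  have hSz : LocallyLipschitzOn s (fun x => wkbSqrt V lam x ^ (1 - (j : ℤ))) := by
    refine hS.comp_contDiffAt (Φ := fun z : ℂ => z ^ (1 - (j : ℤ))) fun x hx => ?_
    have h0 := wkbSqrt_ne_zero (hs x hx)
    have h1 : ContDiffAt ℝ 1 (fun z : ℂ => z * (z ^ j)⁻¹) (wkbSqrt V lam x) :=
      contDiffAt_id.mul ((contDiffAt_id.pow j).inv (pow_ne_zero _ h0))
    refine h1.congr_of_eventuallyEq ?_
    filter_upwards [isOpen_ne.mem_nhds h0] with z hz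
    rw [zpow_sub₀ hz, zpow_one, zpow_natCast, div_eq_mul_inv]
  have hw : ∀ m ≤ n, LocallyLipschitzOn s (fun x => wkbVar V E lam x m) := by
    intro m hm
    have h1 : LocallyLipschitzOn s (fun x => ((lam : ℂ) - V x)⁻¹) :=
      hsub.comp_contDiffAt (Φ := fun z => z⁻¹)
        fun x hx => contDiffAt_inv ℝ (sub_ne_zero_of_re_lt (hs x hx))
    simpa only [wkbVar, div_eq_mul_inv] using
      (hE.locallyLipschitz m hm).locallyLipschitzOn.fun_mul h1
  refine hSz.fun_mul ?_
  rcases Nat.eq_zero_or_pos j with rfl | hj0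
  · simpa [wkbSymbol] using locallyLipschitzOn_const Complex.I s
  · exact (isSymbol_wkbSymbol j hj0).locallyLipschitzOn_eval fun m _ hm => hw m (hm.trans hj)

theorem locallyLipschitzOn_wkbSum (hE : IsClassicalJet n V E) (hs : ∀ x ∈ s, (V x).re < lam) :
    LocallyLipschitzOn s (wkbSum V E n lam) :=
  LocallyLipschitzOn.finset_sum _ fun _ hj =>
    locallyLipschitzOn_wkbTerm hE hs (Nat.lt_succ_iff.1 (Finset.mem_range.1 hj))

theorem IsClassicalJet.ae_hasDerivAt_all (hE : IsClassicalJet n V E) :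
    ∀ᵐ x, ∀ m ≤ n, HasDerivAt (E m) (E (m + 1) x) x := by
  filter_upwards [hE.ae_hasDerivAt] with x hx m hm
  rcases hm.lt_or_eq with h | rfl
  · exact hE.hasDerivAt m h x
  · exact hx

theorem ae_hasDerivAt_wkbSum (hE : IsClassicalJet n V E) :
    ∀ᵐ x, (V x).re < lam → HasDerivAt (wkbSum V E n lam) (wkbSumDeriv V E n lam x) x := by
  filter_upwards [hE.ae_hasDerivAt_all] with x hx hre
  exact HasDerivAt.fun_sum fun j hj => hasDerivAt_wkbTerm hre hE.zero fun m hm =>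
    hx m (hm.trans (Nat.lt_succ_iff.1 (Finset.mem_range.1 hj)))

variable {a b : ℝ}

/-- The powers `λ^{-(j-1)/2}` in the exponent cancel those in `wkbDeriv_eq`. -/
theorem wkbG_eq (hE : IsClassicalJet n V E) (hlam : 0 < lam) (ha : a ≤ 0) (hb : 0 ≤ b)
    (hs : ∀ x ∈ Icc a b, (V x).re < lam) {x : ℝ} (hx : x ∈ Icc a b) :
    wkbG V n lam x = Complex.exp (-∫ t in (0 : ℝ)..x, wkbSum V E n lam t) := by
  have hsub : uIcc 0 x ⊆ Icc a b := ordConnected_Icc.uIcc_subset ⟨ha, hb⟩ hx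
  rw [wkbG]
  congr 2
  unfold wkbSum
  rw [intervalIntegral.integral_finsetSum]
  · apply Finset.sum_congr rfl
    intro j hj
    rw [wkbPsi, ← intervalIntegral.integral_const_mul]
    apply intervalIntegral.integral_congr
    intro t ht
    beta_reduce
    rw [wkbDeriv_eq hlam hE j (Nat.lt_succ_iff.1 (Finset.mem_range.1 hj)) t (hs t (hsub ht)),
      ← mul_assoc, ← Complex.ofReal_mul, ← Real.rpow_add hlam]
    rw [show -((j : ℝ) - 1) / 2 + ((j : ℝ) - 1) / 2 = 0 by ring]
    simp
  · intro j hj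
    exact ((locallyLipschitzOn_wkbTerm hE hs
      (Nat.lt_succ_iff.1 (Finset.mem_range.1 hj))).continuousOn.mono hsub).intervalIntegrable

theorem hasDerivAt_wkbG (hE : IsClassicalJet n V E) (hlam : 0 < lam) (ha : a < 0) (hb : 0 < b)
    (hs : ∀ x ∈ Icc a b, (V x).re < lam) {x : ℝ} (hx : x ∈ Ioo a b) :
    HasDerivAt (wkbG V n lam) (-wkbSum V E n lam x * wkbG V n lam x) x := by
  have hP := (locallyLipschitzOn_wkbSum hE hs).continuousOn
  have hsub : uIcc 0 x ⊆ Icc a b :=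
    ordConnected_Icc.uIcc_subset ⟨ha.le, hb.le⟩ (Ioo_subset_Icc_self hx)
  have hmem : Icc a b ∈ 𝓝 x := Icc_mem_nhds hx.1 hx.2
  have h1 : HasDerivAt (fun y => ∫ t in (0 : ℝ)..y, wkbSum V E n lam t) (wkbSum V E n lam x) x :=
    intervalIntegral.integral_hasDerivAt_right ((hP.mono hsub).intervalIntegrable)
      ((hP.mono Ioo_subset_Icc_self).stronglyMeasurableAtFilter isOpen_Ioo x hx)
      (hP.continuousAt hmem)
  have h2 := h1.neg.cexp
  rw [wkbG_eq hE hlam ha.le hb.le hs (Ioo_subset_Icc_self hx), mul_comm]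
  refine h2.congr_of_eventuallyEq ?_
  filter_upwards [hmem] with y hy
  exact wkbG_eq hE hlam ha.le hb.le hs hy

theorem locallyLipschitzOn_wkbG (hE : IsClassicalJet n V E) (hlam : 0 < lam) (ha : a ≤ 0)
    (hb : 0 ≤ b) (hs : ∀ x ∈ Icc a b, (V x).re < lam) :
    LocallyLipschitzOn (Icc a b) (wkbG V n lam) := by
  have hP := (locallyLipschitzOn_wkbSum hE hs).continuousOn
  obtain ⟨K, hK⟩ := isCompact_Icc.exists_bound_of_continuousOn hP
  have hint : ∀ x ∈ Icc a b, IntervalIntegrable (wkbSum V E n lam) volume 0 x := fun x hx =>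
    (hP.mono (ordConnected_Icc.uIcc_subset ⟨ha, hb⟩ hx)).intervalIntegrable
  have h1 : LocallyLipschitzOn (Icc a b) (fun y => ∫ t in (0 : ℝ)..y, wkbSum V E n lam t) := by
    intro x hx
    refine ⟨K.toNNReal, Icc a b, self_mem_nhdsWithin, LipschitzOnWith.of_dist_le_mul ?_⟩
    intro y hy z hz
    rw [dist_eq_norm, intervalIntegral.integral_interval_sub_left (hint y hy) (hint z hz),
      Real.dist_eq]
    apply intervalIntegral.norm_integral_le_of_norm_le_const
    intro t ht
    exact (hK t (ordConnected_Icc.uIcc_subset hz hy (uIoc_subset_uIcc ht))).trans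
      (Real.le_coe_toNNReal K)
  have h2 := h1.comp_contDiffAt (Φ := fun z => Complex.exp (-z))
    fun x _ => (Complex.contDiff_exp.comp contDiff_neg).contDiffAt
  intro x hx
  obtain ⟨L, t, ht, hL⟩ := h2 hx
  refine ⟨L, t ∩ Icc a b, inter_mem ht self_mem_nhdsWithin, ?_⟩
  intro y hy z hz
  rw [wkbG_eq hE hlam ha hb hs hy.2, wkbG_eq hE hlam ha hb hs hz.2]
  exact hL hy.1 hz.1

end

/-! ### The pseudomode lies in the domain -/

/-- At a point outside the open interval, endpoints included, `F` vanishes on a half-line ending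
there, and the one-sided derivative determines the derivative. -/
theorem deriv_eq_zero_of_notMem_Ioo {F : ℝ → ℝ} {a b : ℝ} (hF : Differentiable ℝ F)
    (h0 : ∀ x ∉ Ioo a b, F x = 0) : ∀ x ∉ Ioo a b, deriv F x = 0 := by
  intro x hx
  have hd := (hF x).hasDerivAt
  rw [mem_Ioo, not_and_or, not_lt, not_lt] at hx
  rcases hx with hx | hx
  · have h1 : HasDerivWithinAt F 0 (Iic x) x :=
      (hasDerivWithinAt_const x (Iic x) (0 : ℝ)).congr
        (fun y hy => h0 y fun h => absurd h.1 (not_lt.2 (le_trans hy hx)))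
        (h0 x fun h => absurd h.1 (not_lt.2 hx))
    exact (uniqueDiffWithinAt_Iic x).eq_deriv _ hd.hasDerivWithinAt h1
  · have h1 : HasDerivWithinAt F 0 (Ici x) x :=
      (hasDerivWithinAt_const x (Ici x) (0 : ℝ)).congr
        (fun y hy => h0 y fun h => absurd h.2 (not_lt.2 (le_trans hx hy)))
        (h0 x fun h => absurd h.2 (not_lt.2 hx))
    exact (uniqueDiffWithinAt_Ici x).eq_deriv _ hd.hasDerivWithinAt h1

theorem memLp_of_ae_bound_Icc {F : ℝ → ℂ} {a b C : ℝ} {p : ℝ≥0∞}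
    (hm : AEStronglyMeasurable F (volume.restrict (Icc a b)))
    (hC : ∀ᵐ x, x ∈ Icc a b → ‖F x‖ ≤ C) (h0 : ∀ x ∉ Icc a b, F x = 0) : MemLp F p volume := by
  have : F = (Icc a b).indicator F := by
    funext x
    by_cases hx : x ∈ Icc a b
    · rw [indicator_of_mem hx]
    · rw [indicator_of_notMem hx, h0 x hx]
  rw [this, memLp_indicator_iff_restrict measurableSet_Icc]
  exact MemLp.of_bound hm C ((ae_restrict_iff' measurableSet_Icc).2 hC)

theorem memLp_of_continuousOn_Icc {F : ℝ → ℂ} {a b : ℝ} {p : ℝ≥0∞} (hF : ContinuousOn F (Icc a b))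
    (h0 : ∀ x ∉ Icc a b, F x = 0) : MemLp F p volume := by
  obtain ⟨C, hC⟩ := isCompact_Icc.exists_bound_of_continuousOn hF
  exact memLp_of_ae_bound_Icc (hF.aestronglyMeasurable measurableSet_Icc)
    (Eventually.of_forall hC) h0

/-- The factor `f` is bounded with bounded support, and on a set of finite measure `L^r` is
contained in `L²` for `r ≥ 2`. -/
theorem memLp_mul_of_memLp_halfLines {W f : ℝ → ℂ} {rm rp : ℝ} (hrm : 2 ≤ rm) (hrp : 2 ≤ rp)
    (hWm : MemLp W (ENNReal.ofReal rm) (volume.restrict (Iio 0)))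
    (hWp : MemLp W (ENNReal.ofReal rp) (volume.restrict (Ioi 0))) {a b C : ℝ}
    (hf : AEStronglyMeasurable f volume) (hfC : ∀ x, ‖f x‖ ≤ C) (h0 : ∀ x ∉ Icc a b, f x = 0) :
    MemLp (fun x => W x * f x) 2 volume := by
  have key : ∀ (S : Set ℝ) (r : ℝ), MeasurableSet S → 2 ≤ r →
      MemLp W (ENNReal.ofReal r) (volume.restrict S) →
      MemLp (fun x => W x * f x) 2 (volume.restrict S) := by
    intro S r hS hr hW
    have h1 : MemLp W 2 ((volume.restrict S).restrict (Icc a b)) := by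
      have hfin : IsFiniteMeasure ((volume.restrict S).restrict (Icc a b)) := by
        rw [Measure.restrict_restrict measurableSet_Icc]
        exact isFiniteMeasure_restrict.2
          ((measure_mono inter_subset_left).trans_lt (by simp)).ne
      refine (hW.restrict (Icc a b)).mono_exponent ?_
      rw [show (2 : ℝ≥0∞) = ENNReal.ofReal 2 by norm_num]
      exact ENNReal.ofReal_le_ofReal hr
    have h2 : MemLp (fun x => W x * f x) 2 ((volume.restrict S).restrict (Icc a b)) := by
      refine MemLp.of_le_mul (c := C) h1 (h1.1.mul (hf.restrict.restrict)) ?_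
      refine Eventually.of_forall fun x => ?_
      rw [norm_mul, mul_comm]
      exact mul_le_mul_of_nonneg_right (hfC x) (norm_nonneg _)
    have h3 : (fun x => W x * f x) = (Icc a b).indicator (fun x => W x * f x) := by
      funext x
      by_cases hx : x ∈ Icc a b
      · rw [indicator_of_mem hx]
      · rw [indicator_of_notMem hx, h0 x hx, mul_zero]
    rw [h3, memLp_indicator_iff_restrict measurableSet_Icc]
    exact h2
  have hm := key _ rm measurableSet_Iio hrm hWm
  have hp := key _ rp measurableSet_Ioi hrp hWp
  have hm' : MemLp ((Iio (0 : ℝ)).indicator (fun x => W x * f x)) 2 volume :=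
    (memLp_indicator_iff_restrict measurableSet_Iio).2 hm
  have hp' : MemLp ((Ioi (0 : ℝ)).indicator (fun x => W x * f x)) 2 volume :=
    (memLp_indicator_iff_restrict measurableSet_Ioi).2 hp
  refine (hm'.add hp').ae_eq ?_
  have h0 : ∀ᵐ x : ℝ, x ≠ 0 := by simp [ae_iff]
  filter_upwards [h0] with x hx
  rcases lt_or_gt_of_ne hx with h | h
  · simp [h, h.le]
  · simp [h, h.le]

/-- The residual `P' - P² + V - λ` of the expansion. -/
def wkbResidual (V : ℝ → ℂ) (E : ℕ → ℝ → ℂ) (n : ℕ) (lam : ℝ) (x : ℝ) : ℂ :=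
  wkbSumDeriv V E n lam x - wkbSum V E n lam x ^ 2 + V x - lam

/-- The contribution of the derivatives of the cut-off to `(H_V - λ) (ξ g)`. -/
def cutoffError (V : ℝ → ℂ) (E : ℕ → ℝ → ℂ) (n : ℕ) (χ : ℝ → ℝ) (lam : ℝ) (x : ℝ) : ℂ :=
  (2 * ((deriv χ x : ℝ) : ℂ) * wkbSum V E n lam x - ((deriv (deriv χ) x : ℝ) : ℂ))
    * wkbG V n lam x

/-- The contribution of the residual to `(H_V - λ) (ξ g)`. -/
def expansionError (V : ℝ → ℂ) (E : ℕ → ℝ → ℂ) (n : ℕ) (χ : ℝ → ℝ) (lam : ℝ) (x : ℝ) : ℂ :=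
  wkbResidual V E n lam x * (((χ x : ℝ) : ℂ) * wkbG V n lam x)

section

variable {n : ℕ} {V W : ℝ → ℂ} {E : ℕ → ℝ → ℂ} {lam : ℝ} {a b : ℝ} {χ : ℝ → ℝ}

theorem locallyLipschitzOn_ofReal_contDiff {F : ℝ → ℝ} (hF : ContDiff ℝ 1 F) (s : Set ℝ) :
    LocallyLipschitzOn s (fun x => ((F x : ℝ) : ℂ)) :=
  ((Complex.ofRealCLM.contDiff (n := 1)).comp hF).locallyLipschitz (𝕂 := ℝ) |>.locallyLipschitzOn

/-- On `[a, b]` both `f` and `f'` are Lipschitz, and they vanish at the ends because `χ` and `χ'`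
do, so extension by zero creates no boundary terms. Almost everywhere `f''` equals `(V - λ) f` minus
the two error functions. -/
theorem isSchrodingerImage_pseudomode (hE : IsClassicalJet n V E) (hlam : 0 < lam) (ha : a < 0)
    (hb : 0 < b) (hs : ∀ x ∈ Icc a b, (V x).re < lam) (hχ : ContDiff ℝ ∞ χ)
    (hχ0 : ∀ x ∉ Ioo a b, χ x = 0) {rm rp : ℝ} (hrm : 2 ≤ rm) (hrp : 2 ≤ rp)
    (hWm : MemLp W (ENNReal.ofReal rm) (volume.restrict (Iio 0)))
    (hWp : MemLp W (ENNReal.ofReal rp) (volume.restrict (Ioi 0))) {f : ℝ → ℂ}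
    (hf : ∀ x, f x = ((χ x : ℝ) : ℂ) * wkbG V n lam x) :
    MemLp f 2 volume ∧
    MemLp (cutoffError V E n χ lam) 2 volume ∧ MemLp (expansionError V E n χ lam) 2 volume ∧
    MemLp (fun x => W x * f x) 2 volume ∧
    IsSchrodingerImage (fun x => V x + W x) f
      (fun x => lam * f x + (cutoffError V E n χ lam x + expansionError V E n χ lam x)
        + W x * f x) := by
  have hab : a ≤ b := by linarith
  set G := wkbG V n lam with hG
  set P := wkbSum V E n lam with hP
  set P' := wkbSumDeriv V E n lam with hP'
  set χ1 := deriv χ with hχ1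
  set χ2 := deriv χ1 with hχ2
  have hχs1 : ContDiff ℝ ∞ χ1 := (contDiff_infty_iff_deriv.1 hχ).2
  have hχs2 : ContDiff ℝ ∞ χ2 := (contDiff_infty_iff_deriv.1 hχs1).2
  have hχd : ∀ x, HasDerivAt (fun y => ((χ y : ℝ) : ℂ)) ((χ1 x : ℝ) : ℂ) x := fun x =>
    ((hχ.differentiable (by simp)) x).hasDerivAt.ofReal_comp
  have hχd1 : ∀ x, HasDerivAt (fun y => ((χ1 y : ℝ) : ℂ)) ((χ2 x : ℝ) : ℂ) x := fun x =>
    ((hχs1.differentiable (by simp)) x).hasDerivAt.ofReal_comp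
  have hχ10 : ∀ x ∉ Ioo a b, χ1 x = 0 :=
    deriv_eq_zero_of_notMem_Ioo (hχ.differentiable (by simp)) hχ0
  have hχ20 : ∀ x ∉ Ioo a b, χ2 x = 0 :=
    deriv_eq_zero_of_notMem_Ioo (hχs1.differentiable (by simp)) hχ10
  have hGL := locallyLipschitzOn_wkbG hE hlam ha.le hb.le hs
  have hPL := locallyLipschitzOn_wkbSum hE hs
  have hGd : ∀ x ∈ Ioo a b, HasDerivAt G (-P x * G x) x := fun x hx =>
    hasDerivAt_wkbG hE hlam ha hb hs hx
  have hPd : ∀ᵐ x, x ∈ Icc a b → HasDerivAt P (P' x) x := by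
    filter_upwards [ae_hasDerivAt_wkbSum (lam := lam) hE] with x hx hx'
    exact hx (hs x hx')
  have hends : ∀ᵐ x, x ∈ Icc a b → x ∈ Ioo a b := by
    have h1 : ∀ᵐ x : ℝ, x ≠ a := by simp [ae_iff]
    have h2 : ∀ᵐ x : ℝ, x ≠ b := by simp [ae_iff]
    filter_upwards [h1, h2] with x h1 h2 hx
    exact ⟨lt_of_le_of_ne hx.1 (Ne.symm h1), lt_of_le_of_ne hx.2 h2⟩
  have hχL : LocallyLipschitzOn (Icc a b) (fun x => ((χ x : ℝ) : ℂ)) :=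
    locallyLipschitzOn_ofReal_contDiff (hχ.of_le (by simp)) _
  have hχL1 : LocallyLipschitzOn (Icc a b) (fun x => ((χ1 x : ℝ) : ℂ)) :=
    locallyLipschitzOn_ofReal_contDiff (hχs1.of_le (by simp)) _
  have hχL2 : LocallyLipschitzOn (Icc a b) (fun x => ((χ2 x : ℝ) : ℂ)) :=
    locallyLipschitzOn_ofReal_contDiff (hχs2.of_le (by simp)) _
  have hnot : ∀ x, x ∉ Icc a b → x ∉ Ioo a b := fun x hx h => hx (Ioo_subset_Icc_self h)
  have hfeq : f = fun x => ((χ x : ℝ) : ℂ) * G x := funext hf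
  -- `f` and its derivatives
  have hfc : ContinuousOn f (Icc a b) := by
    rw [hfeq]; exact (hχL.fun_mul hGL).continuousOn
  have hf0 : ∀ x ∉ Icc a b, f x = 0 := fun x hx => by rw [hf, hχ0 x (hnot x hx)]; simp
  set f1 : ℝ → ℂ := fun x => ((χ1 x : ℝ) : ℂ) * G x + -1 * (((χ x : ℝ) : ℂ) * (P x * G x)) with hf1
  have hf1L : LocallyLipschitzOn (Icc a b) f1 :=
    (hχL1.fun_mul hGL).fun_add ((locallyLipschitzOn_const _ _).fun_mul
      (hχL.fun_mul (hPL.fun_mul hGL)))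
  set f2 : ℝ → ℂ := fun x => (V x - lam) * f x
    - (cutoffError V E n χ lam x + expansionError V E n χ lam x) with hf2
  have hfd : ∀ x ∈ Ioo a b, HasDerivAt f (f1 x) x := by
    intro x hx
    rw [hfeq]
    refine ((hχd x).mul (hGd x hx)).congr_deriv ?_
    simp only [hf1]; ring
  have hf1d : ∀ᵐ x, x ∈ Icc a b → HasDerivAt f1 (f2 x) x := by
    filter_upwards [hPd, hends] with x hx1 hx2 hx
    have d1 := (hχd1 x).mul (hGd x (hx2 hx))
    have d2 := ((hχd x).mul ((hx1 hx).mul (hGd x (hx2 hx)))).const_mul (-1)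
    refine (d1.add d2).congr_deriv ?_
    simp only [hf2, cutoffError, expansionError, wkbResidual, hf x, ← hG, ← hP, ← hP', ← hχ1, ← hχ2]
    simp only [Pi.mul_apply]
    ring
  have hf2i := (integral_eq_sub_of_locallyLipschitzOn (a := a) (b := b)
    (by rwa [uIcc_of_le hab]) (by rwa [uIcc_of_le hab])).1
  -- integrability
  have hfm : MemLp f 2 volume := memLp_of_continuousOn_Icc hfc hf0
  have hVfm : MemLp (fun x => V x * f x) 2 volume :=
    memLp_of_continuousOn_Icc (hE.continuous.continuousOn.mul hfc)
      fun x hx => by rw [hf0 x hx, mul_zero]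
  have hcut : MemLp (cutoffError V E n χ lam) 2 volume := by
    refine memLp_of_continuousOn_Icc (a := a) (b := b) ?_ fun x hx => ?_
    · have := ((((locallyLipschitzOn_const 2 _).fun_mul hχL1).fun_mul hPL).fun_add
        ((locallyLipschitzOn_const (-1) _).fun_mul hχL2)).fun_mul hGL
      refine this.continuousOn.congr fun x _ => ?_
      simp only [cutoffError, ← hG, ← hP, ← hχ1, ← hχ2]; ring
    · rw [cutoffError, ← hχ1, hχ10 x (hnot x hx), ← hχ2, hχ20 x (hnot x hx)]; simp
  have hf2b : ∃ C : ℝ, ∀ᵐ x, x ∈ Icc a b → ‖f2 x‖ ≤ C := by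
    obtain ⟨K, hK⟩ := hf1L.exists_lipschitzOnWith_of_compact isCompact_Icc
    refine ⟨K, ?_⟩
    filter_upwards [hf1d, hends] with x h1 h2 hx
    have := norm_deriv_le_of_lipschitzOn (Icc_mem_nhds (h2 hx).1 (h2 hx).2) hK
    rwa [(h1 hx).deriv] at this
  obtain ⟨C2, hC2⟩ := hf2b
  -- The residual is an almost everywhere derivative. Its measurability and boundedness are read off
  -- from `f2 = f''`, which is integrable by the fundamental theorem and bounded by the Lipschitz
  -- constant of `f1 = f'`.
  have hexp : MemLp (expansionError V E n χ lam) 2 volume := by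
    have h1 : MemLp ((Icc a b).indicator f2) 2 volume := by
      refine memLp_of_ae_bound_Icc (a := a) (b := b) (C := C2) ?_ ?_ ?_
      · refine (AEStronglyMeasurable.congr (f := f2) ?_ ?_)
        · have := hf2i.aestronglyMeasurable_restrict_uIoc
          rw [uIoc_of_le hab] at this
          rwa [restrict_Ioc_eq_restrict_Icc] at this
        · filter_upwards [ae_restrict_mem measurableSet_Icc] with x hx
          rw [indicator_of_mem hx]
      · filter_upwards [hC2] with x hx hx'
        rw [indicator_of_mem hx']; exact hx hx'
      · intro x hx; rw [indicator_of_notMem hx]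
    refine (((hVfm.sub (hfm.const_mul (lam : ℂ))).sub hcut).sub h1).ae_eq ?_
    refine Eventually.of_forall fun x => ?_
    by_cases hx : x ∈ Icc a b
    · simp only [Pi.sub_apply, indicator_of_mem hx, hf2]; ring
    · simp only [Pi.sub_apply, indicator_of_notMem hx, hf0 x hx, cutoffError, expansionError,
        ← hχ1, ← hχ2, hχ0 x (hnot x hx), hχ10 x (hnot x hx), hχ20 x (hnot x hx)]
      simp
  obtain ⟨Cf, hCf⟩ := isCompact_Icc.exists_bound_of_continuousOn hfc
  have hfC : ∀ x, ‖f x‖ ≤ max Cf 0 := by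
    intro x
    by_cases hx : x ∈ Icc a b
    · exact (hCf x hx).trans (le_max_left _ _)
    · rw [hf0 x hx, norm_zero]; exact le_max_right _ _
  have hWf := memLp_mul_of_memLp_halfLines hrm hrp hWm hWp hfm.1 hfC hf0
  refine ⟨hfm, hcut, hexp, hWf, hfm, ?_, ?_, ?_⟩
  · exact ((hfm.const_mul (lam : ℂ)).add (hcut.add hexp)).add hWf
  · refine ((hVfm.add hWf).locallyIntegrable (by norm_num)).congr (Eventually.of_forall fun x => ?_)
    simp only [Pi.add_apply]; ring
  · intro φ hφ
    have hφc : ∀ {F : ℝ → ℂ}, MemLp F 2 volume → Integrable (fun x => F x * ((φ x : ℝ) : ℂ)) := by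
      intro F hF
      have := (hF.locallyIntegrable (by norm_num)).integrable_smul_left_of_hasCompactSupport
        hφ.1.continuous hφ.2
      refine this.congr (Eventually.of_forall fun x => ?_)
      simp [Complex.real_smul, mul_comm]
    set φ1 := deriv φ with hφ1
    set φ2 := deriv φ1 with hφ2
    have hφs1 : ContDiff ℝ ∞ φ1 := (contDiff_infty_iff_deriv.1 hφ.1).2
    have hφs2 : ContDiff ℝ ∞ φ2 := (contDiff_infty_iff_deriv.1 hφs1).2
    have hφd : ∀ x, HasDerivAt (fun y => ((φ y : ℝ) : ℂ)) ((φ1 x : ℝ) : ℂ) x := fun x =>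
      ((hφ.1.differentiable (by simp)) x).hasDerivAt.ofReal_comp
    have hφd1 : ∀ x, HasDerivAt (fun y => ((φ1 y : ℝ) : ℂ)) ((φ2 x : ℝ) : ℂ) x := fun x =>
      ((hφs1.differentiable (by simp)) x).hasDerivAt.ofReal_comp
    have hit : iteratedDeriv 2 φ = φ2 := by
      rw [iteratedDeriv_succ, iteratedDeriv_one]
    have hφL := locallyLipschitzOn_ofReal_contDiff (hφ.1.of_le (m := 1) (by simp)) (Icc a b)
    have hφL1 := locallyLipschitzOn_ofReal_contDiff (hφs1.of_le (m := 1) (by simp)) (Icc a b)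
    have hfL : LocallyLipschitzOn (Icc a b) f := by rw [hfeq]; exact hχL.fun_mul hGL
    -- Green's identity: the derivative of `f φ' - f' φ` is `f φ'' - f'' φ`, and the boundary values
    -- vanish.
    have hftc := (integral_eq_sub_of_locallyLipschitzOn (a := a) (b := b)
      (f := fun x => f x * ((φ1 x : ℝ) : ℂ) + -1 * (f1 x * ((φ x : ℝ) : ℂ)))
      (f' := fun x => f x * ((φ2 x : ℝ) : ℂ) - f2 x * ((φ x : ℝ) : ℂ))
      (by rw [uIcc_of_le hab]; exact (hfL.fun_mul hφL1).fun_add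
            ((locallyLipschitzOn_const _ _).fun_mul (hf1L.fun_mul hφL)))
      (by
        rw [uIcc_of_le hab]
        filter_upwards [hf1d, hends] with x h1 h2 hx
        refine (((hfd x (h2 hx)).mul (hφd1 x)).add
          (((h1 hx).mul (hφd x)).const_mul (-1))).congr_deriv ?_
        ring)).2
    have hbd : ∀ x ∉ Ioo a b, f x = 0 ∧ f1 x = 0 := by
      intro x hx
      constructor
      · rw [hf, hχ0 x hx]; simp
      · simp only [hf1, hχ0 x hx, hχ10 x hx]; simp
    rw [(hbd b (by simp)).1, (hbd b (by simp)).2, (hbd a (by simp)).1, (hbd a (by simp)).2] at hftc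
    have hwhole : ∫ x, (f x * ((φ2 x : ℝ) : ℂ) - f2 x * ((φ x : ℝ) : ℂ)) = 0 := by
      rw [← setIntegral_eq_integral_of_forall_compl_eq_zero (s := Ioc a b),
        ← intervalIntegral.integral_of_le hab, hftc]
      · simp
      · intro x hx
        have hx' : x ∉ Ioo a b := fun h => hx ⟨h.1, h.2.le⟩
        simp only [hf2, (hbd x hx').1, cutoffError, expansionError, ← hχ1, ← hχ2, hχ0 x hx',
          hχ10 x hx', hχ20 x hx']
        simp
    have i2 : Integrable (fun x => f x * ((φ2 x : ℝ) : ℂ)) := by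
      have := (hfm.locallyIntegrable (by norm_num)).integrable_smul_left_of_hasCompactSupport
        hφs2.continuous hφ.2.deriv.deriv
      refine this.congr (Eventually.of_forall fun x => ?_)
      simp [Complex.real_smul, mul_comm]
    have hf2m : MemLp f2 2 volume := by
      refine (((hVfm.sub (hfm.const_mul (lam : ℂ)))).sub (hcut.add hexp)).ae_eq ?_
      refine Eventually.of_forall fun x => ?_
      simp only [Pi.sub_apply, Pi.add_apply, hf2]; ring
    rw [integral_sub i2 (hφc hf2m), sub_eq_zero] at hwhole
    have i3 : Integrable (fun x => (V x + W x) * f x * ((φ x : ℝ) : ℂ)) := by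
      refine (hφc (hVfm.add hWf)).congr (Eventually.of_forall fun x => ?_)
      simp only [Pi.add_apply]; ring
    rw [hit, hwhole, ← integral_neg]
    refine (integral_add (f := fun x => -(f2 x * ((φ x : ℝ) : ℂ))) (hφc hf2m).neg i3).symm.trans ?_
    congr 1
    funext x
    simp only [hf2]; ring

end

/-! ### Cancellation in the residual -/

theorem sum_fin_succ_mul_eq_antidiagonal (T : ℕ → ℂ) (j : ℕ) :
    2 * T 0 * T (j + 1) + ∑ a : Fin j, T (a.1 + 1) * T (j - a.1)
      = ∑ p ∈ Finset.HasAntidiagonal.antidiagonal (j + 1), T p.1 * T p.2 := by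
  rw [Finset.Nat.sum_antidiagonal_eq_sum_range_succ (fun a b => T a * T b),
    Finset.sum_range_succ, Finset.sum_range_succ', Fin.sum_univ_eq_sum_range
      (fun a => T (a + 1) * T (j - a))]
  have : ∀ k ∈ Finset.range j, T (k + 1) * T (j + 1 - (k + 1)) = T (k + 1) * T (j - k) :=
    fun k _ => by rw [Nat.add_sub_add_right]
  rw [Finset.sum_congr rfl this]
  simp
  ring

/-- Pairs are sorted by total index. The double sum runs over totals `1, …, n + 1` and the square
over the box `{0, …, n}²`; they share the pairs of the box with such totals. Left over are `(0,
n+1)` and `(n+1, 0)` on one side, `(0, 0)` and the totals `≥ n + 2` on the other. -/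
theorem sum_antidiagonal_sub_sq (T : ℕ → ℂ) (n : ℕ) :
    (∑ j ∈ Finset.range (n + 1), ∑ p ∈ Finset.HasAntidiagonal.antidiagonal (j + 1), T p.1 * T p.2)
      - (∑ j ∈ Finset.range (n + 1), T j) ^ 2 + T 0 ^ 2
      = 2 * T 0 * T (n + 1) - ∑ p ∈ (Finset.range (n + 1) ×ˢ Finset.range (n + 1)).filter
          (fun p => n + 2 ≤ p.1 + p.2), T p.1 * T p.2 := by
  classical
  set F : ℕ × ℕ → ℂ := fun p => T p.1 * T p.2 with hF
  set R := Finset.range (n + 1) ×ˢ Finset.range (n + 1) with hR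
  set A := (Finset.range (n + 2) ×ˢ Finset.range (n + 2)).filter
    (fun p => 1 ≤ p.1 + p.2 ∧ p.1 + p.2 ≤ n + 1) with hA
  have h1 : ∑ j ∈ Finset.range (n + 1), ∑ p ∈ Finset.HasAntidiagonal.antidiagonal (j + 1), F p = ∑ p ∈ A, F p := by
    rw [← Finset.sum_fiberwise_of_maps_to (s := A) (t := Finset.range (n + 1))
      (g := fun p => p.1 + p.2 - 1)]
    · apply Finset.sum_congr rfl
      intro j hj
      apply Finset.sum_congr _ fun _ _ => rfl
      ext ⟨a, b⟩
      simp only [hA, Finset.HasAntidiagonal.mem_antidiagonal, Finset.mem_filter, Finset.mem_product,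
        Finset.mem_range] at hj ⊢
      omega
    · rintro ⟨a, b⟩ h
      simp only [hA, Finset.mem_filter, Finset.mem_product, Finset.mem_range] at h ⊢
      omega
  have h2 : (∑ j ∈ Finset.range (n + 1), T j) ^ 2 = ∑ p ∈ R, F p := by
    rw [sq, Finset.sum_mul_sum, hR, Finset.sum_product]
  have h3 : ∑ p ∈ R, F p = ∑ p ∈ R.filter (fun p => n + 2 ≤ p.1 + p.2), F p
      + (F (0, 0) + ∑ p ∈ R.filter (fun p => 1 ≤ p.1 + p.2 ∧ p.1 + p.2 ≤ n + 1), F p) := by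
    rw [← Finset.sum_filter_add_sum_filter_not R (fun p => n + 2 ≤ p.1 + p.2)]
    congr 1
    rw [← Finset.sum_insert]
    · apply Finset.sum_congr _ fun _ _ => rfl
      ext ⟨a, b⟩
      simp only [hR, Finset.mem_insert, Finset.mem_filter, Finset.mem_product, Finset.mem_range,
        Prod.mk.injEq]
      omega
    · simp
  have h4 : ∑ p ∈ A, F p = (F (0, n + 1) + F (n + 1, 0))
      + ∑ p ∈ R.filter (fun p => 1 ≤ p.1 + p.2 ∧ p.1 + p.2 ≤ n + 1), F p := by
    rw [add_assoc, ← Finset.sum_insert, ← Finset.sum_insert]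
    · apply Finset.sum_congr _ fun _ _ => rfl
      ext ⟨a, b⟩
      simp only [hA, hR, Finset.mem_insert, Finset.mem_filter, Finset.mem_product,
        Finset.mem_range, Prod.mk.injEq]
      omega
    · simp [hR]
    · simp [hR]
  rw [h1, h2, h3, h4]
  simp only [hF]
  ring

/-! ### Pointwise bounds for the terms and the residual -/

section pointwise

variable {n : ℕ} {V : ℝ → ℂ} {E : ℕ → ℝ → ℂ} {lam x : ℝ}

theorem wkbTerm_zero : wkbTerm V E lam 0 x = wkbSqrt V lam x * Complex.I := by
  simp [wkbTerm, wkbSymbol]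

theorem wkbResidual_eq (h : (V x).re < lam) :
    wkbResidual V E n lam x = 2 * wkbTerm V E lam 0 x * wkbTerm V E lam (n + 1) x
      - ∑ p ∈ (Finset.range (n + 1) ×ˢ Finset.range (n + 1)).filter
          (fun p => n + 2 ≤ p.1 + p.2), wkbTerm V E lam p.1 x * wkbTerm V E lam p.2 x := by
  rw [← sum_antidiagonal_sub_sq (fun j => wkbTerm V E lam j x), wkbResidual, wkbSumDeriv, wkbSum]
  have h0 : wkbTerm V E lam 0 x ^ 2 = V x - lam := by
    rw [wkbTerm_zero, mul_pow, wkbSqrt_sq, Complex.I_sq]; ring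
  rw [h0, Finset.sum_congr rfl fun j _ => wkbTermDeriv_eq (E := E) h j,
    Finset.sum_congr rfl fun j _ => sum_fin_succ_mul_eq_antidiagonal
      (fun j => wkbTerm V E lam j x) j]
  ring

/-- The bounds at a point that control the terms of the expansion: `μ = λ^{1/2}`, `v` is the size
of `V / λ`, and `t` the cost of a derivative. -/
structure TermBounds (n : ℕ) (V : ℝ → ℂ) (E : ℕ → ℝ → ℂ) (B lam μ v t x : ℝ) : Prop where
  pos : 0 < μ
  sq : μ ^ 2 = lam
  re_le : (V x).re ≤ lam / 2
  norm_le : ‖V x‖ ≤ B * lam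
  v_nonneg : 0 ≤ v
  v_le : v ≤ B
  t_nonneg : 0 ≤ t
  t_le : t ≤ μ
  jet : ∀ m, 1 ≤ m → m ≤ n + 1 → ‖E m x‖ ≤ B * v * t ^ m * lam

variable {B μ v t : ℝ}

theorem TermBounds.lam_pos (h : TermBounds n V E B lam μ v t x) : 0 < lam :=
  h.sq ▸ pow_pos h.pos 2

theorem TermBounds.re_lt (h : TermBounds n V E B lam μ v t x) : (V x).re < lam := by
  have := h.lam_pos; have := h.re_le; linarith

theorem TermBounds.norm_sub_ge (h : TermBounds n V E B lam μ v t x) :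
    lam / 2 ≤ ‖(lam : ℂ) - V x‖ := by
  have h1 := Complex.re_le_norm ((lam : ℂ) - V x)
  have := h.re_le
  simp at h1
  linarith

/-- One has `(Re S)² ≥ Re S² = λ - Re V ≥ λ / 2`, and `Re S ≥ 0` for the principal branch. -/
theorem TermBounds.sqrt_re_ge (h : TermBounds n V E B lam μ v t x) :
    μ / 2 ≤ (wkbSqrt V lam x).re := by
  have h1 := congrArg Complex.re (wkbSqrt_sq V lam x)
  have h2 := wkbSqrt_re_nonneg V lam x
  have h3 := h.re_le
  have h4 := h.sq
  have h5 := h.pos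
  rw [pow_two, Complex.mul_re] at h1
  simp at h1
  nlinarith [sq_nonneg (wkbSqrt V lam x).im, sq_nonneg ((wkbSqrt V lam x).re - μ / 2)]

theorem TermBounds.norm_sqrt_ge (h : TermBounds n V E B lam μ v t x) :
    μ / 2 ≤ ‖wkbSqrt V lam x‖ := h.sqrt_re_ge.trans (Complex.re_le_norm _)

theorem TermBounds.norm_sqrt_le (hB : 0 ≤ B) (h : TermBounds n V E B lam μ v t x) :
    ‖wkbSqrt V lam x‖ ≤ (1 + B) * μ := by
  have h1 : ‖wkbSqrt V lam x‖ ^ 2 ≤ (1 + B) * lam := by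
    rw [← norm_pow, wkbSqrt_sq]
    refine (norm_sub_le _ _).trans ?_
    have := h.norm_le
    have := h.lam_pos
    rw [Complex.norm_real, Real.norm_of_nonneg this.le]
    linarith
  apply le_of_sq_le_sq _ (by have := h.pos; positivity)
  rw [mul_pow, h.sq]
  have := h.lam_pos
  nlinarith [mul_nonneg hB this.le, mul_nonneg (mul_nonneg hB this.le) hB]

/-- The leading term dictates the decay. -/
theorem TermBounds.re_wkbTerm_zero (hB : 0 ≤ B) (h : TermBounds n V E B lam μ v t x) :
    ∃ ρ : ℝ, (2 * (1 + B) * μ)⁻¹ ≤ ρ ∧ ρ ≤ μ⁻¹ ∧ (wkbTerm V E lam 0 x).re = (V x).im * ρ := by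
  have h1 := congrArg Complex.im (wkbSqrt_sq V lam x)
  have h2 := h.sqrt_re_ge
  have h3 := (Complex.re_le_norm _).trans (h.norm_sqrt_le hB)
  have h4 := h.pos
  have h5 : 0 < (wkbSqrt V lam x).re := by linarith
  -- The imaginary part of `S² = λ - V` reads `2 Re S Im S = -Im V`, while `Re (i S) = -Im S`.
  refine ⟨(2 * (wkbSqrt V lam x).re)⁻¹, ?_, ?_, ?_⟩
  · apply inv_anti₀ (by positivity); linarith
  · apply inv_anti₀ (by positivity); linarith
  · rw [wkbTerm_zero]
    rw [pow_two, Complex.mul_im] at h1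
    simp at h1
    simp only [Complex.mul_re, Complex.I_re, Complex.I_im]
    field_simp
    linarith

/-- Since `|λ - V| ≥ λ / 2`, the variables satisfy `|w_m| ≤ 2 B v t^m`; the symbol then contributes
`v t^j` and `S^{1-j}` contributes `μ^{1-j}`. The constant depends on `n` and `B` only, which makes
the bound uniform in `λ` and `x`. -/
theorem exists_norm_wkbTerm_le (n : ℕ) {B : ℝ} (hB : 0 ≤ B) :
    ∃ C : ℝ, 0 ≤ C ∧ ∀ (V : ℝ → ℂ) (E : ℕ → ℝ → ℂ) (lam μ v t x : ℝ),
      TermBounds n V E B lam μ v t x →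
        ∀ j, 1 ≤ j → j ≤ n + 1 → ‖wkbTerm V E lam j x‖ ≤ C * μ * v * (t / μ) ^ j := by
  have hex : ∀ j, ∃ C : ℝ, 0 ≤ C ∧ (1 ≤ j → ∀ (w : ℕ → ℂ) (v t : ℝ), 0 ≤ v → v ≤ 2 * B → 0 ≤ t →
      (∀ m, 1 ≤ m → m ≤ j → ‖w m‖ ≤ 2 * B * v * t ^ m) →
        ‖MvPolynomial.eval w (wkbSymbol j)‖ ≤ C * v * t ^ j) := by
    intro j
    by_cases hj : 1 ≤ j
    · obtain ⟨C, hC, h⟩ := (isSymbol_wkbSymbol j hj).norm_eval_le (by positivity : 0 ≤ 2 * B)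
      exact ⟨C, hC, fun _ => h⟩
    · exact ⟨0, le_rfl, fun h => absurd h hj⟩
  choose c hc0 hc using hex
  refine ⟨∑ j ∈ Finset.range (n + 2), (1 + B) * 2 ^ j * c j,
    Finset.sum_nonneg fun j _ => by have := hc0 j; positivity, ?_⟩
  intro V E lam μ v t x h j hj hj'
  have hμ := h.pos
  have hv := h.v_nonneg
  have ht := h.t_nonneg
  have hw : ∀ m, 1 ≤ m → m ≤ j → ‖wkbVar V E lam x m‖ ≤ 2 * B * v * t ^ m := by
    intro m hm hm'
    rw [wkbVar, norm_div, div_le_iff₀ (by have := h.norm_sub_ge; have := h.lam_pos; linarith)]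
    refine (h.jet m hm (by omega)).trans ?_
    have h1 := mul_le_mul_of_nonneg_left h.norm_sub_ge (by positivity : 0 ≤ 2 * B * v * t ^ m)
    linarith
  have h1 := hc j hj _ v t hv (by linarith [h.v_le]) ht hw
  have h2 : ‖wkbSqrt V lam x ^ (1 - (j : ℤ))‖ ≤ (1 + B) * μ * (2 / μ) ^ j := by
    have hS0 := wkbSqrt_ne_zero h.re_lt
    rw [zpow_sub₀ hS0, zpow_one, zpow_natCast, norm_div, norm_pow, div_eq_mul_inv, ← inv_pow]
    have h3 : ‖wkbSqrt V lam x‖⁻¹ ≤ 2 / μ := by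
      rw [← inv_div]; exact inv_anti₀ (by positivity) h.norm_sqrt_ge
    have h4 := h.norm_sqrt_le hB
    gcongr
  rw [wkbTerm, norm_mul]
  calc _ ≤ (1 + B) * μ * (2 / μ) ^ j * (c j * v * t ^ j) :=
        mul_le_mul h2 h1 (norm_nonneg _) (by positivity)
    _ = ((1 + B) * 2 ^ j * c j) * (μ * v * (t / μ) ^ j) := by
        rw [div_pow, div_pow]; ring
    _ ≤ _ := by
      rw [mul_assoc _ μ, mul_assoc _ (μ * v)]
      refine mul_le_mul_of_nonneg_right ?_ (by positivity)
      exact Finset.single_le_sum (f := fun j => (1 + B) * 2 ^ j * c j)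
        (fun i _ => by have := hc0 i; positivity) (Finset.mem_range.2 (by omega))

/-- As `t ≤ μ`, the powers of `t / μ` decrease, so the lowest order dominates: order one in `P -
T_0`, and order `n + 1` in the residual. One factor `v` is kept throughout, any second one is
estimated by `B`. -/
theorem exists_wkb_bounds (n : ℕ) {B : ℝ} (hB : 0 ≤ B) :
    ∃ C : ℝ, 0 ≤ C ∧ ∀ (V : ℝ → ℂ) (E : ℕ → ℝ → ℂ) (lam μ v t x : ℝ),
      TermBounds n V E B lam μ v t x →
        ‖wkbSum V E n lam x - wkbTerm V E lam 0 x‖ ≤ C * v * t ∧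
        ‖wkbSum V E n lam x‖ ≤ C * μ ∧
        ‖wkbResidual V E n lam x‖ ≤ C * μ ^ 2 * v * (t / μ) ^ (n + 1) := by
  obtain ⟨C, hC, hT⟩ := exists_norm_wkbTerm_le n hB
  set Q := (Finset.range (n + 1) ×ˢ Finset.range (n + 1)).filter
          (fun p : ℕ × ℕ => n + 2 ≤ p.1 + p.2) with hQ
  refine ⟨n * C + (1 + B) + n * C * B + 2 * (1 + B) * C + Q.card * (C * C * B), by positivity, ?_⟩
  intro V E lam μ v t x h
  have hμ := h.pos
  have hv := h.v_nonneg
  have ht := h.t_nonneg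
  have hq0 : 0 ≤ t / μ := by positivity
  have hq1 : t / μ ≤ 1 := by rw [div_le_one hμ]; exact h.t_le
  have h1 : ‖wkbSum V E n lam x - wkbTerm V E lam 0 x‖ ≤ n * C * (v * t) := by
    rw [wkbSum, Finset.sum_range_succ', add_sub_cancel_right]
    calc _ ≤ ∑ j ∈ Finset.range n, C * v * t := by
          refine norm_sum_le_of_le _ fun j hj => ?_
          rw [Finset.mem_range] at hj
          refine (hT V E lam μ v t x h (j + 1) (by omega) (by omega)).trans ?_
          have h2 : (t / μ) ^ (j + 1) ≤ t / μ := by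
            simpa using pow_le_pow_of_le_one hq0 hq1 (show 1 ≤ j + 1 by omega)
          calc C * μ * v * (t / μ) ^ (j + 1) ≤ C * μ * v * (t / μ) := by gcongr
            _ = C * v * t := by field_simp
      _ = _ := by rw [Finset.sum_const, Finset.card_range, nsmul_eq_mul]; ring
  have h0 : ‖wkbTerm V E lam 0 x‖ ≤ (1 + B) * μ := by
    rw [wkbTerm_zero, norm_mul, Complex.norm_I, mul_one]; exact h.norm_sqrt_le hB
  have hvt : v * t ≤ B * μ := mul_le_mul h.v_le h.t_le ht hB
  refine ⟨h1.trans ?_, ?_, ?_⟩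
  · refine le_of_le_of_eq ?_ (mul_assoc _ v t).symm
    refine mul_le_mul_of_nonneg_right ?_ (by positivity)
    have : 0 ≤ (1 + B) + n * C * B + 2 * (1 + B) * C + Q.card * (C * C * B) := by positivity
    linarith
  · have h3 : ‖wkbSum V E n lam x‖ ≤ n * C * (v * t) + (1 + B) * μ := by
      calc _ = ‖(wkbSum V E n lam x - wkbTerm V E lam 0 x) + wkbTerm V E lam 0 x‖ := by
            rw [sub_add_cancel]
        _ ≤ _ := norm_add_le_of_le h1 h0
    have h4 : n * C * (v * t) ≤ n * C * (B * μ) := by gcongr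
    have : 0 ≤ (n * C + 2 * (1 + B) * C + Q.card * (C * C * B)) * μ := by positivity
    linarith
  · rw [wkbResidual_eq h.re_lt]
    set Y := μ ^ 2 * v * (t / μ) ^ (n + 1) with hY
    have hY0 : 0 ≤ Y := by positivity
    have h5 : ‖2 * wkbTerm V E lam 0 x * wkbTerm V E lam (n + 1) x‖ ≤ 2 * (1 + B) * C * Y := by
      rw [norm_mul, norm_mul, Complex.norm_two]
      calc _ ≤ 2 * ((1 + B) * μ) * (C * μ * v * (t / μ) ^ (n + 1)) := by
            have := hT V E lam μ v t x h (n + 1) (by omega) le_rfl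
            gcongr
        _ = _ := by rw [hY]; ring
    have h6 : ‖∑ p ∈ Q, wkbTerm V E lam p.1 x * wkbTerm V E lam p.2 x‖
        ≤ Q.card * (C * C * B) * Y := by
      calc _ ≤ ∑ p ∈ Q, C * C * B * Y := by
            refine norm_sum_le_of_le _ fun p hp => ?_
            simp only [hQ, Finset.mem_filter, Finset.mem_product, Finset.mem_range] at hp
            rw [norm_mul]
            have e1 := hT V E lam μ v t x h p.1 (by omega) (by omega)
            have e2 := hT V E lam μ v t x h p.2 (by omega) (by omega)
            have e3 : (t / μ) ^ (p.1 + p.2) ≤ (t / μ) ^ (n + 1) :=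
              pow_le_pow_of_le_one hq0 hq1 (by omega)
            calc _ ≤ (C * μ * v * (t / μ) ^ p.1) * (C * μ * v * (t / μ) ^ p.2) :=
                  mul_le_mul e1 e2 (norm_nonneg _) (by positivity)
              _ = C * C * v * (μ ^ 2 * v * (t / μ) ^ (p.1 + p.2)) := by rw [pow_add]; ring
              _ ≤ C * C * B * (μ ^ 2 * v * (t / μ) ^ (n + 1)) := by
                  have := h.v_le
                  gcongr
        _ = _ := by rw [Finset.sum_const, nsmul_eq_mul]; ring
    refine (norm_sub_le_of_le h5 h6).trans ?_
    rw [show ∀ c : ℝ, c * μ ^ 2 * v * (t / μ) ^ (n + 1) = c * Y from fun c => by rw [hY]; ring]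
    have : 0 ≤ (n * C + (1 + B) + n * C * B) * Y := by positivity
    linarith

end pointwise

/-! ### Bounds near infinity and Gronwall's inequality -/

theorem exists_ae_of_eventually_atTop_inf_ae {p : ℝ → Prop}
    (h : ∀ᶠ x in atTop ⊓ ae volume, p x) : ∃ X : ℝ, ∀ᵐ x, X ≤ x → p x := by
  obtain ⟨s, hs, t, ht, hst⟩ := Filter.mem_inf_iff.1 h
  obtain ⟨X, hX⟩ := mem_atTop_sets.1 hs
  refine ⟨X, ?_⟩
  filter_upwards [ht] with x hx hXx
  have : x ∈ s ∩ t := ⟨hX x hXx, hx⟩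
  rw [← hst] at this
  exact this

theorem exists_ae_bound_of_isBigO {F : Type*} [NormedAddCommGroup F] {f : ℝ → F} {g : ℝ → ℝ}
    (hg : ∀ x, 0 ≤ g x) (h : f =O[atTop ⊓ ae volume] g) :
    ∃ C : ℝ, 0 ≤ C ∧ ∃ X : ℝ, ∀ᵐ x, X ≤ x → ‖f x‖ ≤ C * g x := by
  obtain ⟨C, hC, h⟩ := h.exists_nonneg
  obtain ⟨X, hX⟩ := exists_ae_of_eventually_atTop_inf_ae h.bound
  refine ⟨C, hC, X, ?_⟩
  filter_upwards [hX] with x hx hXx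
  have := hx hXx
  rwa [Real.norm_of_nonneg (hg x)] at this

theorem antitone_of_ae_deriv_nonpos {F F' : ℝ → ℝ} (hF : LocallyLipschitz F) {X : ℝ}
    (hd : ∀ᵐ x, HasDerivAt F (F' x) x) (hn : ∀ᵐ x, X ≤ x → F' x ≤ 0) {x y : ℝ} (hx : X ≤ x)
    (hxy : x ≤ y) : F y ≤ F x := by
  have hL : LocallyLipschitz (fun x => ((F x : ℝ) : ℂ)) :=
    (Complex.ofRealCLM.contDiff (n := 1) (𝕜 := ℝ)).locallyLipschitz (𝕂 := ℝ) |>.comp hF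
  have h := (integral_eq_sub_of_locallyLipschitzOn (a := x) (b := y)
    (f' := fun x => ((F' x : ℝ) : ℂ)) hL.locallyLipschitzOn (by
      filter_upwards [hd] with z hz _ using hz.ofReal_comp)).2
  rw [intervalIntegral.integral_ofReal, ← Complex.ofReal_sub, Complex.ofReal_inj] at h
  have : ∫ t in x..y, F' t ≤ 0 := by
    rw [intervalIntegral.integral_of_le hxy]
    apply integral_nonpos_of_ae
    filter_upwards [ae_restrict_of_ae hn, ae_restrict_mem measurableSet_Ioc] with t ht ht'
    exact ht (hx.trans ht'.1.le)
  linarith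

theorem _root_.LocallyLipschitz.contDiff_comp {E F G : Type*} [PseudoEMetricSpace E]
    [NormedAddCommGroup F] [NormedSpace ℝ F] [NormedAddCommGroup G] [NormedSpace ℝ G]
    {f : E → F} {Φ : F → G} (hf : LocallyLipschitz f) (hΦ : ContDiff ℝ 1 Φ) :
    LocallyLipschitz (fun x => Φ (f x)) :=
  hΦ.locallyLipschitz.comp hf

/-- Gronwall's inequality, in both directions, for locally Lipschitz functions. -/
theorem norm_le_mul_exp_integral {f f' : ℝ → ℂ} {w : ℝ → ℝ} {C X : ℝ} (hf : LocallyLipschitz f)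
    (hd : ∀ᵐ x, HasDerivAt f (f' x) x) (hw : Continuous w)
    (hb : ∀ᵐ x, X ≤ x → ‖f' x‖ ≤ C * (‖f x‖ * w x)) {x y : ℝ} (hx : X ≤ x) (hxy : x ≤ y) :
    ‖f y‖ ≤ ‖f x‖ * Real.exp (C * ∫ t in x..y, w t) ∧
    ‖f x‖ ≤ ‖f y‖ * Real.exp (C * ∫ t in x..y, w t) := by
  -- The argument is applied to `‖f‖²`, which is differentiable also where `f` vanishes; hence the
  -- factor 2.
  set Φ : ℝ → ℝ := fun z => 2 * C * ∫ t in x..z, w t with hΦ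
  have hΦd : ∀ z, HasDerivAt Φ (2 * C * w z) z := fun z =>
    (intervalIntegral.integral_hasDerivAt_right (hw.intervalIntegrable x z)
      (hw.stronglyMeasurableAtFilter _ _) hw.continuousAt).const_mul (2 * C)
  have hΦc : ContDiff ℝ 1 Φ := by
    rw [contDiff_one_iff_deriv]
    refine ⟨fun z => (hΦd z).differentiableAt, ?_⟩
    rw [show deriv Φ = fun z => 2 * C * w z from funext fun z => (hΦd z).deriv]
    fun_prop
  have hsqL : ContDiff ℝ 1 (fun z : ℂ => ‖z‖ ^ 2) := contDiff_norm_sq ℝ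
  have hLs : ∀ s : ℝ, LocallyLipschitz (fun z => ‖f z‖ ^ 2 * Real.exp (s * Φ z)) := by
    intro s
    have h1 : ContDiff ℝ 1 (fun p : ℂ × ℝ => ‖p.1‖ ^ 2 * Real.exp (s * Φ p.2)) :=
      (hsqL.comp contDiff_fst).mul
        ((contDiff_const.mul (hΦc.comp contDiff_snd)).exp)
    exact (hf.prodMk LocallyLipschitz.id).contDiff_comp h1
  have hds : ∀ s : ℝ, ∀ᵐ z, HasDerivAt (fun z => ‖f z‖ ^ 2 * Real.exp (s * Φ z))
      ((2 * inner ℝ (f z) (f' z) + ‖f z‖ ^ 2 * (s * (2 * C * w z))) * Real.exp (s * Φ z)) z := by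
    intro s
    filter_upwards [hd] with z hz
    have h1 : HasDerivAt (fun z => ‖f z‖ ^ 2) (2 * inner ℝ (f z) (f' z)) z := hz.norm_sq
    refine (h1.mul ((hΦd z).const_mul s).exp).congr_deriv ?_
    ring
  have hin : ∀ᵐ z, X ≤ z → |inner ℝ (f z) (f' z)| ≤ ‖f z‖ ^ 2 * (C * w z) := by
    filter_upwards [hb] with z hz hXz
    refine (abs_real_inner_le_norm _ _).trans ?_
    refine (mul_le_mul_of_nonneg_left (hz hXz) (norm_nonneg _)).trans_eq ?_
    ring
  have hΦx : Φ x = 0 := by simp [hΦ]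
  have hfin : ∀ A B : ℝ, 0 ≤ A → 0 ≤ B → A ^ 2 ≤ B ^ 2 * Real.exp (Φ y) →
      A ≤ B * Real.exp (C * ∫ t in x..y, w t) := by
    intro A B hA hB h
    apply le_of_sq_le_sq _ (by positivity)
    have he : Φ y = ((2 : ℕ) : ℝ) * (C * ∫ t in x..y, w t) := by
      simp only [hΦ]; push_cast; ring
    rwa [mul_pow, ← Real.exp_nat_mul, ← he]
  constructor
  · have h1 := antitone_of_ae_deriv_nonpos (hLs (-1)) (hds (-1)) (X := X) (by
      filter_upwards [hin] with z hz hXz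
      apply mul_nonpos_of_nonpos_of_nonneg _ (Real.exp_pos _).le
      have := (abs_le.1 (hz hXz)).2
      linarith) hx hxy
    simp only [hΦx, mul_zero, Real.exp_zero, mul_one] at h1
    apply hfin _ _ (norm_nonneg _) (norm_nonneg _)
    rw [neg_one_mul, Real.exp_neg, ← div_eq_mul_inv, div_le_iff₀ (Real.exp_pos _)] at h1
    exact h1
  · have hL' : LocallyLipschitz (fun z => -(‖f z‖ ^ 2 * Real.exp (1 * Φ z))) :=
      (contDiff_neg (n := 1) (𝕜 := ℝ)).locallyLipschitz (𝕂 := ℝ) |>.comp (hLs 1)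
    have h1 := antitone_of_ae_deriv_nonpos hL' (by
      filter_upwards [hds 1] with z hz using hz.neg) (X := X) (by
      filter_upwards [hin] with z hz hXz
      rw [neg_nonpos]
      apply mul_nonneg _ (Real.exp_pos _).le
      have := (abs_le.1 (hz hXz)).1
      linarith) hx hxy
    simp only [hΦx, mul_zero, Real.exp_zero, mul_one, one_mul] at h1
    apply hfin _ _ (norm_nonneg _) (norm_nonneg _)
    linarith

/-! ### The bracket -/

theorem one_le_jb (x : ℝ) : 1 ≤ jb x := by
  rw [jb]; exact Real.one_le_sqrt.2 (by nlinarith [sq_nonneg x])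

theorem jb_pos (x : ℝ) : 0 < jb x := zero_lt_one.trans_le (one_le_jb x)

theorem le_jb (x : ℝ) : x ≤ jb x := by
  rw [jb]; exact Real.le_sqrt_of_sq_le (by linarith)

theorem jb_le_two_mul {x : ℝ} (hx : 1 ≤ x) : jb x ≤ 2 * x := by
  rw [jb]; exact Real.sqrt_le_iff.2 ⟨by linarith, by nlinarith⟩

theorem continuous_jb : Continuous jb := by unfold jb; fun_prop

theorem continuous_jb_rpow (s : ℝ) : Continuous (fun x => jb x ^ s) :=
  continuous_jb.rpow_const fun x => Or.inl (jb_pos x).ne'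

theorem jb_rpow_pos (x s : ℝ) : 0 < jb x ^ s := Real.rpow_pos_of_pos (jb_pos x) s

/-- Powers of comparable numbers are comparable. -/
theorem rpow_le_mul_rpow {a b s : ℝ} (hb : 0 < b) (h1 : b ≤ 2 * a) (h2 : a ≤ 2 * b) :
    a ^ s ≤ 2 ^ |s| * b ^ s := by
  have ha : 0 < a := by linarith
  rcases le_total 0 s with hs | hs
  · rw [abs_of_nonneg hs, ← Real.mul_rpow (by norm_num) hb.le]
    exact Real.rpow_le_rpow ha.le h2 hs
  · rw [abs_of_nonpos hs, Real.rpow_neg (by norm_num), ← div_eq_inv_mul,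
      le_div_iff₀ (by positivity), mul_comm, ← Real.mul_rpow (by norm_num) ha.le]
    exact Real.rpow_le_rpow_of_nonpos hb h1 hs

theorem jb_rpow_le {x s : ℝ} (hx : 1 ≤ x) : jb x ^ s ≤ 2 ^ |s| * x ^ s :=
  rpow_le_mul_rpow (by linarith) (by linarith [le_jb x]) (by linarith [jb_le_two_mul hx])

theorem le_jb_rpow {x s : ℝ} (hx : 1 ≤ x) : x ^ s ≤ 2 ^ |s| * jb x ^ s :=
  rpow_le_mul_rpow (jb_pos x) (by linarith [jb_le_two_mul hx]) (by linarith [le_jb x])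

theorem tendsto_jb_rpow_neg {s : ℝ} (hs : s < 0) : Tendsto (fun x => jb x ^ s) atTop (𝓝 0) := by
  have h1 : Tendsto jb atTop atTop := tendsto_atTop_mono le_jb tendsto_id
  have := (tendsto_rpow_neg_atTop (y := -s) (by linarith)).comp h1
  simpa [Function.comp_def] using this

theorem integral_jb_rpow_le {s X y : ℝ} (hX : 1 ≤ X) (hXy : X ≤ y) (hs : s ≠ -1) :
    ∫ t in X..y, jb t ^ s ≤ 2 ^ |s| * ((y ^ (s + 1) - X ^ (s + 1)) / (s + 1)) := by
  have h0 : (0 : ℝ) ∉ uIcc X y := by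
    rw [uIcc_of_le hXy]; intro h; linarith [h.1]
  rw [← integral_rpow (Or.inr ⟨hs, h0⟩), ← intervalIntegral.integral_const_mul]
  apply intervalIntegral.integral_mono_on hXy
  · exact (continuous_jb_rpow s).intervalIntegrable _ _
  · exact (intervalIntegral.intervalIntegrable_rpow (Or.inr h0)).const_mul _
  · intro t ht
    exact jb_rpow_le (hX.trans ht.1)

/-! ### Hypotheses and requirements at one end -/

/-- The part of the assumption at one end of the line that concerns the profile and its first
derivative. -/
structure EndHyp (U U' : ℝ → ℂ) (ν ε₁ : ℝ) : Prop where
  lip : LocallyLipschitz U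
  hasDeriv : ∀ᵐ x, HasDerivAt U (U' x) x
  im_ge : ∃ c > 0, ∃ X : ℝ, ∀ x, X ≤ x → c ≤ |(U x).im|
  im_deriv : ∃ C : ℝ, ∃ X : ℝ, ∀ᵐ x, X ≤ x → |(U' x).im| ≤ C * (|(U x).im| * jb x ^ ν)
  norm_deriv : ∃ C : ℝ, ∃ X : ℝ, ∀ᵐ x, X ≤ x → ‖U' x‖ ≤ C * (‖U x‖ * jb x ^ ν)
  unbounded : ¬ BoundedAtInfty U →
    (fun x => jb x ^ (4 * (ν + ε₁) + 2) * (jb x ^ (4 * ν + 2) + |(U x).re|))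
      =O[atTop] (fun x => |(U x).im| ^ 2)
  bounded : BoundedAtInfty U → ν < 1

open Classical in
/-- The exponent of the decay of the pseudomode at the end of its support. -/
def decayRate (U : ℝ → ℂ) (ν ε₁ ε₂ lam : ℝ) : ℝ :=
  if BoundedAtInfty U then lam ^ (ε₂ / 2) else cutRadius U ν ε₁ ε₂ lam ^ (ν + 1 + ε₁)

theorem kappaRate_eq (U : ℝ → ℂ) (ν ε₁ ε₂ c lam : ℝ) :
    kappaRate U ν ε₁ ε₂ c lam = Real.exp (-c * decayRate U ν ε₁ ε₂ lam) := by
  unfold kappaRate decayRate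
  split_ifs <;> rfl

/-- What the construction needs to know about one end of the line. -/
structure EndControl (n : ℕ) (U : ℝ → ℂ) (ν ε₁ ε₂ : ℝ) : Prop where
  tendsto : Tendsto (cutRadius U ν ε₁ ε₂) atTop atTop
  width : ∀ᶠ lam in atTop, 0 < cutWidth U ν ε₁ ε₂ lam ∧
    cutWidth U ν ε₁ ε₂ lam ≤ cutRadius U ν ε₁ ε₂ lam / 4
  size : ∃ B : ℝ, 1 ≤ B ∧ ∀ᶠ lam in atTop, ∀ x, 0 ≤ x → x ≤ cutRadius U ν ε₁ ε₂ lam →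
    (U x).re ≤ lam / 2 ∧ ‖U x‖ ≤ B * lam
  small : ∀ η > 0, ∃ X : ℝ, ∀ᶠ lam in atTop, ∀ x, X ≤ x → x ≤ cutRadius U ν ε₁ ε₂ lam →
    jb x ^ ν ≤ η * √lam ∧ ‖U x‖ * jb x ^ ν ≤ η * |(U x).im| * √lam
  decay : ∀ X : ℝ, ∃ c > 0, ∀ᶠ lam in atTop, ∀ y,
    cutRadius U ν ε₁ ε₂ lam - cutWidth U ν ε₁ ε₂ lam ≤ y → y ≤ cutRadius U ν ε₁ ε₂ lam →
      c * decayRate U ν ε₁ ε₂ lam * √lam ≤ ∫ t in X..y, |(U t).im|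
  growth : ∀ η > 0, ∀ᶠ lam in atTop, lam ≤ Real.exp (η * decayRate U ν ε₁ ε₂ lam) ∧
    cutRadius U ν ε₁ ε₂ lam ≤ Real.exp (η * decayRate U ν ε₁ ε₂ lam) ∧
    (cutWidth U ν ε₁ ε₂ lam)⁻¹ ≤ Real.exp (η * decayRate U ν ε₁ ε₂ lam)
  sigma : ∃ C : ℝ, ∀ᶠ lam in atTop,
    (∀ x, 1 ≤ x → x < cutRadius U ν ε₁ ε₂ lam →
      ‖U x‖ * (jb x ^ ν / √lam) ^ (n + 1) ≤ C * sigmaRate U n ν ε₁ ε₂ lam) ∧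
    (1 / √lam) ^ (n + 1) ≤ C * sigmaRate U n ν ε₁ ε₂ lam

theorem one_div_sqrt_pow {lam : ℝ} (hlam : 0 < lam) (m : ℕ) :
    (1 / √lam) ^ m = lam ^ (-(m : ℝ) / 2) := by
  rw [Real.sqrt_eq_rpow, one_div, ← Real.rpow_neg hlam.le, ← Real.rpow_natCast,
    ← Real.rpow_mul hlam.le]
  congr 1; ring

theorem eventually_le_exp_of_isLittleO {f R : ℝ → ℝ} (hR : Tendsto R atTop atTop)
    (h : (fun x => Real.log (f x)) =o[atTop] R) (hf : ∀ᶠ x in atTop, 0 < f x) {η : ℝ} (hη : 0 < η) :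
    ∀ᶠ x in atTop, f x ≤ Real.exp (η * R x) := by
  filter_upwards [h.def hη, hf, hR.eventually_ge_atTop 0] with x hx hf hRx
  rw [← Real.log_le_iff_le_exp hf]
  rw [Real.norm_eq_abs, Real.norm_of_nonneg hRx] at hx
  exact (le_abs_self _).trans hx

/-! ### An end where the potential is bounded -/

section bounded

variable {n : ℕ} {U U' : ℝ → ℂ} {ν ε₁ ε₂ : ℝ}

theorem exists_norm_le_of_boundedAtInfty (hU : Continuous U) (hb : BoundedAtInfty U) :
    ∃ M : ℝ, 0 < M ∧ ∀ x, 0 ≤ x → ‖U x‖ ≤ M := by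
  obtain ⟨C, hC⟩ := hb.bound
  obtain ⟨X, hX⟩ := eventually_atTop.1 hC
  obtain ⟨K, hK⟩ := (isCompact_Icc (a := (0 : ℝ)) (b := X)).exists_bound_of_continuousOn
    hU.continuousOn
  refine ⟨max (max K C) 1, by positivity, fun x hx => ?_⟩
  rcases le_total x X with h | h
  · exact (hK x ⟨hx, h⟩).trans ((le_max_left _ _).trans (le_max_left _ _))
  · have := hX x h
    simp only [norm_one, mul_one] at this
    exact this.trans ((le_max_right _ _).trans (le_max_left _ _))

/-- Here `U = O(1)`, `|Im U|` is bounded below near infinity, and up to the radius a derivative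
costs at most a multiple of `λ^θ` with `θ = max ((1 + ε₂) ν / 2) 0`. The smallness of the
corrections amounts to `θ < 1/2`. -/
theorem EndHyp.endControl_of_bounded (h : EndHyp U U' ν ε₁) (hb : BoundedAtInfty U)
    (hε₂ : 0 < ε₂) (hε : ε₂ < 1 - ν) : EndControl n U ν ε₁ ε₂ := by
  have hδ : ∀ lam, cutRadius U ν ε₁ ε₂ lam = lam ^ ((1 + ε₂) / 2) := fun lam => by
    rw [cutRadius, if_pos hb]
  have hΔ : ∀ lam, cutWidth U ν ε₁ ε₂ lam = lam ^ ((1 + ε₂) / 2) / 4 := fun lam => by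
    rw [cutWidth, if_pos hb, hδ]
  have hR : ∀ lam, decayRate U ν ε₁ ε₂ lam = lam ^ (ε₂ / 2) := fun lam => by
    rw [decayRate, if_pos hb]
  obtain ⟨M, hM0, hM⟩ := exists_norm_le_of_boundedAtInfty h.lip.continuous hb
  obtain ⟨c0, hc0, X0, hX0⟩ := h.im_ge
  have hδt : Tendsto (fun lam : ℝ => lam ^ ((1 + ε₂) / 2)) atTop atTop :=
    tendsto_rpow_atTop (by linarith)
  have hRt : Tendsto (fun lam : ℝ => lam ^ (ε₂ / 2)) atTop atTop :=
    tendsto_rpow_atTop (by linarith)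
  set θ := max ((1 + ε₂) * ν / 2) 0 with hθ
  have hθ2 : θ < 1 / 2 := by
    rw [hθ, max_lt_iff]
    constructor
    -- For `ν > 0` the restriction on `ε₂` gives `(1 + ε₂) ν < (2 - ν) ν = 1 - (1 - ν)²`.
    · nlinarith [h.bounded hb, sq_nonneg (1 - ν)]
    · norm_num
  -- the cost of a derivative
  have hjb : ∀ lam, 1 ≤ lam → ∀ x, 1 ≤ x → x ≤ lam ^ ((1 + ε₂) / 2) →
      jb x ^ ν ≤ 2 ^ |ν| * lam ^ θ := by
    intro lam hlam x hx hxδ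
    have hlam0 : 0 < lam := by linarith
    refine (jb_rpow_le hx).trans ?_
    apply mul_le_mul_of_nonneg_left _ (by positivity)
    rcases le_total 0 ν with hν | hν
    · calc x ^ ν ≤ (lam ^ ((1 + ε₂) / 2)) ^ ν := Real.rpow_le_rpow (by linarith) hxδ hν
        _ = lam ^ ((1 + ε₂) * ν / 2) := by rw [← Real.rpow_mul hlam0.le]; congr 1; ring
        _ ≤ _ := Real.rpow_le_rpow_of_exponent_le hlam (le_max_left _ _)
    · calc x ^ ν ≤ 1 := Real.rpow_le_one_of_one_le_of_nonpos hx hν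
        _ ≤ _ := Real.one_le_rpow hlam (le_max_right _ _)
  refine ⟨?_, ?_, ?_, ?_, ?_, ?_, ?_⟩
  · simpa only [funext hδ] using hδt
  · filter_upwards [eventually_gt_atTop 0] with lam hlam
    rw [hδ, hΔ]
    exact ⟨by positivity, le_rfl⟩
  · refine ⟨1, le_rfl, ?_⟩
    filter_upwards [eventually_ge_atTop (2 * M)] with lam hlam x hx _
    have h1 := hM x hx
    have h2 := Complex.re_le_norm (U x)
    constructor <;> linarith
  · intro η hη
    refine ⟨max X0 1, ?_⟩
    have hlim : Tendsto (fun lam : ℝ => lam ^ (1 / 2 - θ)) atTop atTop :=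
      tendsto_rpow_atTop (by linarith)
    filter_upwards [eventually_ge_atTop 1, hlim.eventually_ge_atTop (2 ^ |ν| / η),
      hlim.eventually_ge_atTop (M * 2 ^ |ν| / (η * c0))] with lam hlam h1 h2 x hx hxδ
    rw [hδ] at hxδ
    have hlam0 : 0 < lam := by linarith
    have hj := hjb lam hlam x ((le_max_right _ _).trans hx) hxδ
    have hsq : √lam = lam ^ (1 / 2 - θ) * lam ^ θ := by
      rw [Real.sqrt_eq_rpow, ← Real.rpow_add hlam0]; congr 1; ring
    have hθ0 : 0 < lam ^ θ := Real.rpow_pos_of_pos hlam0 _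
    rw [div_le_iff₀ (by positivity)] at h1 h2
    constructor
    · rw [hsq]; nlinarith
    · have hx1 : 1 ≤ x := (le_max_right _ _).trans hx
      have hU := hM x (by linarith)
      have hI := hX0 x ((le_max_left _ _).trans hx)
      calc ‖U x‖ * jb x ^ ν ≤ M * (2 ^ |ν| * lam ^ θ) :=
            mul_le_mul hU hj (jb_rpow_pos _ _).le hM0.le
        _ = (M * 2 ^ |ν|) * lam ^ θ := by ring
        _ ≤ (lam ^ (1 / 2 - θ) * (η * c0)) * lam ^ θ := by gcongr
        _ = η * c0 * √lam := by rw [hsq]; ring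
        _ ≤ η * |(U x).im| * √lam := by gcongr
  · intro X
    set Y := max X (max X0 1) with hY
    refine ⟨c0 / 4, by positivity, ?_⟩
    filter_upwards [eventually_ge_atTop 1, hδt.eventually_ge_atTop (4 * Y)] with lam hlam h1 y hy hyδ
    rw [hδ, hΔ] at hy
    rw [hR]
    have hlam0 : 0 < lam := by linarith
    have hY1 : 1 ≤ Y := (le_max_right _ _).trans (le_max_right _ _)
    have hc : Continuous fun t => |(U t).im| :=
      (Complex.continuous_im.comp h.lip.continuous).abs
    have h2 : ∫ t in Y..y, c0 ≤ ∫ t in Y..y, |(U t).im| := by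
      apply intervalIntegral.integral_mono_on (by linarith) (by simp) (hc.intervalIntegrable _ _)
      intro t ht
      exact hX0 t (((le_max_left _ _).trans (le_max_right _ _)).trans ht.1)
    have h3 : 0 ≤ ∫ t in X..Y, |(U t).im| :=
      intervalIntegral.integral_nonneg (le_max_left _ _) fun t _ => abs_nonneg _
    rw [← intervalIntegral.integral_add_adjacent_intervals (hc.intervalIntegrable X Y)
      (hc.intervalIntegrable Y y)]
    rw [intervalIntegral.integral_const, smul_eq_mul] at h2
    -- The radius is exactly `decayRate` times `√λ`, so a lower bound for the integral proportional
    -- to the radius suffices.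
    have h4 : lam ^ (ε₂ / 2) * √lam = lam ^ ((1 + ε₂) / 2) := by
      rw [Real.sqrt_eq_rpow, ← Real.rpow_add hlam0]; congr 1; ring
    rw [mul_assoc, h4]
    nlinarith
  · intro η hη
    have hlog : (fun lam : ℝ => Real.log lam) =o[atTop] fun lam => lam ^ (ε₂ / 2) :=
      isLittleO_log_rpow_atTop (by linarith)
    have hlogδ : (fun lam : ℝ => Real.log (lam ^ ((1 + ε₂) / 2))) =o[atTop]
        fun lam => lam ^ (ε₂ / 2) := by
      refine (hlog.const_mul_left ((1 + ε₂) / 2)).congr' ?_ EventuallyEq.rfl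
      filter_upwards [eventually_gt_atTop 0] with lam hlam
      rw [Real.log_rpow hlam]
    have e1 := eventually_le_exp_of_isLittleO hRt hlog (eventually_gt_atTop 0) hη
    have e2 := eventually_le_exp_of_isLittleO hRt hlogδ (by
      filter_upwards [eventually_gt_atTop 0] with lam hlam
      exact Real.rpow_pos_of_pos hlam _) hη
    filter_upwards [e1, e2, hδt.eventually_ge_atTop 4, eventually_gt_atTop 0] with lam e1 e2 e3 e4
    rw [hδ, hΔ, hR]
    refine ⟨e1, e2, ?_⟩
    calc (lam ^ ((1 + ε₂) / 2) / 4)⁻¹ ≤ 1 := inv_le_one_of_one_le₀ (by linarith)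
      _ ≤ _ := Real.one_le_exp (by positivity)
  · refine ⟨(M + 1) * (2 ^ |ν|) ^ (n + 1), ?_⟩
    filter_upwards [eventually_ge_atTop 1] with lam hlam
    have hlam0 : 0 < lam := by linarith
    have h2ν : 1 ≤ ((2 : ℝ) ^ |ν|) ^ (n + 1) :=
      one_le_pow₀ (Real.one_le_rpow (by norm_num) (abs_nonneg _))
    have hσ : (lam ^ θ / √lam) ^ (n + 1) = sigmaRate U n ν ε₁ ε₂ lam := by
      rw [sigmaRate, if_pos hb, div_eq_mul_one_div, mul_pow, one_div_sqrt_pow hlam0]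
      split_ifs with hν
      · have : θ = 0 := by
          rw [hθ]; apply max_eq_right; nlinarith
        rw [this, Real.rpow_zero, one_pow, one_mul]; congr 1; push_cast; ring
      · have : θ = (1 + ε₂) * ν / 2 := by
          rw [hθ]; apply max_eq_left; push Not at hν; positivity
        rw [this, ← Real.rpow_natCast, ← Real.rpow_mul hlam0.le, ← Real.rpow_add hlam0]
        congr 1; push_cast; ring
    have hθ1 : 1 ≤ lam ^ θ := Real.one_le_rpow hlam (le_max_right _ _)
    rw [← hσ]
    constructor
    · intro x hx hxδ
      rw [hδ] at hxδ
      have hj := hjb lam hlam x hx hxδ.le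
      have hU := hM x (by linarith)
      have hj0 := jb_rpow_pos x ν
      calc ‖U x‖ * (jb x ^ ν / √lam) ^ (n + 1)
          ≤ (M + 1) * (2 ^ |ν| * lam ^ θ / √lam) ^ (n + 1) := by gcongr; linarith
        _ = _ := by rw [mul_div_assoc, mul_pow]; ring
    · calc (1 / √lam) ^ (n + 1) ≤ 1 * (lam ^ θ / √lam) ^ (n + 1) := by
            rw [one_mul]; gcongr
        _ ≤ _ := by
            gcongr
            nlinarith

theorem cutRadius_ge_of_bounded (hb : BoundedAtInfty U) (hε₂ : 0 < ε₂) {γ : ℝ} (hγ : 0 ≤ γ) :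
    ∃ c > 0, ∀ᶠ lam in atTop, c * lam ^ (1 / (2 * (γ + 1))) ≤ cutRadius U ν ε₁ ε₂ lam := by
  refine ⟨1, one_pos, ?_⟩
  filter_upwards [eventually_ge_atTop 1] with lam hlam
  rw [cutRadius, if_pos hb, one_mul]
  apply Real.rpow_le_rpow_of_exponent_le hlam
  have : 1 / (2 * (γ + 1)) ≤ 1 / 2 := by
    apply one_div_le_one_div_of_le <;> linarith
  linarith

end bounded

/-! ### An end where the potential is unbounded -/

section unbounded

variable {n : ℕ} {U U' : ℝ → ℂ} {ν ε₁ ε₂ : ℝ}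

theorem locallyLipschitz_im (hU : LocallyLipschitz U) :
    LocallyLipschitz (fun x => (((U x).im : ℝ) : ℂ)) :=
  hU.contDiff_comp (Complex.ofRealCLM.contDiff.comp Complex.imCLM.contDiff)

/-- It serves twice: near the radius, `|Im U|` changes only by a bounded factor over lengths of
order `δ^{-ν}`; globally, it grows at most like the exponential of `∫ ⟨t⟩^ν`. -/
theorem EndHyp.im_gronwall (h : EndHyp U U' ν ε₁) : ∃ C : ℝ, 0 ≤ C ∧ ∃ X : ℝ, ∀ x y, X ≤ x → x ≤ y →
    |(U y).im| ≤ |(U x).im| * Real.exp (C * ∫ t in x..y, jb t ^ ν) ∧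
    |(U x).im| ≤ |(U y).im| * Real.exp (C * ∫ t in x..y, jb t ^ ν) := by
  obtain ⟨C, X, hC⟩ := h.im_deriv
  refine ⟨max C 0, le_max_right _ _, X, fun x y hx hxy => ?_⟩
  have := norm_le_mul_exp_integral (locallyLipschitz_im h.lip)
    (f' := fun x => (((U' x).im : ℝ) : ℂ)) (C := max C 0) (X := X) (by
      filter_upwards [h.hasDeriv] with z hz
      exact (Complex.imCLM.hasFDerivAt.comp_hasDerivAt z hz).ofReal_comp) (continuous_jb_rpow ν) (by
      filter_upwards [hC] with z hz hXz
      simp only [Complex.norm_real, Real.norm_eq_abs]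
      refine (hz hXz).trans (mul_le_mul_of_nonneg_right (le_max_left _ _) ?_)
      exact mul_nonneg (abs_nonneg _) (jb_rpow_pos _ _).le) hx hxy
  simpa only [Complex.norm_real, Real.norm_eq_abs] using this

/-- If `ν < -1`, then `⟨t⟩^ν` is integrable at infinity and Gronwall's inequality bounds `U`. -/
theorem EndHyp.neg_one_le (h : EndHyp U U' ν ε₁) (hb : ¬ BoundedAtInfty U) : -1 ≤ ν := by
  by_contra hν
  push Not at hν
  apply hb
  obtain ⟨C, X, hC⟩ := h.norm_deriv
  set Y := max X 1 with hY
  have hY1 : 1 ≤ Y := le_max_right _ _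
  refine IsBigO.of_bound (‖U Y‖ * Real.exp (max C 0 * (2 ^ |ν| * (Y ^ (ν + 1) / (-(ν + 1)))))) ?_
  filter_upwards [eventually_ge_atTop Y] with y hy
  have h1 := (norm_le_mul_exp_integral h.lip h.hasDeriv (continuous_jb_rpow ν) (C := max C 0)
    (X := X) (by
      filter_upwards [hC] with z hz hXz
      refine (hz hXz).trans (mul_le_mul_of_nonneg_right (le_max_left _ _) ?_)
      exact mul_nonneg (norm_nonneg _) (jb_rpow_pos _ _).le) (le_max_left X 1) hy).1
  refine h1.trans ?_
  rw [norm_one, mul_one]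
  have h2 := integral_jb_rpow_le (s := ν) hY1 hy hν.ne
  have h3 : (y ^ (ν + 1) - Y ^ (ν + 1)) / (ν + 1) ≤ Y ^ (ν + 1) / (-(ν + 1)) := by
    rw [← neg_div_neg_eq]
    apply div_le_div_of_nonneg_right _ (by linarith)
    have : 0 ≤ y ^ (ν + 1) := Real.rpow_nonneg (by linarith) _
    linarith
  gcongr
  exact h2.trans (by gcongr)

/-- The consequences of the largeness of `Im U`, at points where `λ` is not yet reached. -/
theorem EndHyp.exists_bounds (h : EndHyp U U' ν ε₁) (hb : ¬ BoundedAtInfty U) :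
    ∃ A : ℝ, 1 ≤ A ∧ ∃ X : ℝ, ∀ x, X ≤ x → ∀ lam, 0 < lam →
      |(U x).im| ^ 2 ≤ lam * jb x ^ (4 * ν + 2 * ε₁ + 2) →
        jb x ^ (4 * ν + 2 * ε₁ + 2) ≤ A * lam ∧ |(U x).im| ≤ A * lam ∧
        |(U x).re| ≤ A * lam * jb x ^ (-2 * ε₁) ∧
        |(U x).re| * jb x ^ ν ≤ A * |(U x).im| * √lam * jb x ^ (-ν - 1 - 3 * ε₁) := by
  obtain ⟨A, hA⟩ := (h.unbounded hb).bound
  obtain ⟨X, hX⟩ := eventually_atTop.1 hA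
  refine ⟨max A 1, le_max_right _ _, X, fun x hx lam hlam hI => ?_⟩
  have h1 := hX x hx
  have hj : ∀ s : ℝ, 0 < jb x ^ s := jb_rpow_pos x
  rw [Real.norm_of_nonneg (mul_nonneg (hj _).le (add_nonneg (hj _).le (abs_nonneg _))),
    Real.norm_of_nonneg (by positivity)] at h1
  set B := max A 1 with hB
  have hB1 : 1 ≤ B := le_max_right _ _
  set p := 4 * ν + 2 * ε₁ + 2 with hp
  set I := |(U x).im| with hIdef
  have h2 : jb x ^ (4 * (ν + ε₁) + 2) * (jb x ^ (4 * ν + 2) + |(U x).re|) ≤ B * I ^ 2 :=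
    h1.trans (mul_le_mul_of_nonneg_right (le_max_left _ _) (by positivity))
  rw [mul_add] at h2
  -- The two exponents in the growth condition add up to `2 p`, where `p` is the exponent in the
  -- definition of the radius.
  have hpp : jb x ^ (4 * (ν + ε₁) + 2) * jb x ^ (4 * ν + 2) = jb x ^ p * jb x ^ p := by
    rw [← Real.rpow_add (jb_pos x), ← Real.rpow_add (jb_pos x)]; congr 1; rw [hp]; ring
  have h3 : jb x ^ p * jb x ^ p ≤ B * I ^ 2 := by
    rw [← hpp]; have := mul_nonneg (hj (4 * (ν + ε₁) + 2)).le (abs_nonneg (U x).re); linarith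
  have h4 : jb x ^ (4 * (ν + ε₁) + 2) * |(U x).re| ≤ B * I ^ 2 := by
    have := mul_pos (hj (4 * (ν + ε₁) + 2)) (hj (4 * ν + 2)); linarith
  have h5 : jb x ^ p ≤ B * lam := by
    have : jb x ^ p * jb x ^ p ≤ (B * lam) * jb x ^ p := by
      refine h3.trans ?_
      rw [mul_assoc]; exact mul_le_mul_of_nonneg_left hI (by linarith)
    exact le_of_mul_le_mul_right this (hj p)
  have hI0 : 0 ≤ I := abs_nonneg _
  refine ⟨h5, ?_, ?_, ?_⟩
  · apply le_of_sq_le_sq _ (by positivity)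
    calc I ^ 2 ≤ lam * (B * lam) := hI.trans (by gcongr)
      _ ≤ B * (lam * (B * lam)) := le_mul_of_one_le_left (by positivity) hB1
      _ = _ := by ring
  · have e : jb x ^ p * jb x ^ (-2 * ε₁) = jb x ^ (4 * ν + 2) := by
      rw [← Real.rpow_add (jb_pos x)]; congr 1; rw [hp]; ring
    have e2 : jb x ^ (4 * (ν + ε₁) + 2) * jb x ^ (-2 * ε₁) = jb x ^ p := by
      rw [← Real.rpow_add (jb_pos x)]; congr 1; rw [hp]; ring
    have h6 : jb x ^ p * |(U x).re| ≤ jb x ^ p * (B * lam * jb x ^ (-2 * ε₁)) := by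
      calc jb x ^ p * |(U x).re|
          = jb x ^ (-2 * ε₁) * (jb x ^ (4 * (ν + ε₁) + 2) * |(U x).re|) := by rw [← e2]; ring
        _ ≤ jb x ^ (-2 * ε₁) * (B * (lam * jb x ^ p)) :=
            mul_le_mul_of_nonneg_left (h4.trans (by gcongr)) (hj _).le
        _ = _ := by ring
    exact le_of_mul_le_mul_left h6 (hj p)
  · have hI' : I ≤ √lam * jb x ^ (p / 2) := by
      apply le_of_sq_le_sq _ (by have := hj (p / 2); positivity)
      rw [mul_pow, Real.sq_sqrt hlam.le, ← Real.rpow_natCast (jb x ^ (p / 2)),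
        ← Real.rpow_mul (jb_pos x).le, show p / 2 * ((2 : ℕ) : ℝ) = p by push_cast; ring]
      exact hI
    have e : jb x ^ (4 * (ν + ε₁) + 2) * jb x ^ (-ν - 1 - 3 * ε₁) = jb x ^ (p / 2) * jb x ^ ν := by
      rw [← Real.rpow_add (jb_pos x), ← Real.rpow_add (jb_pos x)]; congr 1; rw [hp]; ring
    have h6 : jb x ^ (4 * (ν + ε₁) + 2) * (|(U x).re| * jb x ^ ν) ≤
        jb x ^ (4 * (ν + ε₁) + 2) * (B * I * √lam * jb x ^ (-ν - 1 - 3 * ε₁)) := by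
      calc jb x ^ (4 * (ν + ε₁) + 2) * (|(U x).re| * jb x ^ ν)
          = (jb x ^ (4 * (ν + ε₁) + 2) * |(U x).re|) * jb x ^ ν := by ring
        _ ≤ (B * I ^ 2) * jb x ^ ν := mul_le_mul_of_nonneg_right h4 (hj _).le
        _ = B * I * jb x ^ ν * I := by ring
        _ ≤ B * I * jb x ^ ν * (√lam * jb x ^ (p / 2)) := by have := hj ν; gcongr
        _ = B * I * √lam * (jb x ^ (p / 2) * jb x ^ ν) := by ring
        _ = _ := by rw [← e]; ring
    exact le_of_mul_le_mul_left h6 (hj _)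

/-- If the quotient defining the radius stayed below a constant `K`, then `exists_bounds` with `λ =
K` would bound both parts of `U`. -/
theorem EndHyp.not_bddAbove (h : EndHyp U U' ν ε₁) (hε₁ : 0 < ε₁) (hb : ¬ BoundedAtInfty U)
    (L : ℝ) : ∃ x, 0 ≤ x ∧ L < |(U x).im| ^ 2 / jb x ^ (4 * ν + 2 * ε₁ + 2) := by
  by_contra hne
  push Not at hne
  apply hb
  obtain ⟨A, hA1, X, hX⟩ := h.exists_bounds hb
  set K := max L 1 with hK
  have hK0 : 0 < K := lt_of_lt_of_le one_pos (le_max_right _ _)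
  refine IsBigO.of_bound (A * K + A * K) ?_
  filter_upwards [eventually_ge_atTop X, eventually_ge_atTop 0] with x hx hx0
  have hI : |(U x).im| ^ 2 ≤ K * jb x ^ (4 * ν + 2 * ε₁ + 2) := by
    have := (hne x hx0).trans (le_max_left L 1)
    rwa [div_le_iff₀ (jb_rpow_pos _ _)] at this
  obtain ⟨_, h2, h3, _⟩ := hX x hx K hK0 hI
  have h4 : jb x ^ (-2 * ε₁) ≤ 1 :=
    Real.rpow_le_one_of_one_le_of_nonpos (one_le_jb x) (by linarith)
  have h5 : |(U x).re| ≤ A * K := h3.trans (mul_le_of_le_one_right (by positivity) h4)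
  rw [norm_one, mul_one]
  exact (Complex.norm_le_abs_re_add_abs_im _).trans (add_le_add h5 h2)

/-- The defining properties of the radius in the unbounded case. -/
theorem EndHyp.cutRadius_spec (h : EndHyp U U' ν ε₁) (hε₁ : 0 < ε₁) (hb : ¬ BoundedAtInfty U)
    (ε₂ : ℝ) :
    Tendsto (cutRadius U ν ε₁ ε₂) atTop atTop ∧
    ∀ᶠ lam in atTop, |(U (cutRadius U ν ε₁ ε₂ lam)).im| ^ 2
        = lam * jb (cutRadius U ν ε₁ ε₂ lam) ^ (4 * ν + 2 * ε₁ + 2) ∧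
      ∀ x, 0 ≤ x → x ≤ cutRadius U ν ε₁ ε₂ lam →
        |(U x).im| ^ 2 ≤ lam * jb x ^ (4 * ν + 2 * ε₁ + 2) := by
  set F : ℝ → ℝ := fun x => |(U x).im| ^ 2 / jb x ^ (4 * ν + 2 * ε₁ + 2) with hF
  have hFc : Continuous F :=
    (((Complex.continuous_im.comp h.lip.continuous).abs).pow 2).div (continuous_jb_rpow _)
      fun x => (jb_rpow_pos _ _).ne'
  set S : ℝ → Set ℝ := fun lam => {δ : ℝ | 0 ≤ δ ∧ F δ = lam} with hS
  have hδ : ∀ lam, cutRadius U ν ε₁ ε₂ lam = sInf (S lam) := fun lam => by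
    rw [cutRadius, if_neg hb]
  have hne : ∀ lam, F 0 < lam → (S lam).Nonempty := by
    intro lam hlam
    obtain ⟨x, hx, hxl⟩ := h.not_bddAbove hε₁ hb lam
    obtain ⟨z, hz, hz'⟩ := intermediate_value_Icc hx hFc.continuousOn ⟨hlam.le, hxl.le⟩
    exact ⟨z, hz.1, hz'⟩
  have hbb : ∀ lam, BddBelow (S lam) := fun lam => ⟨0, fun _ hx => hx.1⟩
  have hclosed : ∀ lam, IsClosed (S lam) := fun lam =>
    isClosed_Ici.inter (isClosed_singleton.preimage hFc)
  have hmem : ∀ lam, F 0 < lam → sInf (S lam) ∈ S lam := fun lam hlam =>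
    (hclosed lam).csInf_mem (hne lam hlam) (hbb lam)
  have hlt : ∀ lam, F 0 < lam → ∀ x, 0 ≤ x → x ≤ sInf (S lam) → F x ≤ lam := by
    intro lam hlam x hx hxδ
    -- A value above `λ` before the infimum would, by the intermediate value theorem, force an
    -- earlier solution.
    by_contra hcon
    push Not at hcon
    obtain ⟨z, hz, hz'⟩ := intermediate_value_Icc hx hFc.continuousOn ⟨hlam.le, hcon.le⟩
    have h1 : sInf (S lam) ≤ z := csInf_le (hbb lam) ⟨hz.1, hz'⟩
    have h2 : z = x := le_antisymm hz.2 (hxδ.trans h1)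
    rw [h2] at hz'
    linarith
  constructor
  · rw [tendsto_atTop]
    intro b
    obtain ⟨K, hK⟩ := (isCompact_Icc (a := (0 : ℝ)) (b := b)).exists_bound_of_continuousOn
      hFc.continuousOn
    filter_upwards [eventually_gt_atTop K, eventually_gt_atTop (F 0)] with lam hlam hlam0
    rw [hδ]
    by_contra hcon
    push Not at hcon
    have h1 := hmem lam hlam0
    have h2 := hK _ ⟨h1.1, hcon.le⟩
    rw [h1.2, Real.norm_eq_abs] at h2
    linarith [le_abs_self lam]
  · filter_upwards [eventually_gt_atTop (F 0)] with lam hlam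
    rw [hδ]
    constructor
    · have := (hmem lam hlam).2
      simp only [hF] at this
      rwa [div_eq_iff (jb_rpow_pos _ _).ne'] at this
    · intro x hx hxδ
      have := hlt lam hlam x hx hxδ
      simp only [hF] at this
      rwa [div_le_iff₀ (jb_rpow_pos _ _)] at this

end unbounded

/-! ### Control of the radius and of the decay at an unbounded end -/

theorem rpow_isLittleO_rpow {a b : ℝ} (hab : a < b) :
    (fun x : ℝ => x ^ a) =o[atTop] fun x => x ^ b := by
  refine (isLittleO_iff_tendsto' ?_).2 ?_
  · filter_upwards [eventually_gt_atTop 0] with x hx h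
    exact absurd h (Real.rpow_pos_of_pos hx b).ne'
  · refine (tendsto_rpow_neg_atTop (y := b - a) (by linarith)).congr' ?_
    filter_upwards [eventually_gt_atTop 0] with x hx
    rw [← Real.rpow_sub hx, neg_sub]

section unbounded

variable {n : ℕ} {U U' : ℝ → ℂ} {ν ε₁ ε₂ : ℝ}

/-- Far out, `|Re U| ≤ A λ ⟨x⟩^{-2ε₁}` is below `λ / 2`; on the remaining compact interval `U` is
bounded and `λ` is large. -/
theorem EndHyp.size_of_unbounded (h : EndHyp U U' ν ε₁) (hε₁ : 0 < ε₁)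
    (hb : ¬ BoundedAtInfty U) :
    ∃ B : ℝ, 1 ≤ B ∧ ∀ᶠ lam in atTop, ∀ x, 0 ≤ x → x ≤ cutRadius U ν ε₁ ε₂ lam →
    (U x).re ≤ lam / 2 ∧ ‖U x‖ ≤ B * lam := by
  obtain ⟨_, hspec⟩ := h.cutRadius_spec hε₁ hb ε₂
  obtain ⟨A, hA1, X, hX⟩ := h.exists_bounds hb
  have hlim := (tendsto_jb_rpow_neg (s := -2 * ε₁) (by linarith)).eventually_le_const
    (show (0 : ℝ) < 1 / (2 * A) by positivity)
  obtain ⟨Y, hY⟩ := eventually_atTop.1 hlim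
  set Z := max X Y with hZ
  obtain ⟨K, hK⟩ := (isCompact_Icc (a := (0 : ℝ)) (b := Z)).exists_bound_of_continuousOn
    h.lip.continuous.continuousOn
  refine ⟨A + A, by linarith, ?_⟩
  filter_upwards [hspec, eventually_ge_atTop (2 * K), eventually_gt_atTop 0] with
    lam hs hlamK hlam0 x hx hxδ
  rcases le_total x Z with hxZ | hxZ
  · have h1 := hK x ⟨hx, hxZ⟩
    have h2 := Complex.re_le_norm (U x)
    have h3 := norm_nonneg (U x)
    constructor
    · linarith
    · nlinarith
  · obtain ⟨_, h2, h3, _⟩ := hX x ((le_max_left _ _).trans hxZ) lam hlam0 (hs.2 x hx hxδ)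
    have h4 := hY x ((le_max_right _ _).trans hxZ)
    have h5 : |(U x).re| ≤ lam / 2 := by
      calc _ ≤ A * lam * (1 / (2 * A)) := h3.trans (by gcongr)
        _ = lam / 2 := by field_simp
    refine ⟨(le_abs_self _).trans h5, ?_⟩
    refine (Complex.norm_le_abs_re_add_abs_im _).trans ?_
    nlinarith

/-- Up to constants both ratios carry a power of `⟨x⟩` with exponent at most `-ε₁`, thanks to `ν ≥
-1`. They become small once `x` is large, uniformly in `λ`. -/
theorem EndHyp.small_of_unbounded (h : EndHyp U U' ν ε₁) (hε₁ : 0 < ε₁)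
    (hb : ¬ BoundedAtInfty U) :
    ∀ η > 0, ∃ X : ℝ, ∀ᶠ lam in atTop, ∀ x, X ≤ x → x ≤ cutRadius U ν ε₁ ε₂ lam →
    jb x ^ ν ≤ η * √lam ∧ ‖U x‖ * jb x ^ ν ≤ η * |(U x).im| * √lam := by
  intro η hη
  obtain ⟨_, hspec⟩ := h.cutRadius_spec hε₁ hb ε₂
  obtain ⟨A, hA1, X, hX⟩ := h.exists_bounds hb
  have hν := h.neg_one_le hb
  have hlim := (tendsto_jb_rpow_neg (s := -ε₁) (by linarith)).eventually_le_const
    (show (0 : ℝ) < η / (2 * A) by positivity)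
  obtain ⟨Y, hY⟩ := eventually_atTop.1 hlim
  refine ⟨max (max X Y) 0, ?_⟩
  filter_upwards [hspec, eventually_gt_atTop 0] with lam hs hlam0 x hx hxδ
  have hx0 : 0 ≤ x := (le_max_right _ _).trans hx
  have hxX : X ≤ x := ((le_max_left _ _).trans (le_max_left _ _)).trans hx
  have hxY : Y ≤ x := ((le_max_right _ _).trans (le_max_left _ _)).trans hx
  obtain ⟨h1, h2, h3, h4⟩ := hX x hxX lam hlam0 (hs.2 x hx0 hxδ)
  have h5 := hY x hxY
  have hj : ∀ s : ℝ, 0 < jb x ^ s := jb_rpow_pos x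
  have hle : ∀ s, s ≤ -ε₁ → jb x ^ s ≤ η / (2 * A) := fun s hs =>
    (Real.rpow_le_rpow_of_exponent_le (one_le_jb x) hs).trans h5
  have hI0 := abs_nonneg (U x).im
  have hs0 := Real.sqrt_nonneg lam
  have ht : jb x ^ ν ≤ η / 2 * √lam := by
    apply le_of_sq_le_sq _ (by positivity)
    -- The exponent `2 ν` is split as `p - 2 (ν + 1 + ε₁)`, and `⟨x⟩^p` is bounded by `A λ`.
    have e1 : (jb x ^ ν) ^ 2 = jb x ^ (4 * ν + 2 * ε₁ + 2) * (jb x ^ (-(ν + 1 + ε₁))) ^ 2 := by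
      rw [← Real.rpow_natCast, ← Real.rpow_natCast, ← Real.rpow_mul (jb_pos x).le,
        ← Real.rpow_mul (jb_pos x).le, ← Real.rpow_add (jb_pos x)]
      congr 1; push_cast; ring
    have e2 := hle (-(ν + 1 + ε₁)) (by linarith)
    rw [e1, mul_pow, Real.sq_sqrt hlam0.le]
    calc _ ≤ (A * lam) * (η / (2 * A)) ^ 2 := by
          have := hj (-(ν + 1 + ε₁)); gcongr
      _ = (1 / A) * ((η / 2) ^ 2 * lam) := by field_simp
      _ ≤ 1 * ((η / 2) ^ 2 * lam) := by
          gcongr; rw [div_le_one (by linarith)]; exact hA1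
      _ = _ := one_mul _
  constructor
  · nlinarith
  · have e3 : |(U x).re| * jb x ^ ν ≤ η / 2 * |(U x).im| * √lam := by
      calc _ ≤ A * |(U x).im| * √lam * (η / (2 * A)) := h4.trans (by
            have := hle (-ν - 1 - 3 * ε₁) (by linarith); gcongr)
        _ = _ := by field_simp
    calc ‖U x‖ * jb x ^ ν ≤ (|(U x).re| + |(U x).im|) * jb x ^ ν :=
          mul_le_mul_of_nonneg_right (Complex.norm_le_abs_re_add_abs_im _) (hj _).le
      _ = |(U x).re| * jb x ^ ν + |(U x).im| * jb x ^ ν := add_mul _ _ _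
      _ ≤ η / 2 * |(U x).im| * √lam + |(U x).im| * (η / 2 * √lam) := by gcongr
      _ = _ := by ring

theorem cutWidth_of_unbounded (hb : ¬ BoundedAtInfty U) (lam : ℝ) :
    cutWidth U ν ε₁ ε₂ lam = cutRadius U ν ε₁ ε₂ lam ^ (-ν) / 4 := by
  rw [cutWidth, if_neg hb]

theorem cutWidth_bounds_of_unbounded (hν : -1 ≤ ν) (hb : ¬ BoundedAtInfty U) {lam : ℝ}
    (hδ : 1 ≤ cutRadius U ν ε₁ ε₂ lam) :
    0 < cutWidth U ν ε₁ ε₂ lam ∧ cutWidth U ν ε₁ ε₂ lam ≤ cutRadius U ν ε₁ ε₂ lam / 4 := by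
  rw [cutWidth_of_unbounded hb]
  have h0 : 0 < cutRadius U ν ε₁ ε₂ lam := by linarith
  have h1 := Real.rpow_pos_of_pos h0 (-ν)
  have h2 : cutRadius U ν ε₁ ε₂ lam ^ (-ν) ≤ cutRadius U ν ε₁ ε₂ lam := by
    calc _ ≤ cutRadius U ν ε₁ ε₂ lam ^ (1 : ℝ) :=
          Real.rpow_le_rpow_of_exponent_le hδ (by linarith)
      _ = _ := Real.rpow_one _
  constructor <;> linarith

/-- On `[δ - 2Δ, δ]` Gronwall's inequality keeps `|Im U|` comparable to its value `√λ ⟨δ⟩^{p/2}` at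
`δ`. The left half of this interval lies below every admissible `y` and contributes a multiple of `Δ
√λ δ^{p/2}`; as `-ν + p/2 = ν + 1 + ε₁`, this is the required size. -/
theorem EndHyp.decay_of_unbounded (h : EndHyp U U' ν ε₁) (hε₁ : 0 < ε₁)
    (hb : ¬ BoundedAtInfty U) : ∀ X : ℝ, ∃ c > 0, ∀ᶠ lam in atTop, ∀ y,
    cutRadius U ν ε₁ ε₂ lam - cutWidth U ν ε₁ ε₂ lam ≤ y → y ≤ cutRadius U ν ε₁ ε₂ lam →
      c * decayRate U ν ε₁ ε₂ lam * √lam ≤ ∫ t in X..y, |(U t).im| := by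
  intro X
  obtain ⟨hδt, hspec⟩ := h.cutRadius_spec hε₁ hb ε₂
  obtain ⟨C, hC0, Y, hY⟩ := h.im_gronwall
  have hν := h.neg_one_le hb
  set p := 4 * ν + 2 * ε₁ + 2 with hp
  have hcU : Continuous fun t => |(U t).im| :=
    (Complex.continuous_im.comp h.lip.continuous).abs
  -- The Gronwall factor across the interval: its length is `δ^{-ν} / 2`, and `⟨s⟩^ν ≤ 2^{|ν|}
  -- 2^{|ν|} δ^ν` on it.
  set K := Real.exp (C * (2 ^ |ν| * 2 ^ |ν|)) with hK
  have hK0 : 0 < K := Real.exp_pos _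
  have h2p : (0 : ℝ) < 2 ^ |p / 2| := by positivity
  refine ⟨1 / (4 * K * 2 ^ |p / 2|), by positivity, ?_⟩
  filter_upwards [hspec, hδt.eventually_ge_atTop (2 * max (max X Y) 1), eventually_gt_atTop 0]
    with lam hs hδ hlam0 y hy hyδ
  set δ := cutRadius U ν ε₁ ε₂ lam with hδdef
  have hδ1 : 1 ≤ δ := by have := le_max_right (max X Y) 1; linarith
  have hδX : 2 * X ≤ δ := by
    have := (le_max_left X Y).trans (le_max_left (max X Y) 1); linarith
  have hδY : 2 * Y ≤ δ := by
    have := (le_max_right X Y).trans (le_max_left (max X Y) 1); linarith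
  have hw : 0 < cutWidth U ν ε₁ ε₂ lam ∧ cutWidth U ν ε₁ ε₂ lam ≤ δ / 4 :=
    cutWidth_bounds_of_unbounded hν hb hδ1
  rw [cutWidth_of_unbounded hb, ← hδdef] at hw hy
  rw [decayRate, if_neg hb, ← hδdef]
  set Δ := δ ^ (-ν) / 4 with hΔ
  have hδ0 : 0 < δ := by linarith
  -- `|Im U|` is comparable to its value at `δ` near `δ`
  have hlow : ∀ t, δ - 2 * Δ ≤ t → t ≤ δ → |(U δ).im| / K ≤ |(U t).im| := by
    intro t ht htδ
    rw [div_le_iff₀ hK0]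
    refine (hY t δ (by linarith) htδ).1.trans ?_
    apply mul_le_mul_of_nonneg_left _ (abs_nonneg _)
    rw [hK, Real.exp_le_exp]
    apply mul_le_mul_of_nonneg_left _ hC0
    have h1 : ∀ s ∈ Icc t δ, jb s ^ ν ≤ 2 ^ |ν| * (2 ^ |ν| * δ ^ ν) := by
      intro s hs
      have hs1 : δ / 2 ≤ s := by linarith [hs.1]
      have h2 : jb s ^ ν ≤ 2 ^ |ν| * jb δ ^ ν := by
        have hm : jb s ≤ jb δ := by
          unfold jb; apply Real.sqrt_le_sqrt; nlinarith [hs.2]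
        have hm2 : jb δ ≤ 2 * jb s := by
          unfold jb
          rw [Real.sqrt_le_iff]
          refine ⟨by positivity, ?_⟩
          rw [mul_pow, Real.sq_sqrt (by positivity)]
          nlinarith
        exact rpow_le_mul_rpow (jb_pos _) hm2 (by linarith [jb_pos δ])
      exact h2.trans (by gcongr; exact jb_rpow_le hδ1)
    calc ∫ s in t..δ, jb s ^ ν ≤ ∫ s in t..δ, 2 ^ |ν| * (2 ^ |ν| * δ ^ ν) :=
          intervalIntegral.integral_mono_on htδ ((continuous_jb_rpow ν).intervalIntegrable _ _)
            (by simp) h1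
      _ = (δ - t) * (2 ^ |ν| * (2 ^ |ν| * δ ^ ν)) := by
          rw [intervalIntegral.integral_const, smul_eq_mul]
      _ ≤ (2 * Δ) * (2 ^ |ν| * (2 ^ |ν| * δ ^ ν)) := by gcongr; linarith
      _ = (2 ^ |ν| * 2 ^ |ν|) * (δ ^ (-ν) * δ ^ ν) / 2 := by rw [hΔ]; ring
      _ = (2 ^ |ν| * 2 ^ |ν|) / 2 := by
          rw [← Real.rpow_add hδ0, neg_add_cancel, Real.rpow_zero, mul_one]
      _ ≤ _ := half_le_self (by positivity)
  have hIδ : |(U δ).im| = √lam * jb δ ^ (p / 2) := by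
    have h1 : |(U δ).im| ^ 2 = (√lam * jb δ ^ (p / 2)) ^ 2 := by
      rw [hs.1, mul_pow, Real.sq_sqrt hlam0.le, ← Real.rpow_natCast (jb δ ^ (p / 2)),
        ← Real.rpow_mul (jb_pos δ).le, show p / 2 * ((2 : ℕ) : ℝ) = p by push_cast; ring]
    have := jb_rpow_pos δ (p / 2)
    exact (pow_left_inj₀ (abs_nonneg _) (by positivity) two_ne_zero).1 h1
  have hmain : ∫ t in (δ - 2 * Δ)..y, |(U t).im| ≥ Δ * (|(U δ).im| / K) := by
    have h1 : ∫ t in (δ - 2 * Δ)..y, |(U δ).im| / K ≤ ∫ t in (δ - 2 * Δ)..y, |(U t).im| := by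
      apply intervalIntegral.integral_mono_on (by linarith) (by simp) (hcU.intervalIntegrable _ _)
      intro t ht
      exact hlow t ht.1 (ht.2.trans hyδ)
    rw [intervalIntegral.integral_const, smul_eq_mul] at h1
    refine le_trans ?_ h1
    gcongr
    linarith
  have h3 : 0 ≤ ∫ t in X..(δ - 2 * Δ), |(U t).im| :=
    intervalIntegral.integral_nonneg (by linarith) fun t _ => abs_nonneg _
  rw [← intervalIntegral.integral_add_adjacent_intervals
    (hcU.intervalIntegrable X (δ - 2 * Δ)) (hcU.intervalIntegrable (δ - 2 * Δ) y)]
  have h4 : δ ^ (p / 2) ≤ 2 ^ |p / 2| * jb δ ^ (p / 2) := le_jb_rpow hδ1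
  have h5 : 1 / (4 * K * 2 ^ |p / 2|) * δ ^ (ν + 1 + ε₁) * √lam ≤ Δ * (|(U δ).im| / K) := by
    have e : δ ^ (ν + 1 + ε₁) = δ ^ (-ν) * δ ^ (p / 2) := by
      rw [← Real.rpow_add hδ0]; congr 1; rw [hp]; ring
    calc _ = 1 / (4 * K * 2 ^ |p / 2|) * (δ ^ (-ν) * δ ^ (p / 2)) * √lam := by rw [e]
      _ ≤ 1 / (4 * K * 2 ^ |p / 2|) * (δ ^ (-ν) * (2 ^ |p / 2| * jb δ ^ (p / 2))) * √lam := by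
          gcongr
      _ = _ := by rw [hIδ, hΔ]; field_simp
  linarith

/-- At the radius, `λ` is `|Im U|²` times a power of `⟨δ⟩`. By Gronwall's inequality its logarithm
is bounded by `log δ` and a power of `δ` that is lower than the exponent `ν + 1 + ε₁` of the decay
rate. -/
theorem EndHyp.growth_of_unbounded (h : EndHyp U U' ν ε₁) (hε₁ : 0 < ε₁)
    (hb : ¬ BoundedAtInfty U) :
    ∀ η > 0, ∀ᶠ lam in atTop, lam ≤ Real.exp (η * decayRate U ν ε₁ ε₂ lam) ∧
    cutRadius U ν ε₁ ε₂ lam ≤ Real.exp (η * decayRate U ν ε₁ ε₂ lam) ∧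
    (cutWidth U ν ε₁ ε₂ lam)⁻¹ ≤ Real.exp (η * decayRate U ν ε₁ ε₂ lam) := by
  intro η hη
  obtain ⟨hδt, hspec⟩ := h.cutRadius_spec hε₁ hb ε₂
  obtain ⟨C, hC0, Y, hY⟩ := h.im_gronwall
  have hν := h.neg_one_le hb
  set p := 4 * ν + 2 * ε₁ + 2 with hp
  set Z := max Y 1 with hZ
  have hZ1 : 1 ≤ Z := le_max_right _ _
  -- all quantities are dominated by powers of the exponential of the following one
  have hR : ∀ lam, decayRate U ν ε₁ ε₂ lam = cutRadius U ν ε₁ ε₂ lam ^ (ν + 1 + ε₁) := fun lam => by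
    rw [decayRate, if_neg hb]
  have hlo1 : ∀ k : ℝ, (fun d : ℝ => k * Real.log d) =o[atTop] fun d => d ^ (ν + 1 + ε₁) :=
    fun k => (isLittleO_log_rpow_atTop (by linarith)).const_mul_left k
  have hlo2 : ∀ k : ℝ, (fun d : ℝ => k * d ^ (ν + 1 + ε₁ / 2)) =o[atTop]
      fun d => d ^ (ν + 1 + ε₁) :=
    fun k => (rpow_isLittleO_rpow (by linarith)).const_mul_left k
  have hlo3 : ∀ k : ℝ, (fun _ : ℝ => k) =o[atTop] fun d => d ^ (ν + 1 + ε₁) := fun k =>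
    isLittleO_const_left.2 (Or.inr (tendsto_norm_atTop_atTop.comp
      (tendsto_rpow_atTop (by linarith))))
  set K := C * (2 ^ |ν + ε₁ / 2| / (ν + 1 + ε₁ / 2)) with hK
  have hν2 : 0 < ν + 1 + ε₁ / 2 := by linarith
  have hsum : (fun d : ℝ => 2 * (Real.log (|(U Z).im| + 1) + K * d ^ (ν + 1 + ε₁ / 2))
      + |p| * (Real.log 2 + Real.log d)) =o[atTop] fun d => d ^ (ν + 1 + ε₁) := by
    have := ((hlo3 (2 * Real.log (|(U Z).im| + 1))).add (hlo2 (2 * K))).add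
      ((hlo3 (|p| * Real.log 2)).add (hlo1 |p|))
    refine this.congr_left fun d => ?_
    ring
  have hsum2 : (fun d : ℝ => Real.log 4 + ν * Real.log d) =o[atTop] fun d => d ^ (ν + 1 + ε₁) :=
    (hlo3 _).add (hlo1 ν)
  filter_upwards [hspec, hδt.eventually_ge_atTop Z, eventually_gt_atTop 0,
    hδt.eventually (hsum.def hη), hδt.eventually (hsum2.def hη),
    hδt.eventually ((hlo1 1).def hη)] with lam hs hδ hlam0 e1 e2 e3
  rw [hR, cutWidth_of_unbounded hb]
  set δ := cutRadius U ν ε₁ ε₂ lam with hδdef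
  have hδ1 : 1 ≤ δ := hZ1.trans hδ
  have hδ0 : 0 < δ := by linarith
  have hd0 : 0 < δ ^ (ν + 1 + ε₁) := Real.rpow_pos_of_pos hδ0 _
  rw [Real.norm_eq_abs, Real.norm_of_nonneg hd0.le] at e1 e2 e3
  refine ⟨?_, ?_, ?_⟩
  · rw [← Real.log_le_iff_le_exp hlam0]
    refine le_trans ?_ ((le_abs_self _).trans e1)
    have h1 := (hY Z δ (le_max_left _ _) hδ).1
    -- Raising the exponent to `ν + ε₁ / 2` avoids the logarithm at `ν = -1` and still stays below
    -- the exponent of the decay rate.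
    have h2 : ∫ t in Z..δ, jb t ^ ν ≤ 2 ^ |ν + ε₁ / 2| / (ν + 1 + ε₁ / 2) * δ ^ (ν + 1 + ε₁ / 2) := by
      calc ∫ t in Z..δ, jb t ^ ν ≤ ∫ t in Z..δ, jb t ^ (ν + ε₁ / 2) := by
            apply intervalIntegral.integral_mono_on hδ
              ((continuous_jb_rpow _).intervalIntegrable _ _)
              ((continuous_jb_rpow _).intervalIntegrable _ _)
            intro t _
            exact Real.rpow_le_rpow_of_exponent_le (one_le_jb t) (by linarith)
        _ ≤ _ := integral_jb_rpow_le hZ1 hδ (by linarith)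
        _ ≤ 2 ^ |ν + ε₁ / 2| * (δ ^ (ν + 1 + ε₁ / 2) / (ν + 1 + ε₁ / 2)) := by
            rw [show ν + ε₁ / 2 + 1 = ν + 1 + ε₁ / 2 by ring]
            gcongr
            have : 0 ≤ Z ^ (ν + 1 + ε₁ / 2) := Real.rpow_nonneg (by linarith) _
            linarith
        _ = _ := by ring
    have h3 : |(U δ).im| ≤ (|(U Z).im| + 1) * Real.exp (K * δ ^ (ν + 1 + ε₁ / 2)) := by
      refine h1.trans (mul_le_mul (by linarith) ?_ (Real.exp_pos _).le (by positivity))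
      rw [Real.exp_le_exp, hK, mul_assoc]
      exact mul_le_mul_of_nonneg_left h2 hC0
    have h4 : lam = |(U δ).im| ^ 2 * jb δ ^ (-p) := by
      rw [hs.1, mul_assoc, ← Real.rpow_add (jb_pos δ), add_neg_cancel, Real.rpow_zero, mul_one]
    have h5 : jb δ ^ (-p) ≤ (2 * δ) ^ |p| := by
      calc jb δ ^ (-p) ≤ jb δ ^ |p| :=
            Real.rpow_le_rpow_of_exponent_le (one_le_jb δ) (neg_le_abs p)
        _ ≤ _ := Real.rpow_le_rpow (jb_pos δ).le (jb_le_two_mul hδ1) (abs_nonneg _)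
    have h6 : lam ≤ ((|(U Z).im| + 1) * Real.exp (K * δ ^ (ν + 1 + ε₁ / 2))) ^ 2 * (2 * δ) ^ |p| := by
      rw [h4]
      have := jb_rpow_pos δ (-p)
      gcongr
    have hUZ : 0 < |(U Z).im| + 1 := by positivity
    have hlog := Real.log_le_log hlam0 h6
    rwa [Real.log_mul (by positivity) (by positivity), Real.log_pow, Real.log_mul hUZ.ne'
      (Real.exp_pos _).ne', Real.log_exp, Real.log_rpow (by positivity),
      Real.log_mul two_ne_zero hδ0.ne'] at hlog
  · rw [← Real.log_le_iff_le_exp hδ0]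
    rw [one_mul] at e3
    exact (le_abs_self _).trans e3
  · have e : (δ ^ (-ν) / 4)⁻¹ = 4 * δ ^ ν := by
      rw [inv_div, Real.rpow_neg hδ0.le, div_inv_eq_mul]
    have : 0 < δ ^ ν := Real.rpow_pos_of_pos hδ0 _
    rw [e, ← Real.log_le_iff_le_exp (by positivity), Real.log_mul (by norm_num) this.ne',
      Real.log_rpow hδ0]
    exact (le_abs_self _).trans e2

/-- For `ν < 0` the supremum in the rate dominates each value, and it is bounded below by the value
at a fixed point where `U ≠ 0`, which takes care of the compact part. For `ν ≥ 0` one uses `‖U‖ ≤ B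
λ` and `⟨x⟩^ν ≤ 2^{|ν|} δ^ν`. -/
theorem EndHyp.sigma_of_unbounded (h : EndHyp U U' ν ε₁) (hε₁ : 0 < ε₁)
    (hb : ¬ BoundedAtInfty U) :
    ∃ C : ℝ, ∀ᶠ lam in atTop,
    (∀ x, 1 ≤ x → x < cutRadius U ν ε₁ ε₂ lam →
      ‖U x‖ * (jb x ^ ν / √lam) ^ (n + 1) ≤ C * sigmaRate U n ν ε₁ ε₂ lam) ∧
    (1 / √lam) ^ (n + 1) ≤ C * sigmaRate U n ν ε₁ ε₂ lam := by
  obtain ⟨hδt, _⟩ := h.cutRadius_spec hε₁ hb ε₂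
  have hpow : ∀ x, (jb x ^ ν) ^ (n + 1) = jb x ^ (((n : ℝ) + 1) * ν) := fun x => by
    rw [← Real.rpow_natCast, ← Real.rpow_mul (jb_pos x).le]
    congr 1; push_cast; ring
  rcases lt_or_ge ν 0 with hν | hν
  · obtain ⟨c0, hc0, X, hX⟩ := h.im_ge
    set Y := max X 1 with hY
    set G : ℝ → ℝ := fun x => ‖U x‖ * jb x ^ (((n : ℝ) + 1) * ν) with hG
    have hGc : Continuous G := h.lip.continuous.norm.mul (continuous_jb_rpow _)
    have hGY : 0 < G Y := by
      have h1 := hX Y (le_max_left _ _)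
      have h2 := Complex.abs_im_le_norm (U Y)
      exact mul_pos (by linarith) (jb_rpow_pos _ _)
    refine ⟨max 1 (1 / G Y), ?_⟩
    filter_upwards [eventually_gt_atTop 0, hδt.eventually_gt_atTop Y] with lam hlam0 hδ
    have hσ : sigmaRate U n ν ε₁ ε₂ lam = (1 / √lam) ^ (n + 1) *
        sSup (G '' Ioo 0 (cutRadius U ν ε₁ ε₂ lam)) := by
      rw [sigmaRate, if_neg hb, if_pos hν, one_div_sqrt_pow hlam0]
      congr 2; push_cast; ring
    have hbdd : BddAbove (G '' Ioo 0 (cutRadius U ν ε₁ ε₂ lam)) :=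
      ((isCompact_Icc (a := (0 : ℝ)) (b := cutRadius U ν ε₁ ε₂ lam)).image hGc).bddAbove.mono
        (image_mono Ioo_subset_Icc_self)
    have hY1 : 1 ≤ Y := le_max_right _ _
    have hsup : G Y ≤ sSup (G '' Ioo 0 (cutRadius U ν ε₁ ε₂ lam)) :=
      le_csSup hbdd ⟨Y, ⟨by linarith, hδ⟩, rfl⟩
    rw [hσ]
    set M := sSup (G '' Ioo 0 (cutRadius U ν ε₁ ε₂ lam)) with hM
    have hM0 : 0 < M := hGY.trans_le hsup
    have hq : 0 < (1 / √lam) ^ (n + 1) := by have := Real.sqrt_pos.2 hlam0; positivity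
    constructor
    · intro x hx hxδ
      have h1 : G x ≤ M := le_csSup hbdd ⟨x, ⟨by linarith, hxδ⟩, rfl⟩
      calc _ = (1 / √lam) ^ (n + 1) * G x := by
            rw [div_eq_mul_one_div, mul_pow, hpow]; simp only [hG]; ring
        _ ≤ 1 * ((1 / √lam) ^ (n + 1) * M) := by rw [one_mul]; gcongr
        _ ≤ _ := by gcongr; exact le_max_left _ _
    · calc (1 / √lam) ^ (n + 1) = (1 / G Y) * ((1 / √lam) ^ (n + 1) * G Y) := by field_simp
        _ ≤ max 1 (1 / G Y) * ((1 / √lam) ^ (n + 1) * M) := by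
            gcongr; exact le_max_right _ _
  · obtain ⟨B, hB, hsize⟩ := h.size_of_unbounded (ε₂ := ε₂) hε₁ hb
    refine ⟨B * (2 ^ |ν|) ^ (n + 1), ?_⟩
    filter_upwards [eventually_ge_atTop 1, hδt.eventually_ge_atTop 1, hsize] with lam hlam hδ hsz
    have hlam0 : 0 < lam := by linarith
    set δ := cutRadius U ν ε₁ ε₂ lam with hδdef
    have hδ0 : 0 < δ := by linarith
    have hσ : sigmaRate U n ν ε₁ ε₂ lam = lam * (δ ^ ν / √lam) ^ (n + 1) := by
      rw [sigmaRate, if_neg hb, if_neg (not_lt.2 hν), div_eq_mul_one_div (δ ^ ν), mul_pow,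
        one_div_sqrt_pow hlam0, ← Real.rpow_natCast, ← Real.rpow_mul hδ0.le, ← hδdef]
      rw [show (1 - (n : ℝ)) / 2 = 1 + -((n + 1 : ℕ) : ℝ) / 2 by push_cast; ring,
        Real.rpow_add hlam0, Real.rpow_one,
        show ν * ((n + 1 : ℕ) : ℝ) = ((n : ℝ) + 1) * ν by push_cast; ring]
      ring
    have h2 : 1 ≤ ((2 : ℝ) ^ |ν|) ^ (n + 1) :=
      one_le_pow₀ (Real.one_le_rpow (by norm_num) (abs_nonneg _))
    have hδν : 1 ≤ δ ^ ν := Real.one_le_rpow hδ hν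
    rw [hσ]
    constructor
    · intro x hx hxδ
      have h3 : jb x ^ ν ≤ 2 ^ |ν| * δ ^ ν := (jb_rpow_le hx).trans (by gcongr)
      have h4 := (hsz x (by linarith) hxδ.le).2
      have h5 := jb_rpow_pos x ν
      calc _ ≤ (B * lam) * (2 ^ |ν| * δ ^ ν / √lam) ^ (n + 1) := by gcongr
        _ = _ := by rw [mul_div_assoc, mul_pow]; ring
    · calc (1 / √lam) ^ (n + 1) ≤ 1 * (lam * (δ ^ ν / √lam) ^ (n + 1)) := by
            rw [one_mul]
            refine le_trans ?_ (le_mul_of_one_le_left (by positivity) hlam)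
            gcongr
        _ ≤ _ := by
            gcongr
            nlinarith

theorem EndHyp.endControl (h : EndHyp U U' ν ε₁) (hε₁ : 0 < ε₁) (hε₂ : 0 < ε₂)
    (hε : BoundedAtInfty U → ε₂ < 1 - ν) : EndControl n U ν ε₁ ε₂ := by
  by_cases hb : BoundedAtInfty U
  · exact h.endControl_of_bounded hb hε₂ (hε hb)
  · have hδt := (h.cutRadius_spec hε₁ hb ε₂).1
    refine ⟨hδt, ?_, h.size_of_unbounded hε₁ hb, h.small_of_unbounded hε₁ hb,
      h.decay_of_unbounded hε₁ hb, h.growth_of_unbounded hε₁ hb, h.sigma_of_unbounded hε₁ hb⟩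
    filter_upwards [hδt.eventually_ge_atTop 1] with lam hlam
    exact cutWidth_bounds_of_unbounded (h.neg_one_le hb) hb hlam

/-- In the unbounded case `λ = |Im U(δ)|² ⟨δ⟩^{-p}`, and `-p ≤ 2` because `ν ≥ -1`. So `λ` is at
most a multiple of `δ^{2γ+2}`. -/
theorem EndHyp.cutRadius_ge (h : EndHyp U U' ν ε₁) (hε₁ : 0 < ε₁) (hε₂ : 0 < ε₂) {γ : ℝ}
    (hγ : 0 ≤ γ) (hU : (fun x => (U x).im) =O[atTop] fun x => |x| ^ γ) :
    ∃ c > 0, ∀ᶠ lam in atTop, c * lam ^ (1 / (2 * (γ + 1))) ≤ cutRadius U ν ε₁ ε₂ lam := by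
  by_cases hb : BoundedAtInfty U
  · exact cutRadius_ge_of_bounded hb hε₂ hγ
  obtain ⟨hδt, hspec⟩ := h.cutRadius_spec hε₁ hb ε₂
  obtain ⟨C, hC, hUC⟩ := hU.exists_pos
  have hν := h.neg_one_le hb
  have hγ1 : 0 < 2 * (γ + 1) := by linarith
  refine ⟨(1 / (4 * C ^ 2)) ^ (1 / (2 * (γ + 1))), by positivity, ?_⟩
  filter_upwards [hspec, hδt.eventually_ge_atTop 1, hδt.eventually hUC.bound,
    eventually_gt_atTop 0] with lam hs hδ1 hI hlam0
  set δ := cutRadius U ν ε₁ ε₂ lam with hδdef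
  have hδ0 : 0 < δ := by linarith
  have h0 : 0 < |δ| ^ γ := Real.rpow_pos_of_pos (abs_pos.2 hδ0.ne') _
  rw [Real.norm_eq_abs, Real.norm_of_nonneg h0.le, abs_of_pos hδ0] at hI
  have h1 : lam ≤ 4 * C ^ 2 * δ ^ (2 * (γ + 1)) := by
    have h4 : lam = |(U δ).im| ^ 2 * jb δ ^ (-(4 * ν + 2 * ε₁ + 2)) := by
      rw [hs.1, mul_assoc, ← Real.rpow_add (jb_pos δ), add_neg_cancel, Real.rpow_zero, mul_one]
    have h5 : jb δ ^ (-(4 * ν + 2 * ε₁ + 2)) ≤ (2 * δ) ^ (2 : ℝ) :=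
      (Real.rpow_le_rpow_of_exponent_le (one_le_jb δ) (by linarith)).trans
        (Real.rpow_le_rpow (jb_pos δ).le (jb_le_two_mul hδ1) (by norm_num))
    have h6 := jb_rpow_pos δ (-(4 * ν + 2 * ε₁ + 2))
    calc lam = |(U δ).im| ^ 2 * jb δ ^ (-(4 * ν + 2 * ε₁ + 2)) := h4
      _ ≤ (C * δ ^ γ) ^ 2 * (2 * δ) ^ (2 : ℝ) := by gcongr
      _ = 4 * C ^ 2 * (δ ^ (γ * 2) * δ ^ (2 : ℝ)) := by
          rw [mul_pow, ← Real.rpow_natCast (δ ^ γ), ← Real.rpow_mul hδ0.le,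
            Real.mul_rpow (by norm_num) hδ0.le]
          norm_num
          ring
      _ = _ := by rw [← Real.rpow_add hδ0]; congr 2; ring
  have h2 : 1 / (4 * C ^ 2) * lam ≤ δ ^ (2 * (γ + 1)) := by
    rw [one_div_mul_eq_div, div_le_iff₀ (by positivity)]; linarith
  calc _ = (1 / (4 * C ^ 2) * lam) ^ (1 / (2 * (γ + 1))) := by
        rw [Real.mul_rpow (by positivity) hlam0.le]
    _ ≤ (δ ^ (2 * (γ + 1))) ^ (1 / (2 * (γ + 1))) :=
        Real.rpow_le_rpow (by positivity) h2 (by positivity)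
    _ = δ := by
        rw [← Real.rpow_mul hδ0.le, mul_one_div_cancel hγ1.ne', Real.rpow_one]

end unbounded

/-! ### Bounds for the expansion on one half-line -/

theorem IsClassicalJet.exists_ae_bound {n : ℕ} {V : ℝ → ℂ} {E : ℕ → ℝ → ℂ}
    (hE : IsClassicalJet n V E) (R : ℝ) :
    ∃ K : ℝ, 1 ≤ K ∧ ∀ᵐ x, |x| ≤ R → ∀ m ≤ n + 1, ‖E m x‖ ≤ K := by
  have hex : ∀ m, ∃ K : ℝ, 0 ≤ K ∧ (m ≤ n + 1 → ∀ᵐ x, |x| ≤ R → ‖E m x‖ ≤ K) := by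
    intro m
    rcases lt_trichotomy m (n + 1) with hm | rfl | hm
    · obtain ⟨K, hK⟩ := (isCompact_Icc (a := -R) (b := R)).exists_bound_of_continuousOn
        (hE.locallyLipschitz m (Nat.lt_succ_iff.1 hm)).continuous.continuousOn
      exact ⟨max K 0, le_max_right _ _, fun _ => Eventually.of_forall fun x hx =>
        (hK x (abs_le.1 hx)).trans (le_max_left _ _)⟩
    · obtain ⟨K, hK⟩ := hE.ae_bounded R
      refine ⟨max K 0, le_max_right _ _, fun _ => ?_⟩
      filter_upwards [hK] with x hx hxR
      exact (hx hxR).trans (le_max_left _ _)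
    · exact ⟨0, le_rfl, fun h => absurd h (not_le.2 hm)⟩
  choose K hK0 hK using hex
  refine ⟨1 + ∑ m ∈ Finset.range (n + 2), K m,
    le_add_of_nonneg_right (Finset.sum_nonneg fun m _ => hK0 m), ?_⟩
  have hall : ∀ᵐ x, ∀ m, m ≤ n + 1 → |x| ≤ R → ‖E m x‖ ≤ K m := by
    rw [ae_all_iff]
    intro m
    by_cases hm : m ≤ n + 1
    · filter_upwards [hK m hm] with x hx _ using hx
    · exact Eventually.of_forall fun x h => absurd h hm
  filter_upwards [hall] with x hx hxR m hm
  have h1 := Finset.single_le_sum (f := K) (fun i _ => hK0 i)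
    (Finset.mem_range.2 (Nat.lt_succ_of_le hm))
  linarith [hx m hm hxR]

/-- One end of the line, parametrised by `x ↦ s x` with `s = ± 1`, `x ≥ 0`. -/
structure EndData (n : ℕ) (V : ℝ → ℂ) (E : ℕ → ℝ → ℂ) (s : ℝ) (U : ℝ → ℂ) (ν ε₁ ε₂ : ℝ) :
    Prop where
  sign : s = 1 ∨ s = -1
  profile : ∀ x, U x = V (s * x)
  im_sign : ∃ c > 0, ∃ X : ℝ, ∀ x, X ≤ x → c ≤ s * (U x).im
  jet : ∃ C : ℝ, ∃ X : ℝ, ∀ᵐ x, X ≤ x → ∀ m, 1 ≤ m → m ≤ n + 1 →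
    ‖E m (s * x)‖ ≤ C * (‖U x‖ * (jb x ^ ν) ^ m)
  control : EndControl n U ν ε₁ ε₂

section

variable {n : ℕ} {V U : ℝ → ℂ} {E : ℕ → ℝ → ℂ} {s ν ε₁ ε₂ : ℝ}

theorem quasiMeasurePreserving_sign {s : ℝ} (hs : s = 1 ∨ s = -1) {p : ℝ → Prop}
    (h : ∀ᵐ x, p x) : ∀ᵐ x, p (s * x) := by
  rcases hs with rfl | rfl
  · simpa using h
  · simpa using (Measure.measurePreserving_neg (volume : Measure ℝ)).quasiMeasurePreserving.ae h

theorem EndData.abs_sign_mul (h : EndData n V E s U ν ε₁ ε₂) (x : ℝ) : |s * x| = |x| := by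
  rcases h.sign with rfl | rfl <;> simp

theorem EndData.norm_wkbG (h : EndData n V E s U ν ε₁ ε₂) (hE : IsClassicalJet n V E) {lam δ : ℝ}
    (hlam : 0 < lam) (hδ : 0 ≤ δ) (hre : ∀ x, 0 ≤ x → x ≤ δ → (U x).re < lam) :
    ContinuousOn (fun t => s * (wkbSum V E n lam (s * t)).re) (Icc 0 δ) ∧
    ∀ x ∈ Icc 0 δ, ‖wkbG V n lam (s * x)‖
      = Real.exp (-∫ t in (0 : ℝ)..x, s * (wkbSum V E n lam (s * t)).re) := by
  have hre' : ∀ x, 0 ≤ x → x ≤ δ → (V (s * x)).re < lam := fun x h1 h2 => by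
    rw [← h.profile]; exact hre x h1 h2
  -- the interval that carries this end
  have hI : ∃ a b : ℝ, a ≤ 0 ∧ 0 ≤ b ∧ (∀ y ∈ Icc a b, (V y).re < lam) ∧
      ∀ x ∈ Icc 0 δ, s * x ∈ Icc a b := by
    rcases h.sign with hs | hs
    · refine ⟨0, δ, le_rfl, hδ, fun y hy => ?_, fun x hx => ?_⟩
      · simpa [hs] using hre' y hy.1 hy.2
      · simpa [hs] using hx
    · refine ⟨-δ, 0, by linarith, le_rfl, fun y hy => ?_, fun x hx => ?_⟩
      · simpa [hs] using hre' (-y) (by linarith [hy.2]) (by linarith [hy.1])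
      · rw [hs]; constructor <;> linarith [hx.1, hx.2]
  obtain ⟨a, b, ha, hb, hab, hmem⟩ := hI
  have hPc := (locallyLipschitzOn_wkbSum (lam := lam) hE hab).continuousOn
  have hPs : ContinuousOn (fun t => wkbSum V E n lam (s * t)) (Icc 0 δ) :=
    hPc.comp (by fun_prop) hmem
  have hcont : ContinuousOn (fun t => s * (wkbSum V E n lam (s * t)).re) (Icc 0 δ) :=
    continuousOn_const.mul (Complex.continuous_re.comp_continuousOn hPs)
  refine ⟨hcont, fun x hx => ?_⟩
  rw [wkbG_eq hE hlam ha hb hab (hmem x hx), Complex.norm_exp]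
  congr 1
  have h1 : ∫ t in (0 : ℝ)..s * x, wkbSum V E n lam t
      = ∫ t in (0 : ℝ)..x, (s : ℂ) * wkbSum V E n lam (s * t) := by
    have := intervalIntegral.smul_integral_comp_mul_left (a := 0) (b := x)
      (wkbSum V E n lam) s
    rw [mul_zero] at this
    rw [← this, intervalIntegral.integral_const_mul, Complex.real_smul]
  have hsub : uIcc 0 x ⊆ Icc 0 δ := by
    rw [uIcc_of_le hx.1]; exact Icc_subset_Icc_right hx.2
  have hii : IntervalIntegrable (fun t => (s : ℂ) * wkbSum V E n lam (s * t)) volume 0 x :=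
    ((continuousOn_const.mul hPs).mono hsub).intervalIntegrable
  rw [h1, Complex.neg_re]
  congr 1
  have h2 := Complex.reCLM.intervalIntegral_comp_comm hii
  simp only [Complex.reCLM_apply, Complex.re_ofReal_mul] at h2
  exact h2.symm

theorem sigmaRate_nonneg {lam : ℝ} (hlam : 0 ≤ lam) : 0 ≤ sigmaRate U n ν ε₁ ε₂ lam := by
  have hr : ∀ y : ℝ, 0 ≤ lam ^ y := fun y => Real.rpow_nonneg hlam y
  have hcr : 0 ≤ cutRadius U ν ε₁ ε₂ lam := by
    unfold cutRadius
    split_ifs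
    · exact hr _
    · exact Real.sInf_nonneg fun y hy => hy.1
  unfold sigmaRate
  split_ifs
  · exact hr _
  · exact hr _
  · refine mul_nonneg (hr _) (Real.sSup_nonneg ?_)
    rintro _ ⟨y, _, rfl⟩
    exact mul_nonneg (norm_nonneg _) (jb_rpow_pos _ _).le
  · exact mul_nonneg (Real.rpow_nonneg hcr _) (hr _)

theorem TermBounds.abs_re_wkbSum_le {B C K lam μ y : ℝ} (hB : 0 ≤ B) (hC : 0 ≤ C) (hμ : 1 ≤ μ)
    (hK : ‖V y‖ ≤ K) (h : TermBounds n V E B lam μ (K / lam) 1 y)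
    (hb : ‖wkbSum V E n lam y - wkbTerm V E lam 0 y‖ ≤ C * (K / lam) * 1) :
    |(wkbSum V E n lam y).re| ≤ (K + C * K) / μ := by
  obtain ⟨ρ, hρ1, hρ2, hρ3⟩ := h.re_wkbTerm_zero hB
  have hμ0 := h.pos
  have hK0 : 0 ≤ K := (norm_nonneg _).trans hK
  have hρ0 : 0 ≤ ρ := le_trans (by positivity) hρ1
  have h1 : |(wkbSum V E n lam y).re - (wkbTerm V E lam 0 y).re| ≤ C * K / μ := by
    rw [← Complex.sub_re]
    refine (Complex.abs_re_le_norm _).trans (hb.trans ?_)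
    rw [mul_one, mul_div_assoc]
    have : μ ≤ lam := by rw [← h.sq]; nlinarith
    gcongr
  have h2 : |(wkbTerm V E lam 0 y).re| ≤ K / μ := by
    rw [hρ3, abs_mul, abs_of_nonneg hρ0, div_eq_mul_inv]
    exact mul_le_mul ((Complex.abs_im_le_norm _).trans hK) hρ2 hρ0 hK0
  have h3 := abs_add_le ((wkbSum V E n lam y).re - (wkbTerm V E lam 0 y).re)
    ((wkbTerm V E lam 0 y).re)
  rw [sub_add_cancel] at h3
  rw [add_div]
  linarith

/-- The choice of `η` makes the correction `P - T_0` at most half of the lower bound `|Im V| / (2 (1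
+ B) μ)` for `|Re T_0|`. -/
theorem TermBounds.re_wkbSum_mem {B C η lam μ t y : ℝ} (hB : 0 ≤ B) (hC : 0 ≤ C)
    (hs : s = 1 ∨ s = -1) (hsV : s * (V y).im = |(V y).im|)
    (h : TermBounds n V E B lam μ (‖V y‖ / lam) t y)
    (hb : ‖wkbSum V E n lam y - wkbTerm V E lam 0 y‖ ≤ C * (‖V y‖ / lam) * t)
    (hη : ‖V y‖ * t ≤ η * |(V y).im| * μ) (hηC : C * η ≤ 1 / (4 * (1 + B))) :
    (4 * (1 + B) * μ)⁻¹ * |(V y).im| ≤ s * (wkbSum V E n lam y).re ∧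
      s * (wkbSum V E n lam y).re ≤ 2 / μ * |(V y).im| := by
  obtain ⟨ρ, hρ1, hρ2, hρ3⟩ := h.re_wkbTerm_zero hB
  have hμ0 := h.pos
  have hI0 := abs_nonneg (V y).im
  have hs1 : |s| = 1 := by rcases hs with rfl | rfl <;> simp
  have h1 : |s * (wkbSum V E n lam y).re - |(V y).im| * ρ| ≤ (4 * (1 + B) * μ)⁻¹ * |(V y).im| := by
    have e : s * (wkbSum V E n lam y).re - |(V y).im| * ρ
        = s * (wkbSum V E n lam y - wkbTerm V E lam 0 y).re := by
      rw [Complex.sub_re, hρ3, ← hsV]; ring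
    rw [e, abs_mul, hs1, one_mul]
    refine (Complex.abs_re_le_norm _).trans (hb.trans ?_)
    calc C * (‖V y‖ / lam) * t = C * (‖V y‖ * t) / lam := by ring
      _ ≤ C * (η * |(V y).im| * μ) / lam := by
          have := h.lam_pos; gcongr
      _ = (C * η) * (|(V y).im| / μ) := by
          rw [← h.sq]; field_simp
      _ ≤ 1 / (4 * (1 + B)) * (|(V y).im| / μ) := by gcongr
      _ = _ := by field_simp
  have h2 := abs_le.1 h1
  have h3 : |(V y).im| * (2 * (1 + B) * μ)⁻¹ ≤ |(V y).im| * ρ := by gcongr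
  have h4 : |(V y).im| * ρ ≤ |(V y).im| * μ⁻¹ := by gcongr
  have h5 : |(V y).im| * (2 * (1 + B) * μ)⁻¹ = 2 * ((4 * (1 + B) * μ)⁻¹ * |(V y).im|) := by
    field_simp; ring
  have h6 : (4 * (1 + B) * μ)⁻¹ * |(V y).im| ≤ |(V y).im| * μ⁻¹ := by
    rw [mul_comm]
    apply mul_le_mul_of_nonneg_left _ hI0
    apply inv_anti₀ hμ0
    nlinarith
  have h7 : 2 / μ * |(V y).im| = |(V y).im| * μ⁻¹ + |(V y).im| * μ⁻¹ := by ring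
  constructor <;> linarith

/-- The control of the expansion near an end, in the form in which it enters the norm estimates. -/
theorem EndData.exists_ae_bounds (h : EndData n V E s U ν ε₁ ε₂) (hE : IsClassicalJet n V E) :
    ∃ X : ℝ, 1 ≤ X ∧ ∃ C : ℝ, 1 ≤ C ∧ ∀ᶠ lam in atTop,
      (∀ᵐ x, 0 ≤ x → x < cutRadius U ν ε₁ ε₂ lam →
        ‖wkbSum V E n lam (s * x)‖ ≤ C * √lam ∧
        ‖wkbResidual V E n lam (s * x)‖ ≤ C * sigmaRate U n ν ε₁ ε₂ lam ∧
        (x ≤ X → |s * (wkbSum V E n lam (s * x)).re| ≤ C / √lam) ∧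
        (X < x → (C * √lam)⁻¹ * |(U x).im| ≤ s * (wkbSum V E n lam (s * x)).re ∧
          s * (wkbSum V E n lam (s * x)).re ≤ C / √lam * |(U x).im|)) := by
  obtain ⟨Bs, hBs1, hsize⟩ := h.control.size
  obtain ⟨Cj, Xj, hjet⟩ := h.jet
  obtain ⟨c0, hc0, Xi, him⟩ := h.im_sign
  obtain ⟨Cσ, hσ⟩ := h.control.sigma
  obtain ⟨B, hBdef⟩ : ∃ B, B = max Bs (max Cj 1) := ⟨_, rfl⟩
  have hBs : Bs ≤ B := hBdef ▸ le_max_left _ _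
  have hBj : Cj ≤ B := hBdef ▸ (le_max_left _ _).trans (le_max_right _ _)
  have hB1 : 1 ≤ B := hBdef ▸ (le_max_right _ _).trans (le_max_right _ _)
  have hB0 : 0 ≤ B := by linarith
  obtain ⟨C, hC, hwkb⟩ := exists_wkb_bounds n hB0
  obtain ⟨η, hη0, hη1, hηC⟩ : ∃ η : ℝ, 0 < η ∧ η ≤ 1 ∧ C * η ≤ 1 / (4 * (1 + B)) := by
    refine ⟨min 1 (1 / (4 * (1 + B) * (C + 1))), by positivity, min_le_left _ _, ?_⟩
    calc C * _ ≤ (C + 1) * (1 / (4 * (1 + B) * (C + 1))) :=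
          mul_le_mul (by linarith) (min_le_right _ _) (by positivity) (by linarith)
      _ = _ := by field_simp
  obtain ⟨Xs, hsmall⟩ := h.control.small η hη0
  obtain ⟨X, hXdef⟩ : ∃ X, X = max (max Xj Xi) (max Xs 1) := ⟨_, rfl⟩
  have hX1 : 1 ≤ X := hXdef ▸ (le_max_right _ _).trans (le_max_right _ _)
  have hXs : Xs ≤ X := hXdef ▸ (le_max_left _ _).trans (le_max_right _ _)
  have hXi : Xi ≤ X := hXdef ▸ (le_max_right _ _).trans (le_max_left _ _)
  have hXj : Xj ≤ X := hXdef ▸ (le_max_left _ _).trans (le_max_left _ _)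
  obtain ⟨K, hK1, hK⟩ := hE.exists_ae_bound X
  have hKs := quasiMeasurePreserving_sign h.sign hK
  have e1 : 0 ≤ C * |Cσ| := by positivity
  have e2 : 0 ≤ C * K := by positivity
  have e3 : 0 ≤ C * |Cσ| * K := by positivity
  obtain ⟨Cf, hCf⟩ : ∃ Cf, Cf = C + (C * |Cσ| * K + C * |Cσ|) + 4 * (1 + B) + (K + C * K) :=
    ⟨_, rfl⟩
  refine ⟨X, hX1, Cf, by linarith, ?_⟩
  filter_upwards [hsize, hsmall, hσ, eventually_ge_atTop K] with lam hsz hsm hsg hlamK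
  have hlam1 : 1 ≤ lam := hK1.trans hlamK
  have hlam0 : 0 < lam := by linarith
  have hμ0 : 0 < √lam := Real.sqrt_pos.2 hlam0
  have hμ1 : 1 ≤ √lam := Real.one_le_sqrt.2 hlam1
  have hμsq : √lam ^ 2 = lam := Real.sq_sqrt hlam0.le
  have hσpos : 0 ≤ sigmaRate U n ν ε₁ ε₂ lam := sigmaRate_nonneg hlam0.le
  have hσabs : Cσ * sigmaRate U n ν ε₁ ε₂ lam ≤ |Cσ| * sigmaRate U n ν ε₁ ε₂ lam :=
    mul_le_mul_of_nonneg_right (le_abs_self _) hσpos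
  have hs1 : |s| = 1 := by rcases h.sign with rfl | rfl <;> simp
  filter_upwards [hjet, hKs] with x hxj hxK hx0 hxδ
  obtain ⟨hre, hnm⟩ := hsz x hx0 hxδ.le
  rw [h.profile] at hre hnm
  have hnmB : ‖V (s * x)‖ ≤ B * lam := hnm.trans (mul_le_mul_of_nonneg_right hBs hlam0.le)
  rcases le_or_gt x X with hxX | hxX
  · have hxK' := hxK (by rw [h.abs_sign_mul, abs_of_nonneg hx0]; exact hxX)
    -- On the compact part `V` may vanish, so its derivatives cannot be measured against `‖V‖`; the
    -- constants `v = K / λ` and `t = 1` are used instead.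
    have hTB : TermBounds n V E B lam (√lam) (K / lam) 1 (s * x) := by
      refine ⟨hμ0, hμsq, hre, hnmB, by positivity, ?_, zero_le_one, hμ1, ?_⟩
      · rw [div_le_iff₀ hlam0]; nlinarith
      · intro m _ hm
        refine (hxK' m hm).trans ?_
        rw [one_pow, mul_one, mul_assoc, div_mul_cancel₀ _ hlam0.ne']
        nlinarith
    obtain ⟨b1, b2, b3⟩ := hwkb V E lam _ (K / lam) 1 (s * x) hTB
    have hV0 := hxK' 0 (Nat.zero_le _)
    rw [hE.zero] at hV0
    have hsum := hTB.abs_re_wkbSum_le hB0 hC hμ1 hV0 b1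
    refine ⟨?_, ?_, fun _ => ?_, fun hXx => absurd hxX (not_le.2 hXx)⟩
    · refine b2.trans (mul_le_mul_of_nonneg_right ?_ hμ0.le)
      linarith
    · refine b3.trans ?_
      calc C * √lam ^ 2 * (K / lam) * (1 / √lam) ^ (n + 1) = C * K * (1 / √lam) ^ (n + 1) := by
            rw [hμsq]; field_simp
        _ ≤ C * K * (|Cσ| * sigmaRate U n ν ε₁ ε₂ lam) :=
            mul_le_mul_of_nonneg_left (hsg.2.trans hσabs) e2
        _ = (C * |Cσ| * K) * sigmaRate U n ν ε₁ ε₂ lam := by ring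
        _ ≤ _ := mul_le_mul_of_nonneg_right (by linarith) hσpos
    · rw [abs_mul, hs1, one_mul]
      exact hsum.trans (div_le_div_of_nonneg_right (by linarith) hμ0.le)
  · have hsmx := hsm x (hXs.trans hxX.le) hxδ.le
    have hsV : s * (V (s * x)).im = |(V (s * x)).im| := by
      have h1 := him x (hXi.trans hxX.le)
      rw [h.profile] at h1
      have h2 : |s * (V (s * x)).im| = s * (V (s * x)).im := abs_of_nonneg (by linarith)
      rw [← h2, abs_mul, hs1, one_mul]
    have hTB : TermBounds n V E B lam (√lam) (‖V (s * x)‖ / lam) (jb x ^ ν) (s * x) := by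
      refine ⟨hμ0, hμsq, hre, hnmB, by positivity, ?_, (jb_rpow_pos _ _).le, ?_, ?_⟩
      · rwa [div_le_iff₀ hlam0]
      · exact hsmx.1.trans (mul_le_of_le_one_left hμ0.le hη1)
      · intro m hm hm'
        refine (hxj (hXj.trans hxX.le) m hm hm').trans ?_
        rw [h.profile, show B * (‖V (s * x)‖ / lam) * (jb x ^ ν) ^ m * lam
          = B * (‖V (s * x)‖ * (jb x ^ ν) ^ m) by field_simp]
        have := (jb_rpow_pos x ν).le
        exact mul_le_mul_of_nonneg_right hBj (by positivity)
    obtain ⟨b1, b2, b3⟩ := hwkb V E lam _ _ _ (s * x) hTB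
    rw [h.profile] at hsmx
    obtain ⟨r1, r2⟩ := hTB.re_wkbSum_mem hB0 hC h.sign hsV b1 hsmx.2 hηC
    rw [h.profile]
    refine ⟨?_, ?_, fun hXx => absurd hxX (not_lt.2 hXx), fun _ => ⟨?_, ?_⟩⟩
    · refine b2.trans (mul_le_mul_of_nonneg_right ?_ hμ0.le)
      linarith
    · refine b3.trans ?_
      have h1 := hsg.1 x (hX1.trans hxX.le) hxδ
      rw [h.profile] at h1
      calc C * √lam ^ 2 * (‖V (s * x)‖ / lam) * (jb x ^ ν / √lam) ^ (n + 1)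
          = C * (‖V (s * x)‖ * (jb x ^ ν / √lam) ^ (n + 1)) := by
            rw [hμsq]; field_simp
        _ ≤ C * (|Cσ| * sigmaRate U n ν ε₁ ε₂ lam) :=
            mul_le_mul_of_nonneg_left (h1.trans hσabs) hC
        _ = (C * |Cσ|) * sigmaRate U n ν ε₁ ε₂ lam := by ring
        _ ≤ _ := mul_le_mul_of_nonneg_right (by linarith) hσpos
    · refine le_trans ?_ r1
      apply mul_le_mul_of_nonneg_right _ (abs_nonneg _)
      apply inv_anti₀ (by positivity)
      exact mul_le_mul_of_nonneg_right (by linarith) hμ0.le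
    · refine r2.trans ?_
      apply mul_le_mul_of_nonneg_right _ (abs_nonneg _)
      exact div_le_div_of_nonneg_right (by linarith) hμ0.le

end

/-! ### Norm estimates on one half-line -/

theorem eLpNorm_comp_sign {s : ℝ} (hs : s = 1 ∨ s = -1) (F : ℝ → ℂ) (p : ℝ≥0∞) :
    eLpNorm (fun x => F (s * x)) p volume = eLpNorm F p volume := by
  rcases hs with rfl | rfl
  · simp
  · have h := (MeasurableEquiv.neg ℝ).measurableEmbedding.eLpNorm_map_measure
      (μ := volume) (g := F) (p := p)
    have hm : Measure.map (MeasurableEquiv.neg ℝ) volume = (volume : Measure ℝ) :=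
      (Measure.measurePreserving_neg (volume : Measure ℝ)).map_eq
    rw [hm] at h
    rw [h]
    congr 1
    funext x
    simp

/-- The Gaussian-type weights that dominate the pseudomode, in the exponent dual to `r`. -/
theorem exists_holderTriple_eLpNorm_exp_le {q r : ℝ} (hq : 0 < q) (hr : 2 ≤ r) :
    ∃ P : ℝ≥0∞, (ENNReal.ofReal r).HolderTriple P 2 ∧ ∃ K : ℝ, 0 ≤ K ∧ ∀ b > 0,
      eLpNorm (fun x : ℝ => Real.exp (-b * x ^ q)) P (volume.restrict (Ioi 0))
        ≤ ENNReal.ofReal (K * b ^ (-(1 / q) * (1 / 2 - 1 / r))) := by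
  -- For `r = 2` the complementary exponent is `∞` and the weight is bounded by one. Otherwise `1/p
  -- = 1/2 - 1/r` and the norm is an explicit Gamma integral.
  rcases hr.eq_or_lt with rfl | hr
  · refine ⟨⊤, ⟨by norm_num⟩, 1, zero_le_one, fun b hb => ?_⟩
    rw [eLpNorm_exponent_top]
    norm_num
    rw [← ENNReal.ofReal_one]
    refine eLpNormEssSup_le_of_ae_bound ?_
    filter_upwards [ae_restrict_mem measurableSet_Ioi] with x hx
    rw [Real.norm_of_nonneg (Real.exp_pos _).le, Real.exp_le_one_iff]
    have := Real.rpow_nonneg (le_of_lt hx) q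
    nlinarith
  · obtain ⟨p, hp⟩ : ∃ p, p = (1 / 2 - 1 / r)⁻¹ := ⟨_, rfl⟩
    have hr0 : 0 < r := by linarith
    have hpi0 : 0 < 1 / 2 - 1 / r := by
      rw [sub_pos]; exact one_div_lt_one_div_of_lt two_pos hr
    have hp0 : 0 < p := hp ▸ inv_pos.2 hpi0
    have hpi : p⁻¹ = 1 / 2 - 1 / r := by rw [hp, inv_inv]
    refine ⟨ENNReal.ofReal p, ⟨?_⟩, (p ^ (-1 / q) * Real.Gamma (1 / q + 1)) ^ (1 / p), ?_, ?_⟩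
    · rw [← ENNReal.ofReal_inv_of_pos hr0, ← ENNReal.ofReal_inv_of_pos hp0,
        ← ENNReal.ofReal_add (by positivity) (by positivity), hpi,
        show r⁻¹ + (1 / 2 - 1 / r) = (2 : ℝ)⁻¹ by ring, ENNReal.ofReal_inv_of_pos two_pos]
      norm_num
    · have := Real.Gamma_pos_of_pos (show 0 < 1 / q + 1 by positivity)
      positivity
    · intro b hb
      have hG := Real.Gamma_pos_of_pos (show 0 < 1 / q + 1 by positivity)
      have hpb : 0 < p * b := by positivity
      have hint := integral_exp_neg_mul_rpow hq hpb
      have hI : IntegrableOn (fun x : ℝ => Real.exp (-(p * b) * x ^ q)) (Ioi 0) := by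
        apply Integrable.of_integral_ne_zero
        rw [hint]
        positivity
      rw [eLpNorm_eq_lintegral_rpow_enorm_toReal (by simpa using hp0) ENNReal.ofReal_ne_top,
        ENNReal.toReal_ofReal hp0.le]
      have h1 : ∫⁻ x in Ioi (0 : ℝ), ‖Real.exp (-b * x ^ q)‖ₑ ^ p
          = ENNReal.ofReal ((p * b) ^ (-1 / q) * Real.Gamma (1 / q + 1)) := by
        rw [← hint, ofReal_integral_eq_lintegral_ofReal hI
          (Eventually.of_forall fun x => (Real.exp_pos _).le)]
        refine lintegral_congr fun x => ?_
        rw [Real.enorm_eq_ofReal (Real.exp_pos _).le, ENNReal.ofReal_rpow_of_pos (Real.exp_pos _),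
          ← Real.exp_mul]
        congr 2; ring
      rw [h1, ENNReal.ofReal_rpow_of_pos (by positivity)]
      apply le_of_eq
      congr 1
      rw [Real.mul_rpow hp0.le hb.le, mul_assoc, mul_comm (b ^ (-1 / q)), ← mul_assoc,
        Real.mul_rpow (by positivity) (by positivity), ← Real.rpow_mul hb.le, ← hpi]
      congr 2; ring

/-- The cut-off seen from one end of the line. -/
structure EndCutoff (χ : ℝ → ℝ) (s δ Δ K : ℝ) : Prop where
  range : ∀ x, 0 ≤ χ x ∧ χ x ≤ 1
  eq_one : ∀ x, 0 < x → x < δ - Δ → χ (s * x) = 1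
  eq_zero : ∀ x, δ ≤ x → χ (s * x) = 0
  deriv_le : ∀ x, 0 < x → |deriv χ (s * x)| ≤ K / Δ ∧ |deriv (deriv χ) (s * x)| ≤ K / Δ ^ 2
  deriv_eq_zero : ∀ x, 0 < x → x < δ - Δ ∨ δ ≤ x →
    deriv χ (s * x) = 0 ∧ deriv (deriv χ) (s * x) = 0

section

variable {n : ℕ} {V U : ℝ → ℂ} {E : ℕ → ℝ → ℂ} {s ν ε₁ ε₂ : ℝ}

/-- The logarithm of `|g(s x)|` is `-∫₀ˣ s Re P(s t) dt`. Up to `X` the integrand is `O(λ^{-1/2})`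
and costs a constant factor; beyond `X` it is comparable to `λ^{-1/2} |Im U|`. -/
theorem EndData.exists_wkbG_bounds (h : EndData n V E s U ν ε₁ ε₂) (hE : IsClassicalJet n V E)
    (hU : Continuous U) :
    ∃ X : ℝ, 1 ≤ X ∧ ∃ C : ℝ, 1 ≤ C ∧ ∀ᶠ lam in atTop,
      (∀ᵐ x, 0 ≤ x → x < cutRadius U ν ε₁ ε₂ lam →
        ‖wkbSum V E n lam (s * x)‖ ≤ C * √lam ∧
        ‖wkbResidual V E n lam (s * x)‖ ≤ C * sigmaRate U n ν ε₁ ε₂ lam) ∧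
      (∀ x, 0 ≤ x → x ≤ X → C⁻¹ ≤ ‖wkbG V n lam (s * x)‖ ∧ ‖wkbG V n lam (s * x)‖ ≤ C) ∧
      (∀ x, X ≤ x → x ≤ cutRadius U ν ε₁ ε₂ lam →
        C⁻¹ * Real.exp (-(C / √lam * ∫ t in X..x, |(U t).im|)) ≤ ‖wkbG V n lam (s * x)‖ ∧
        ‖wkbG V n lam (s * x)‖
          ≤ C * Real.exp (-((C * √lam)⁻¹ * ∫ t in X..x, |(U t).im|))) := by
  obtain ⟨X, hX, C, hC, hb⟩ := h.exists_ae_bounds hE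
  obtain ⟨B, _, hsize⟩ := h.control.size
  have hX0 : 0 ≤ X := by linarith
  have hexp : 1 ≤ Real.exp (C * X) := Real.one_le_exp (by positivity)
  refine ⟨X, hX, C * Real.exp (C * X), by nlinarith, ?_⟩
  filter_upwards [hb, hsize, h.control.tendsto.eventually_ge_atTop X, eventually_ge_atTop 1]
    with lam hlam hsz hXδ hlam1
  have hlam0 : 0 < lam := by linarith
  have hμ1 : 1 ≤ √lam := Real.one_le_sqrt.2 hlam1
  have hμ0 : 0 < √lam := by linarith
  have hC0 : 0 < C := by linarith
  have hCe : C ≤ C * Real.exp (C * X) := le_mul_of_one_le_right hC0.le hexp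
  have heC : Real.exp (C * X) ≤ C * Real.exp (C * X) :=
    le_mul_of_one_le_left (Real.exp_pos _).le hC
  have hδ0 : 0 ≤ cutRadius U ν ε₁ ε₂ lam := hX0.trans hXδ
  obtain ⟨hcont, hnorm⟩ := h.norm_wkbG hE hlam0 hδ0 fun x h1 h2 => by linarith [(hsz x h1 h2).1]
  obtain ⟨p, hp⟩ : ∃ p : ℝ → ℝ, p = fun t => s * (wkbSum V E n lam (s * t)).re := ⟨_, rfl⟩
  rw [← hp] at hcont
  have hnorm' : ∀ x ∈ Icc 0 (cutRadius U ν ε₁ ε₂ lam),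
      ‖wkbG V n lam (s * x)‖ = Real.exp (-∫ t in (0 : ℝ)..x, p t) := by
    intro x hx; rw [hnorm x hx, hp]
  have hii : ∀ a b, 0 ≤ a → a ≤ b → b ≤ cutRadius U ν ε₁ ε₂ lam →
      IntervalIntegrable p volume a b := fun a b ha hab hb' =>
    (hcont.mono (by rw [uIcc_of_le hab]; exact Icc_subset_Icc ha hb')).intervalIntegrable
  have hne : ∀ᵐ x, x ≠ cutRadius U ν ε₁ ε₂ lam := by
    simp [ae_iff, measure_singleton]
  have hnX : ∀ᵐ x, x ≠ X := by
    simp [ae_iff, measure_singleton]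
  have habs : ∀ x, 0 ≤ x → x ≤ X → |∫ t in (0 : ℝ)..x, p t| ≤ C * X := by
    intro x hx0 hxX
    have h1 : ‖∫ t in (0 : ℝ)..x, p t‖ ≤ C / √lam * |x - 0| := by
      apply intervalIntegral.norm_integral_le_of_norm_le_const_ae
      filter_upwards [hlam, hne] with t ht htne htm
      rw [uIoc_of_le hx0] at htm
      have h2 : t ≤ X := htm.2.trans hxX
      rw [hp]
      exact (ht htm.1.le (lt_of_le_of_ne (h2.trans hXδ) htne)).2.2.1 h2
    rw [sub_zero, abs_of_nonneg hx0, Real.norm_eq_abs] at h1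
    refine h1.trans ?_
    have : C / √lam ≤ C := div_le_self hC0.le hμ1
    gcongr
  refine ⟨?_, fun x hx0 hxX => ?_, fun x hXx hxδ => ?_⟩
  · filter_upwards [hlam] with x hx h1 h2
    obtain ⟨a1, a2, -⟩ := hx h1 h2
    refine ⟨a1.trans (mul_le_mul_of_nonneg_right hCe hμ0.le),
      a2.trans (mul_le_mul_of_nonneg_right hCe (sigmaRate_nonneg hlam0.le))⟩
  · have h1 := abs_le.1 (habs x hx0 hxX)
    rw [hnorm' x ⟨hx0, hxX.trans hXδ⟩]
    constructor
    · calc (C * Real.exp (C * X))⁻¹ ≤ (Real.exp (C * X))⁻¹ := inv_anti₀ (Real.exp_pos _) heC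
        _ = Real.exp (-(C * X)) := (Real.exp_neg _).symm
        _ ≤ _ := Real.exp_le_exp.2 (by linarith)
    · exact (Real.exp_le_exp.2 (by linarith)).trans heC
  · have h1 := abs_le.1 (habs X hX0 le_rfl)
    rw [hnorm' x ⟨hX0.trans hXx, hxδ⟩,
      ← intervalIntegral.integral_add_adjacent_intervals (hii 0 X le_rfl hX0 hXδ)
        (hii X x hX0 hXx hxδ)]
    have hUi : IntervalIntegrable (fun t => |(U t).im|) volume X x :=
      ((Complex.continuous_im.comp hU).abs).intervalIntegrable _ _
    have hI0 : 0 ≤ ∫ t in X..x, |(U t).im| :=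
      intervalIntegral.integral_nonneg hXx fun t _ => abs_nonneg _
    have hmem : ∀ᵐ t ∂volume.restrict (Icc X x),
        (C * √lam)⁻¹ * |(U t).im| ≤ p t ∧ p t ≤ C / √lam * |(U t).im| := by
      rw [ae_restrict_iff' measurableSet_Icc]
      filter_upwards [hlam, hne, hnX] with t ht htne htX htm
      rw [hp]
      exact (ht (hX0.trans htm.1) (lt_of_le_of_ne (htm.2.trans hxδ) htne)).2.2.2
        (lt_of_le_of_ne htm.1 (Ne.symm htX))
    have hlow : (C * √lam)⁻¹ * (∫ t in X..x, |(U t).im|) ≤ ∫ t in X..x, p t := by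
      rw [← intervalIntegral.integral_const_mul]
      exact intervalIntegral.integral_mono_ae_restrict hXx (hUi.const_mul _) (hii X x hX0 hXx hxδ)
        (hmem.mono fun t ht => ht.1)
    have hupp : ∫ t in X..x, p t ≤ C / √lam * (∫ t in X..x, |(U t).im|) := by
      rw [← intervalIntegral.integral_const_mul]
      exact intervalIntegral.integral_mono_ae_restrict hXx (hii X x hX0 hXx hxδ) (hUi.const_mul _)
        (hmem.mono fun t ht => ht.2)
    have hexpC : (C * Real.exp (C * X))⁻¹ ≤ Real.exp (-(C * X)) := by
      rw [Real.exp_neg]; exact inv_anti₀ (Real.exp_pos _) heC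
    constructor
    · calc (C * Real.exp (C * X))⁻¹ *
            Real.exp (-(C * Real.exp (C * X) / √lam * ∫ t in X..x, |(U t).im|))
          ≤ Real.exp (-(C * X)) * Real.exp (-(C / √lam * ∫ t in X..x, |(U t).im|)) := by
            gcongr
        _ = Real.exp (-(C * X) + -(C / √lam * ∫ t in X..x, |(U t).im|)) := (Real.exp_add _ _).symm
        _ ≤ _ := Real.exp_le_exp.2 (by linarith)
    · calc _ ≤ Real.exp (C * X + -((C * √lam)⁻¹ * ∫ t in X..x, |(U t).im|)) :=
            Real.exp_le_exp.2 (by linarith)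
        _ = Real.exp (C * X) * Real.exp (-((C * √lam)⁻¹ * ∫ t in X..x, |(U t).im|)) :=
            Real.exp_add _ _
        _ ≤ _ := by gcongr

end

section

variable {n : ℕ} {V U : ℝ → ℂ} {E : ℕ → ℝ → ℂ} {s ν ε₁ ε₂ : ℝ}

theorem eLpNorm_two_le_of_ae_bound_Ioc {F : ℝ → ℂ} {M δ : ℝ} (hM : 0 ≤ M) (hδ : 0 ≤ δ)
    (h : ∀ᵐ x, 0 < x → ‖F x‖ ≤ (Ioc 0 δ).indicator (fun _ => M) x) :
    eLpNorm F 2 (volume.restrict (Ioi 0)) ≤ ENNReal.ofReal (M * √δ) := by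
  have h1 : eLpNorm F 2 (volume.restrict (Ioi 0))
      ≤ eLpNorm ((Ioc 0 δ).indicator (fun _ => M)) 2 (volume.restrict (Ioi 0)) := by
    apply eLpNorm_mono_ae_real
    rw [ae_restrict_iff' measurableSet_Ioi]
    exact h
  refine h1.trans ((eLpNorm_mono_measure _ Measure.restrict_le_self).trans ?_)
  rw [eLpNorm_indicator_const measurableSet_Ioc (by norm_num) (by norm_num), Real.volume_Ioc,
    sub_zero, Real.enorm_eq_ofReal hM, ENNReal.ofReal_mul hM]
  rw [Real.sqrt_eq_rpow, ← ENNReal.ofReal_rpow_of_nonneg hδ (by norm_num)]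
  norm_num

/-- The derivatives of the cut-off live between `δ - Δ` and `δ`, where `g` is exponentially small in
the decay rate `R`. All other factors are powers of quantities bounded by `exp (η R)`. -/
theorem EndData.cutoffError_le (h : EndData n V E s U ν ε₁ ε₂) (hE : IsClassicalJet n V E)
    (hU : Continuous U) {K : ℝ} (hK : 0 ≤ K) :
    ∃ c > 0, ∃ C : ℝ, 0 ≤ C ∧ ∀ᶠ lam in atTop, ∀ χ : ℝ → ℝ,
      EndCutoff χ s (cutRadius U ν ε₁ ε₂ lam) (cutWidth U ν ε₁ ε₂ lam) K →
      eLpNorm (fun x => cutoffError V E n χ lam (s * x)) 2 (volume.restrict (Ioi 0))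
        ≤ ENNReal.ofReal (C * kappaRate U ν ε₁ ε₂ c lam) := by
  obtain ⟨X, hX, C, hC, hb⟩ := h.exists_wkbG_bounds hE hU
  obtain ⟨c, hc, hdec⟩ := h.control.decay X
  have hC0 : 0 < C := by linarith
  -- With this `η` one has `|g| ≤ C exp (-8 η R)`. Three factors `Q = exp (η R)` are lost, two to
  -- the cut-off derivatives and `P`, one to `√δ`, so there is room to spare.
  obtain ⟨η, hη⟩ : ∃ η, η = c / (8 * C) := ⟨_, rfl⟩
  have hη0 : 0 < η := by rw [hη]; positivity
  refine ⟨η, hη0, 3 * K * C ^ 2, by positivity, ?_⟩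
  filter_upwards [hb, hdec, h.control.growth η hη0, h.control.width,
    h.control.tendsto.eventually_ge_atTop (2 * X), h.control.tendsto.eventually_ge_atTop 1,
    eventually_ge_atTop 1] with lam hlam hd hg hw hδX hδ1 hlam1 χ hχ
  rw [kappaRate_eq]
  generalize cutRadius U ν ε₁ ε₂ lam = δ at hlam hd hg hw hδX hδ1 hχ
  generalize cutWidth U ν ε₁ ε₂ lam = Δ at hd hg hw hχ
  generalize decayRate U ν ε₁ ε₂ lam = R at hd hg ⊢
  obtain ⟨hPb, -, hgb⟩ := hlam
  obtain ⟨hlamR, hδR, hΔR⟩ := hg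
  obtain ⟨hΔ0, hΔδ⟩ := hw
  have hμ1 : 1 ≤ √lam := Real.one_le_sqrt.2 hlam1
  have hμ0 : 0 < √lam := by linarith
  have hμlam : √lam ≤ lam := by
    calc √lam ≤ √lam * √lam := by nlinarith
      _ = lam := Real.mul_self_sqrt (by linarith)
  have hδ0 : 0 ≤ δ := by linarith
  have hsδ : √δ ≤ δ := by
    have := Real.one_le_sqrt.2 hδ1
    calc √δ ≤ √δ * √δ := by nlinarith
      _ = δ := Real.mul_self_sqrt hδ0
  obtain ⟨Q, hQ⟩ : ∃ Q, Q = Real.exp (η * R) := ⟨_, rfl⟩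
  rw [← hQ] at hlamR hδR hΔR
  have hQ1 : 1 ≤ Q := hlam1.trans hlamR
  have hQ0 : 0 < Q := by linarith
  obtain ⟨M, hM⟩ : ∃ M, M = 3 * K * C ^ 2 * Q ^ 2 * Real.exp (-(8 * η * R)) := ⟨_, rfl⟩
  have hM0 : 0 ≤ M := by rw [hM]; positivity
  have hfinal : M * √δ ≤ 3 * K * C ^ 2 * Real.exp (-η * R) := by
    calc M * √δ ≤ M * Q := by gcongr; exact hsδ.trans hδR
      _ = 3 * K * C ^ 2 * (Q ^ 3 * Real.exp (-(8 * η * R))) := by rw [hM]; ring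
      _ = 3 * K * C ^ 2 * Real.exp (-(5 * (η * R))) := by
          rw [hQ, ← Real.exp_nat_mul, ← Real.exp_add]; congr 2; push_cast; ring
      _ ≤ _ := by
          have : 0 ≤ η * R := by
            by_contra hneg
            rw [hQ] at hQ1
            exact absurd hQ1 (not_le.2 (Real.exp_lt_one_iff.2 (not_le.1 hneg)))
          gcongr
          linarith
  refine (eLpNorm_two_le_of_ae_bound_Ioc hM0 hδ0 ?_).trans (ENNReal.ofReal_le_ofReal hfinal)
  filter_upwards [hPb] with x hPx hx0
  by_cases hx : x < δ - Δ ∨ δ ≤ x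
  · obtain ⟨d1, d2⟩ := hχ.deriv_eq_zero x hx0 hx
    rw [cutoffError, d1, d2]
    simp only [Complex.ofReal_zero, mul_zero, zero_mul, sub_zero, norm_zero]
    exact indicator_nonneg (fun _ _ => hM0) _
  · rw [not_or, not_lt, not_le] at hx
    rw [indicator_of_mem (show x ∈ Ioc 0 δ from ⟨hx0, hx.2.le⟩)]
    obtain ⟨d1, d2⟩ := hχ.deriv_le x hx0
    have hP := (hPx hx0.le hx.2).1
    have hXx : X ≤ x := by linarith
    have hG := (hgb x hXx hx.2.le).2
    have hI := hd x hx.1 hx.2.le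
    have hG' : ‖wkbG V n lam (s * x)‖ ≤ C * Real.exp (-(8 * η * R)) := by
      have h1 : 8 * η * R ≤ (C * √lam)⁻¹ * ∫ t in X..x, |(U t).im| := by
        calc 8 * η * R = (C * √lam)⁻¹ * (c * R * √lam) := by rw [hη]; field_simp
          _ ≤ _ := by gcongr
      exact hG.trans (mul_le_mul_of_nonneg_left (Real.exp_le_exp.2 (neg_le_neg h1)) hC0.le)
    have hΔ2 : Δ⁻¹ ≤ Q := hΔR
    have hlin : ‖2 * ((deriv χ (s * x) : ℝ) : ℂ) * wkbSum V E n lam (s * x)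
        - ((deriv (deriv χ) (s * x) : ℝ) : ℂ)‖ ≤ 3 * K * C * Q ^ 2 := by
      refine (norm_sub_le _ _).trans ?_
      rw [norm_mul, norm_mul, Complex.norm_real, Complex.norm_real, Complex.norm_ofNat,
        Real.norm_eq_abs, Real.norm_eq_abs]
      have e1 : |deriv χ (s * x)| ≤ K * Q := d1.trans (by rw [div_eq_mul_inv]; gcongr)
      have e2 : |deriv (deriv χ) (s * x)| ≤ K * Q ^ 2 :=
        d2.trans (by rw [div_eq_mul_inv, ← inv_pow]; gcongr)
      have e3 : ‖wkbSum V E n lam (s * x)‖ ≤ C * Q := hP.trans (by gcongr; linarith)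
      calc 2 * |deriv χ (s * x)| * ‖wkbSum V E n lam (s * x)‖ + |deriv (deriv χ) (s * x)|
          ≤ 2 * (K * Q) * (C * Q) + K * Q ^ 2 := by gcongr
        _ ≤ 3 * K * C * Q ^ 2 := by nlinarith [mul_nonneg hK (sq_nonneg Q)]
    rw [cutoffError, norm_mul]
    calc _ ≤ (3 * K * C * Q ^ 2) * (C * Real.exp (-(8 * η * R))) := by gcongr
      _ = M := by rw [hM]; ring

/-- The bound keeps the norm of the pseudomode itself as a factor, so that division by `‖f‖` loses
nothing. -/
theorem EndData.expansionError_le (h : EndData n V E s U ν ε₁ ε₂) (hE : IsClassicalJet n V E)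
    (hU : Continuous U) {K : ℝ} :
    ∃ C : ℝ, 0 ≤ C ∧ ∀ᶠ lam in atTop, ∀ χ : ℝ → ℝ,
      EndCutoff χ s (cutRadius U ν ε₁ ε₂ lam) (cutWidth U ν ε₁ ε₂ lam) K →
      eLpNorm (fun x => expansionError V E n χ lam (s * x)) 2 (volume.restrict (Ioi 0))
        ≤ ENNReal.ofReal (C * sigmaRate U n ν ε₁ ε₂ lam)
          * eLpNorm (fun x => ((χ x : ℝ) : ℂ) * wkbG V n lam x) 2 volume := by
  obtain ⟨X, hX, C, hC, hb⟩ := h.exists_wkbG_bounds hE hU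
  refine ⟨C, by linarith, ?_⟩
  filter_upwards [hb, eventually_ge_atTop 0] with lam hlam hlam0 χ hχ
  rw [← eLpNorm_comp_sign h.sign (fun x => ((χ x : ℝ) : ℂ) * wkbG V n lam x)]
  refine (eLpNorm_le_mul_eLpNorm_of_ae_le_mul
    (g := fun x => ((χ (s * x) : ℝ) : ℂ) * wkbG V n lam (s * x)) ?_ 2).trans
    (mul_le_mul_right (eLpNorm_mono_measure _ Measure.restrict_le_self) _)
  rw [ae_restrict_iff' measurableSet_Ioi]
  filter_upwards [hlam.1] with x hx hx0
  rw [expansionError, norm_mul]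
  rcases lt_or_ge x (cutRadius U ν ε₁ ε₂ lam) with hxδ | hxδ
  · exact mul_le_mul_of_nonneg_right (hx (le_of_lt hx0) hxδ).2 (norm_nonneg _)
  · rw [hχ.eq_zero x hxδ]; simp

/-- The power bound on `|Im U|` is integrated from `Y` on. What is missing before `Y` costs a factor
that is bounded because `λ ≥ 1`. -/
theorem EndData.norm_wkbG_le_exp (h : EndData n V E s U ν ε₁ ε₂) (hE : IsClassicalJet n V E)
    (hU : Continuous U) {γ : ℝ} (hγ : 0 ≤ γ)
    (hlow : (fun x => |x| ^ γ) =O[atTop] fun x => (U x).im) :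
    ∃ c > 0, ∃ C : ℝ, 0 ≤ C ∧ ∀ᶠ lam in atTop, ∀ x, 0 ≤ x → x ≤ cutRadius U ν ε₁ ε₂ lam →
      ‖wkbG V n lam (s * x)‖ ≤ C * Real.exp (-(c / √lam) * x ^ (γ + 1)) := by
  obtain ⟨X, hX, C, hC, hb⟩ := h.exists_wkbG_bounds hE hU
  have hC0 : 0 < C := by linarith
  obtain ⟨m, hm0, hm⟩ := hlow.exists_pos
  obtain ⟨X1, hX1⟩ := eventually_atTop.1 hm.bound
  obtain ⟨Y, hY⟩ : ∃ Y, Y = max X X1 := ⟨_, rfl⟩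
  have hXY : X ≤ Y := hY ▸ le_max_left _ _
  have hY0 : 0 ≤ Y := by linarith
  have hγ1 : 0 < γ + 1 := by linarith
  obtain ⟨a, ha⟩ : ∃ a, a = 1 / (m * (γ + 1)) := ⟨_, rfl⟩
  have ha0 : 0 < a := by rw [ha]; positivity
  have hUc : Continuous fun t => |(U t).im| := (Complex.continuous_im.comp hU).abs
  have hint : ∀ x, X ≤ x → a * (x ^ (γ + 1) - Y ^ (γ + 1)) ≤ ∫ t in X..x, |(U t).im| := by
    intro x hx
    rcases le_total x Y with hxY | hxY
    · have h1 : x ^ (γ + 1) ≤ Y ^ (γ + 1) := Real.rpow_le_rpow (by linarith) hxY hγ1.le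
      have h2 : 0 ≤ ∫ t in X..x, |(U t).im| :=
        intervalIntegral.integral_nonneg hx fun t _ => abs_nonneg _
      nlinarith
    · have h1 : 0 ≤ ∫ t in X..Y, |(U t).im| :=
        intervalIntegral.integral_nonneg hXY fun t _ => abs_nonneg _
      have h2 : ∫ t in Y..x, m⁻¹ * t ^ γ ≤ ∫ t in Y..x, |(U t).im| := by
        apply intervalIntegral.integral_mono_on hxY
        · exact ((intervalIntegral.intervalIntegrable_rpow' (by linarith)).const_mul _)
        · exact hUc.intervalIntegrable _ _
        · intro t ht
          have h3 := hX1 t ((hY ▸ le_max_right _ _ : X1 ≤ Y).trans ht.1)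
          have ht0 : 0 ≤ t := hY0.trans ht.1
          rw [abs_of_nonneg ht0, Real.norm_of_nonneg (Real.rpow_nonneg ht0 _),
            Real.norm_eq_abs] at h3
          rw [inv_mul_le_iff₀ hm0]; exact h3
      rw [intervalIntegral.integral_const_mul, integral_rpow (Or.inl (by linarith))] at h2
      rw [← intervalIntegral.integral_add_adjacent_intervals (hUc.intervalIntegrable X Y)
        (hUc.intervalIntegrable Y x)]
      have h4 : m⁻¹ * ((x ^ (γ + 1) - Y ^ (γ + 1)) / (γ + 1)) = a * (x ^ (γ + 1) - Y ^ (γ + 1)) := by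
        rw [ha]; field_simp
      linarith
  refine ⟨a / C, by positivity, C * Real.exp (a / C * Y ^ (γ + 1)), by positivity, ?_⟩
  filter_upwards [hb, eventually_ge_atTop 1] with lam hlam hlam1 x hx0 hxδ
  have hμ1 : 1 ≤ √lam := Real.one_le_sqrt.2 hlam1
  have hμ0 : 0 < √lam := by linarith
  have hY1 : 0 ≤ Y ^ (γ + 1) := Real.rpow_nonneg hY0 _
  have hdiv : a / C / √lam ≤ a / C := div_le_self (by positivity) hμ1
  rw [mul_assoc C, ← Real.exp_add]
  rcases le_total x X with hxX | hxX
  · refine (hlam.2.1 x hx0 hxX).2.trans (le_mul_of_one_le_right hC0.le (Real.one_le_exp ?_))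
    have h1 : x ^ (γ + 1) ≤ Y ^ (γ + 1) := Real.rpow_le_rpow hx0 (hxX.trans hXY) hγ1.le
    have h2 : 0 ≤ x ^ (γ + 1) := Real.rpow_nonneg hx0 _
    have h3 : 0 ≤ a / C / √lam := by positivity
    have := mul_le_mul hdiv h1 h2 (h3.trans hdiv)
    linarith
  · refine (hlam.2.2 x hxX hxδ).2.trans ?_
    gcongr
    have h1 : (C * √lam)⁻¹ * (a * (x ^ (γ + 1) - Y ^ (γ + 1)))
        ≤ (C * √lam)⁻¹ * ∫ t in X..x, |(U t).im| := by
      gcongr; exact hint x hxX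
    have h2 : (C * √lam)⁻¹ * (a * (x ^ (γ + 1) - Y ^ (γ + 1)))
        = a / C / √lam * x ^ (γ + 1) - a / C / √lam * Y ^ (γ + 1) := by field_simp
    have h3 := mul_le_mul_of_nonneg_right hdiv hY1
    linarith

/-- Hölder's inequality with `1/P = 1/2 - 1/r` separates `W` from the weight `exp (-c λ^{-1/2}
x^{γ+1})`, whose `L^P` norm is found by scaling. -/
theorem EndData.perturbation_le (h : EndData n V E s U ν ε₁ ε₂) (hE : IsClassicalJet n V E)
    (hU : Continuous U) {γ r K : ℝ} (hγ : 0 ≤ γ) (hr : 2 ≤ r)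
    (hlow : (fun x => |x| ^ γ) =O[atTop] fun x => (U x).im) {W : ℝ → ℂ}
    (hW : MemLp (fun x => W (s * x)) (ENNReal.ofReal r) (volume.restrict (Ioi 0))) :
    ∃ C : ℝ, 0 ≤ C ∧ ∀ᶠ lam in atTop, ∀ χ : ℝ → ℝ,
      EndCutoff χ s (cutRadius U ν ε₁ ε₂ lam) (cutWidth U ν ε₁ ε₂ lam) K →
      eLpNorm (fun x => W (s * x) * (((χ (s * x) : ℝ) : ℂ) * wkbG V n lam (s * x))) 2
          (volume.restrict (Ioi 0))
        ≤ ENNReal.ofReal (C * lam ^ (1 / (2 * (γ + 1)) * (1 / 2 - 1 / r))) := by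
  obtain ⟨c, hc, C, hC, hb⟩ := h.norm_wkbG_le_exp hE hU hγ hlow
  obtain ⟨P, hP, K', hK', hK⟩ :=
    exists_holderTriple_eLpNorm_exp_le (q := γ + 1) (r := r) (by linarith) hr
  obtain ⟨w, hw⟩ : ∃ w, w = (eLpNorm (fun x => W (s * x)) (ENNReal.ofReal r)
    (volume.restrict (Ioi 0))).toReal := ⟨_, rfl⟩
  have hw0 : 0 ≤ w := hw ▸ ENNReal.toReal_nonneg
  have hw' : eLpNorm (fun x => W (s * x)) (ENNReal.ofReal r) (volume.restrict (Ioi 0))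
      = ENNReal.ofReal w := by rw [hw, ENNReal.ofReal_toReal hW.2.ne]
  obtain ⟨β, hβ⟩ : ∃ β, β = -(1 / (γ + 1)) * (1 / 2 - 1 / r) := ⟨_, rfl⟩
  refine ⟨C * (w * (K' * c ^ β)), by positivity, ?_⟩
  filter_upwards [hb, eventually_gt_atTop 0] with lam hlam hlam0 χ hχ
  have hμ0 : 0 < √lam := Real.sqrt_pos.2 hlam0
  have hcμ : 0 < c / √lam := by positivity
  have h1 : eLpNorm (fun x => W (s * x) * (((χ (s * x) : ℝ) : ℂ) * wkbG V n lam (s * x))) 2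
        (volume.restrict (Ioi 0))
      ≤ ENNReal.ofReal C * eLpNorm ((fun x => W (s * x)) •
        fun x => ((Real.exp (-(c / √lam) * x ^ (γ + 1)) : ℝ) : ℂ)) 2 (volume.restrict (Ioi 0)) := by
    apply eLpNorm_le_mul_eLpNorm_of_ae_le_mul
    rw [ae_restrict_iff' measurableSet_Ioi]
    refine Eventually.of_forall fun x hx0 => ?_
    have hχx := hχ.range (s * x)
    rw [Pi.smul_apply', smul_eq_mul, norm_mul, norm_mul, norm_mul, Complex.norm_real,
      Complex.norm_real, Real.norm_of_nonneg hχx.1, Real.norm_of_nonneg (Real.exp_pos _).le,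
      mul_left_comm C]
    apply mul_le_mul_of_nonneg_left _ (norm_nonneg _)
    rcases le_or_gt x (cutRadius U ν ε₁ ε₂ lam) with hxδ | hxδ
    · exact (mul_le_of_le_one_left (norm_nonneg _) hχx.2).trans (hlam x (le_of_lt hx0) hxδ)
    · rw [hχ.eq_zero x hxδ.le, zero_mul]; positivity
  have hmeas : AEStronglyMeasurable
      (fun x => ((Real.exp (-(c / √lam) * x ^ (γ + 1)) : ℝ) : ℂ)) (volume.restrict (Ioi 0)) := by
    apply Measurable.aestronglyMeasurable
    fun_prop
  have h2 := eLpNorm_smul_le_mul_eLpNorm (r := 2) (q := P) (p := ENNReal.ofReal r) hmeas hW.1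
  have h3 : eLpNorm (fun x => ((Real.exp (-(c / √lam) * x ^ (γ + 1)) : ℝ) : ℂ)) P
      (volume.restrict (Ioi 0)) = eLpNorm (fun x => Real.exp (-(c / √lam) * x ^ (γ + 1))) P
      (volume.restrict (Ioi 0)) := eLpNorm_congr_norm_ae (Eventually.of_forall fun x => by
        rw [Complex.norm_real])
  have h4 := hK (c / √lam) hcμ
  rw [← h3] at h4
  refine h1.trans ((mul_le_mul_right (h2.trans (mul_le_mul_right h4 _)) _).trans ?_)
  rw [hw', ← ENNReal.ofReal_mul hw0, ← ENNReal.ofReal_mul hC]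
  apply ENNReal.ofReal_le_ofReal
  apply le_of_eq
  rw [← hβ, Real.div_rpow hc.le hμ0.le, Real.sqrt_eq_rpow, ← Real.rpow_mul hlam0.le, div_eq_mul_inv,
    ← Real.rpow_neg hlam0.le, show -(1 / 2 * β) = 1 / (2 * (γ + 1)) * (1 / 2 - 1 / r) by
      rw [hβ]; field_simp]
  ring

/-- For `x` up to a multiple of `λ^{1/(2(γ+1))}` the exponent `λ^{-1/2} ∫ |Im U|` stays bounded, so
`|g|` is bounded below there. The norm is at least the square root of this length, up to a constant.
-/
theorem EndData.le_eLpNorm (h : EndData n V E s U ν ε₁ ε₂) (hE : IsClassicalJet n V E)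
    (hU : Continuous U) {γ K c0 : ℝ} (hγ : 0 ≤ γ)
    (hup : (fun x => (U x).im) =O[atTop] fun x => |x| ^ γ) (hc0 : 0 < c0)
    (hrad : ∀ᶠ lam in atTop, c0 * lam ^ (1 / (2 * (γ + 1))) ≤ cutRadius U ν ε₁ ε₂ lam) :
    ∃ c > 0, ∀ᶠ lam in atTop, ∀ χ : ℝ → ℝ,
      EndCutoff χ s (cutRadius U ν ε₁ ε₂ lam) (cutWidth U ν ε₁ ε₂ lam) K →
      ENNReal.ofReal (c * lam ^ (1 / (4 * (γ + 1))))
        ≤ eLpNorm (fun x => ((χ x : ℝ) : ℂ) * wkbG V n lam x) 2 volume := by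
  obtain ⟨X, hX, C, hC, hb⟩ := h.exists_wkbG_bounds hE hU
  have hC0 : 0 < C := by linarith
  have hγ1 : 0 < γ + 1 := by linarith
  -- a bound of the imaginary part on `[1, ∞)`
  obtain ⟨M, hM0, hM⟩ : ∃ M : ℝ, 0 < M ∧ ∀ t, 1 ≤ t → |(U t).im| ≤ M * t ^ γ := by
    obtain ⟨m, hm0, hm⟩ := hup.exists_pos
    obtain ⟨X1, hX1⟩ := eventually_atTop.1 hm.bound
    obtain ⟨k, hk⟩ := (isCompact_Icc (a := (1 : ℝ)) (b := X1)).exists_bound_of_continuousOn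
      (Complex.continuous_im.comp hU).continuousOn
    refine ⟨max m k, by positivity, fun t ht => ?_⟩
    rcases le_total t X1 with h1 | h1
    · calc |(U t).im| ≤ k := hk t ⟨ht, h1⟩
        _ ≤ max m k := le_max_right _ _
        _ ≤ _ := le_mul_of_one_le_right (by positivity) (Real.one_le_rpow ht hγ)
    · have := hX1 t h1
      have ht0 : 0 ≤ t := by linarith
      rw [abs_of_nonneg ht0, Real.norm_of_nonneg (Real.rpow_nonneg ht0 _), Real.norm_eq_abs] at this
      refine this.trans ?_
      gcongr
      exact le_max_left _ _
  -- The bound `a ≤ 1` controls the exponent, and `a ≤ c0 / 2` keeps the interval inside `(0, δ/2)`,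
  -- where the cut-off equals one.
  obtain ⟨a, ha⟩ : ∃ a, a = min 1 (c0 / 2) := ⟨_, rfl⟩
  have ha0 : 0 < a := by rw [ha]; positivity
  have ha1 : a ≤ 1 := ha ▸ min_le_left _ _
  have hac : a ≤ c0 / 2 := ha ▸ min_le_right _ _
  obtain ⟨b, hbdef⟩ : ∃ b, b = C⁻¹ * Real.exp (-(C * M)) := ⟨_, rfl⟩
  have hb0 : 0 < b := by rw [hbdef]; positivity
  have hbC : b ≤ C⁻¹ := by
    rw [hbdef]
    exact mul_le_of_le_one_right (by positivity) (Real.exp_le_one_iff.2 (by nlinarith))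
  refine ⟨b * √a, by positivity, ?_⟩
  filter_upwards [hb, hrad, h.control.width, eventually_ge_atTop 1] with lam hlam hrd hw hlam1 χ hχ
  have hlam0 : 0 < lam := by linarith
  have hμ0 : 0 < √lam := Real.sqrt_pos.2 hlam0
  obtain ⟨l, hl⟩ : ∃ l, l = lam ^ (1 / (2 * (γ + 1))) := ⟨_, rfl⟩
  rw [← hl] at hrd
  have hl0 : 0 < l := hl ▸ Real.rpow_pos_of_pos hlam0 _
  have hlpow : l ^ (γ + 1) = √lam := by
    rw [hl, ← Real.rpow_mul hlam0.le, Real.sqrt_eq_rpow]; congr 1; field_simp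
  have hLδ : a * l ≤ cutRadius U ν ε₁ ε₂ lam / 2 := by nlinarith
  have hδ0 : 0 < cutRadius U ν ε₁ ε₂ lam := by nlinarith
  have hgx : ∀ x, 0 < x → x < a * l → b ≤ ‖wkbG V n lam (s * x)‖ := by
    intro x hx0 hxl
    rcases le_total x X with hxX | hxX
    · exact hbC.trans (hlam.2.1 x hx0.le hxX).1
    · refine le_trans ?_ (hlam.2.2 x hxX (by linarith)).1
      rw [hbdef]
      have hI : ∫ t in X..x, |(U t).im| ≤ M * √lam := by
        have h1 : ‖∫ t in X..x, |(U t).im|‖ ≤ M * x ^ γ * |x - X| := by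
          apply intervalIntegral.norm_integral_le_of_norm_le_const
          intro t ht
          rw [uIoc_of_le hxX] at ht
          have ht1 : 1 ≤ t := hX.trans ht.1.le
          rw [Real.norm_eq_abs, abs_abs]
          refine (hM t ht1).trans ?_
          gcongr
          exact ht.2
        refine (le_abs_self _).trans (h1.trans ?_)
        rw [abs_of_nonneg (by linarith)]
        calc M * x ^ γ * (x - X) ≤ M * x ^ γ * x := by
              have : 0 ≤ M * x ^ γ := by positivity
              exact mul_le_mul_of_nonneg_left (by linarith) this
          _ = M * x ^ (γ + 1) := by rw [Real.rpow_add_one hx0.ne']; ring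
          _ ≤ M * l ^ (γ + 1) := by
              gcongr; nlinarith
          _ = M * √lam := by rw [hlpow]
      have hCM : C / √lam * ∫ t in X..x, |(U t).im| ≤ C * M := by
        calc C / √lam * ∫ t in X..x, |(U t).im| ≤ C / √lam * (M * √lam) := by gcongr
          _ = C * M := by field_simp
      exact mul_le_mul_of_nonneg_left (Real.exp_le_exp.2 (by linarith)) (by positivity)
  rw [← eLpNorm_comp_sign h.sign (fun x => ((χ x : ℝ) : ℂ) * wkbG V n lam x)]
  have hlow : eLpNorm ((Ioo 0 (a * l)).indicator fun _ => b) 2 volume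
      ≤ eLpNorm (fun x => ((χ (s * x) : ℝ) : ℂ) * wkbG V n lam (s * x)) 2 volume := by
    apply eLpNorm_mono
    intro x
    by_cases hx : x ∈ Ioo 0 (a * l)
    · rw [indicator_of_mem hx, Real.norm_of_nonneg hb0.le, hχ.eq_one x hx.1 (by linarith [hx.2]),
        Complex.ofReal_one, one_mul]
      exact hgx x hx.1 hx.2
    · rw [indicator_of_notMem hx, norm_zero]; exact norm_nonneg _
  refine le_trans (le_of_eq ?_) hlow
  rw [eLpNorm_indicator_const measurableSet_Ioo (by norm_num) (by norm_num), Real.volume_Ioo,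
    sub_zero, Real.enorm_eq_ofReal hb0.le]
  have hal : 0 ≤ a * l := by positivity
  rw [show (1 / (2 : ℝ≥0∞).toReal) = (1 / 2 : ℝ) by norm_num,
    ENNReal.ofReal_rpow_of_nonneg hal (by norm_num), ← ENNReal.ofReal_mul hb0.le,
    Real.mul_rpow ha0.le hl0.le, ← Real.sqrt_eq_rpow, hl, ← Real.rpow_mul hlam0.le, mul_assoc]
  congr 4
  field_simp
  norm_num

end

/-! ### From the assumption on the potential to the data at an end -/

section

variable {n : ℕ} {V U : ℝ → ℂ} {E D : ℕ → ℝ → ℂ} {s ν ε₁ ε₂ : ℝ}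

theorem endHyp_of_endAssumption (hE : IsClassicalJet n V E)
    (hED : ∀ m ≤ n + 1, ∀ᵐ x, E m x = D m x) (hs : s = 1 ∨ s = -1) (hU : ∀ x, U x = V (s * x))
    (him : ∃ c > 0, ∃ X : ℝ, ∀ x, X ≤ x → c ≤ s * (U x).im)
    (h : EndAssumption (n + 1) U (fun m x => D m (s * x)) ν ε₁) :
    EndHyp U (fun x => s * E 1 (s * x)) ν ε₁ := by
  have hs1 : |s| = 1 := by rcases hs with rfl | rfl <;> simp
  have hE1 := quasiMeasurePreserving_sign hs (hED 1 (by omega))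
  have hUV : U = V ∘ fun x => s * x := funext hU
  refine ⟨?_, ?_, ?_, ?_, ?_, h.unbounded, h.bounded⟩
  · have hV := hE.locallyLipschitz 0 (Nat.zero_le _)
    rw [hE.zero] at hV
    rw [hUV]
    exact hV.comp (LipschitzWith.of_dist_le_mul (K := 1) fun x y => by
      rw [Real.dist_eq, Real.dist_eq, ← mul_sub, abs_mul, hs1]; simp).locallyLipschitz
  · filter_upwards [quasiMeasurePreserving_sign hs hE.ae_hasDerivAt_all] with x hx
    have hx := hx 0 (Nat.zero_le _)
    rw [hE.zero] at hx
    rw [hUV]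
    have := hx.scomp x ((hasDerivAt_id x).const_mul s)
    simpa using this
  · obtain ⟨c, hc, X, hX⟩ := him
    refine ⟨c, hc, X, fun x hx => (hX x hx).trans ((le_abs_self _).trans ?_)⟩
    rw [abs_mul, hs1, one_mul]
  · obtain ⟨C, -, X, hX⟩ := exists_ae_bound_of_isBigO
      (fun x => mul_nonneg (abs_nonneg _) (jb_rpow_pos x _).le) (h.im_deriv 1 le_rfl (by omega))
    refine ⟨C, X, ?_⟩
    filter_upwards [hX, hE1] with x hx h1 hXx
    have := hx hXx
    rwa [Nat.cast_one, one_mul, ← h1, Real.norm_eq_abs, ← one_mul |(E 1 (s * x)).im|, ← hs1,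
      ← abs_mul, ← Complex.im_ofReal_mul] at this
  · obtain ⟨C, -, X, hX⟩ := exists_ae_bound_of_isBigO
      (fun x => mul_nonneg (norm_nonneg _) (jb_rpow_pos x _).le) (h.deriv 1 le_rfl (by omega))
    refine ⟨C, X, ?_⟩
    filter_upwards [hX, hE1] with x hx h1 hXx
    have := hx hXx
    rw [norm_mul, Complex.norm_real, Real.norm_eq_abs, hs1, one_mul]
    rwa [Nat.cast_one, one_mul, ← h1] at this

theorem endData_of_endAssumption (hE : IsClassicalJet n V E)
    (hED : ∀ m ≤ n + 1, ∀ᵐ x, E m x = D m x) (hs : s = 1 ∨ s = -1) (hU : ∀ x, U x = V (s * x))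
    (him : ∃ c > 0, ∃ X : ℝ, ∀ x, X ≤ x → c ≤ s * (U x).im)
    (h : EndAssumption (n + 1) U (fun m x => D m (s * x)) ν ε₁) (hε₁ : 0 < ε₁) (hε₂ : 0 < ε₂)
    (hε : BoundedAtInfty U → ε₂ < 1 - ν) : EndData n V E s U ν ε₁ ε₂ := by
  refine ⟨hs, hU, him, ?_,
    (endHyp_of_endAssumption hE hED hs hU him h).endControl hε₁ hε₂ hε⟩
  have hex : ∀ m, ∃ C : ℝ, 0 ≤ C ∧ ∃ X : ℝ, 1 ≤ m → m ≤ n + 1 → ∀ᵐ x, X ≤ x →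
      ‖E m (s * x)‖ ≤ C * (‖U x‖ * (jb x ^ ν) ^ m) := by
    intro m
    by_cases hm : 1 ≤ m ∧ m ≤ n + 1
    · obtain ⟨C, hC, X, hX⟩ := exists_ae_bound_of_isBigO
        (fun x => mul_nonneg (norm_nonneg _) (jb_rpow_pos x _).le) (h.deriv m hm.1 hm.2)
      refine ⟨C, hC, X, fun _ _ => ?_⟩
      filter_upwards [hX, quasiMeasurePreserving_sign hs (hED m hm.2)] with x hx h1 hXx
      have := hx hXx
      rwa [← h1, mul_comm (m : ℝ) ν, Real.rpow_mul (jb_pos x).le, Real.rpow_natCast] at this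
    · exact ⟨0, le_rfl, 0, fun h1 h2 => absurd ⟨h1, h2⟩ hm⟩
  choose C hC X hX using hex
  refine ⟨∑ m ∈ Finset.range (n + 2), C m, ∑ m ∈ Finset.range (n + 2), |X m|, ?_⟩
  have hall : ∀ᵐ x, ∀ m, 1 ≤ m → m ≤ n + 1 → X m ≤ x →
      ‖E m (s * x)‖ ≤ C m * (‖U x‖ * (jb x ^ ν) ^ m) := by
    rw [ae_all_iff]
    intro m
    by_cases hm : 1 ≤ m ∧ m ≤ n + 1
    · filter_upwards [hX m hm.1 hm.2] with x hx _ _ using hx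
    · exact Eventually.of_forall fun x h1 h2 => absurd ⟨h1, h2⟩ hm
  filter_upwards [hall] with x hx hXx m h1 h2
  have hmem : m ∈ Finset.range (n + 2) := Finset.mem_range.2 (Nat.lt_succ_of_le h2)
  have hXm := Finset.single_le_sum (f := fun m => |X m|) (fun i _ => abs_nonneg _) hmem
  have hCm := Finset.single_le_sum (f := C) (fun i _ => hC i) hmem
  refine (hx m h1 h2 ((le_abs_self _).trans (hXm.trans hXx))).trans ?_
  have := (jb_rpow_pos x ν).le
  exact mul_le_mul_of_nonneg_right hCm (by positivity)

theorem endCutoff_of_isCutoff {χ : ℝ → ℝ} {a b a' b' δ Δ K : ℝ} (hχ : ContDiff ℝ ∞ χ)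
    (hrange : ∀ x, 0 ≤ χ x ∧ χ x ≤ 1) (hone : ∀ x ∈ Ioo a b, χ x = 1)
    (hzero : ∀ x ∉ Ioo a' b', χ x = 0)
    (hin : ∀ x, 0 < x → x < δ - Δ → s * x ∈ Ioo a b) (hout : ∀ x, δ ≤ x → s * x ∉ Ioo a' b')
    (hderiv : ∀ j : ℕ, j = 1 ∨ j = 2 → ∀ x, 0 < x → |iteratedDeriv j χ (s * x)| ≤ K / Δ ^ j) :
    EndCutoff χ s δ Δ K := by
  have hχ1 : ContDiff ℝ ∞ (deriv χ) := (contDiff_infty_iff_deriv.1 hχ).2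
  have hz1 := deriv_eq_zero_of_notMem_Ioo (hχ.differentiable (by simp)) hzero
  have hz2 := deriv_eq_zero_of_notMem_Ioo (hχ1.differentiable (by simp)) hz1
  have ho1 : ∀ x ∈ Ioo a b, deriv χ x = 0 := fun x hx => by
    have : χ =ᶠ[𝓝 x] fun _ => 1 := by
      filter_upwards [isOpen_Ioo.mem_nhds hx] with y hy using hone y hy
    rw [this.deriv_eq, deriv_const]
  have ho2 : ∀ x ∈ Ioo a b, deriv (deriv χ) x = 0 := fun x hx => by
    have : deriv χ =ᶠ[𝓝 x] fun _ => 0 := by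
      filter_upwards [isOpen_Ioo.mem_nhds hx] with y hy using ho1 y hy
    rw [this.deriv_eq, deriv_const]
  refine ⟨hrange, fun x h1 h2 => hone _ (hin x h1 h2), fun x hx => hzero _ (hout x hx),
    fun x hx => ⟨?_, ?_⟩, fun x hx hx' => ?_⟩
  · simpa using hderiv 1 (Or.inl rfl) x hx
  · have := hderiv 2 (Or.inr rfl) x hx
    rwa [iteratedDeriv_succ, iteratedDeriv_one] at this
  · rcases hx' with hx' | hx'
    · exact ⟨ho1 _ (hin x hx hx'), ho2 _ (hin x hx hx')⟩
    · exact ⟨hz1 _ (hout x hx'), hz2 _ (hout x hx')⟩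

end

/-! ### Joining the half-lines and splitting the error -/

theorem eLpNorm_restrict_Iio_zero (F : ℝ → ℂ) (p : ℝ≥0∞) :
    eLpNorm F p (volume.restrict (Iio 0))
      = eLpNorm (fun x => F (-1 * x)) p (volume.restrict (Ioi 0)) := by
  rw [← eLpNorm_indicator_eq_eLpNorm_restrict measurableSet_Iio,
    ← eLpNorm_indicator_eq_eLpNorm_restrict measurableSet_Ioi,
    ← eLpNorm_comp_sign (s := -1) (Or.inr rfl)]
  congr 1
  funext x
  simp only [indicator, mem_Iio, mem_Ioi, neg_mul, one_mul, Left.neg_neg_iff]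

theorem eLpNorm_le_add_halfLines {F : ℝ → ℂ} (hF : AEStronglyMeasurable F volume) :
    eLpNorm F 2 volume ≤ eLpNorm (fun x => F (-1 * x)) 2 (volume.restrict (Ioi 0))
      + eLpNorm (fun x => F (1 * x)) 2 (volume.restrict (Ioi 0)) := by
  have h1 : F =ᵐ[volume] (Iio 0).indicator F + (Ioi 0).indicator F := by
    have : ∀ᵐ x : ℝ, x ≠ 0 := by simp [ae_iff, measure_singleton]
    filter_upwards [this] with x hx
    rcases lt_or_gt_of_ne hx with h | h
    · simp [indicator, h, h.not_gt]
    · simp [indicator, h, h.not_gt]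
  rw [eLpNorm_congr_ae h1]
  refine (eLpNorm_add_le (hF.indicator measurableSet_Iio) (hF.indicator measurableSet_Ioi)
    (by norm_num)).trans ?_
  rw [eLpNorm_indicator_eq_eLpNorm_restrict measurableSet_Iio,
    eLpNorm_indicator_eq_eLpNorm_restrict measurableSet_Ioi, eLpNorm_restrict_Iio_zero]
  simp only [one_mul, le_refl]

theorem memLp_comp_neg_one_mul {W : ℝ → ℂ} {p : ℝ≥0∞}
    (hW : MemLp W p (volume.restrict (Iio 0))) :
    MemLp (fun x => W (-1 * x)) p (volume.restrict (Ioi 0)) := by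
  have h := (Measure.measurePreserving_neg (volume : Measure ℝ)).restrict_preimage
    (measurableSet_Iio (a := (0 : ℝ)))
  have hp : (Neg.neg ⁻¹' Iio (0 : ℝ)) = Ioi 0 := by ext x; simp
  rw [hp] at h
  simpa [Function.comp_def] using hW.comp_measurePreserving h

/-- A function that is bounded by a sum of nonnegative functions splits accordingly. -/
theorem exists_isBigO_sum_eq {ι : Type*} [Fintype ι] {Q : ℝ → ℝ} {A : ι → ℝ → ℝ}
    (hA : ∀ i, ∀ᶠ x in atTop, 0 ≤ A i x) (hQ : ∀ᶠ x in atTop, |Q x| ≤ ∑ i, A i x) :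
    ∃ q : ι → ℝ → ℝ, (∀ i, q i =O[atTop] A i) ∧ ∀ᶠ x in atTop, Q x = ∑ i, q i x := by
  -- The shares are proportional to the `A i`. Where their sum is zero, `Q x` is zero too, and so is
  -- the quotient by the convention on division.
  refine ⟨fun i x => Q x * (A i x / ∑ j, A j x), fun i => ?_, ?_⟩
  · refine IsBigO.of_bound 1 ?_
    filter_upwards [eventually_all.2 hA, hQ] with x hAx hQx
    have hS : 0 ≤ ∑ j, A j x := Finset.sum_nonneg fun j _ => hAx j
    rw [norm_mul, Real.norm_of_nonneg (div_nonneg (hAx i) hS), Real.norm_of_nonneg (hAx i), one_mul,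
      Real.norm_eq_abs, ← mul_div_assoc]
    refine div_le_of_le_mul₀ hS (hAx i) ?_
    rw [mul_comm]
    exact mul_le_mul_of_nonneg_left hQx (hAx i)
  · filter_upwards [eventually_all.2 hA, hQ] with x hAx hQx
    rw [← Finset.mul_sum, ← Finset.sum_div]
    rcases (Finset.sum_nonneg fun j _ => hAx j : 0 ≤ ∑ j, A j x).eq_or_lt with h0 | h0
    · rw [← h0, abs_nonpos_iff] at hQx
      rw [hQx, zero_mul]
    · rw [div_self h0.ne', mul_one]

section

variable {n : ℕ} {V W Um Up : ℝ → ℂ} {E : ℕ → ℝ → ℂ} {νm νp ε₁ ε₂ : ℝ} {ξ : ℝ → ℝ → ℝ}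

theorem exists_endCutoff (hm : EndData n V E (-1) Um νm ε₁ ε₂) (hp : EndData n V E 1 Up νp ε₁ ε₂)
    (hξ : IsCutoffFamily (cutRadius Um νm ε₁ ε₂) (cutWidth Um νm ε₁ ε₂) (cutRadius Up νp ε₁ ε₂)
      (cutWidth Up νp ε₁ ε₂) ξ) :
    ∃ K : ℝ, 0 ≤ K ∧ ∀ᶠ lam in atTop,
      EndCutoff (ξ lam) (-1) (cutRadius Um νm ε₁ ε₂ lam) (cutWidth Um νm ε₁ ε₂ lam) K ∧
      EndCutoff (ξ lam) 1 (cutRadius Up νp ε₁ ε₂ lam) (cutWidth Up νp ε₁ ε₂ lam) K := by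
  obtain ⟨K, hK⟩ := hξ.deriv_le
  refine ⟨|K|, abs_nonneg K, ?_⟩
  filter_upwards [hK, hξ.smooth, hξ.range, hξ.eq_one, hξ.eq_zero, hm.control.width,
    hp.control.width] with lam hd hs hr ho hz hwm hwp
  have hKle : ∀ (Δ : ℝ) (j : ℕ), 0 < Δ → K / Δ ^ j ≤ |K| / Δ ^ j := fun Δ j hΔ =>
    div_le_div_of_nonneg_right (le_abs_self K) (by positivity)
  constructor
  · refine endCutoff_of_isCutoff hs.1 hr ho hz (fun x h1 h2 => ?_) (fun x hx hmem => ?_)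
      fun j hj x hx => ((hd j hj).1 _ (by linarith)).trans (hKle _ j hwm.1)
    -- The plateau of the cut-off contains `0`, since `Δ < δ` at the other end as well.
    · constructor <;> linarith [hwp.1, hwp.2]
    · linarith [hmem.1]
  · refine endCutoff_of_isCutoff hs.1 hr ho hz (fun x h1 h2 => ?_) (fun x hx hmem => ?_)
      fun j hj x hx => ((hd j hj).2 _ (by linarith)).trans (hKle _ j hwp.1)
    · constructor <;> linarith [hwm.1, hwm.2]
    · linarith [hmem.2]

/-- The function `(H_{V+W} - λ) f` for the pseudomode `f`. -/
def pseudomodeError (V W : ℝ → ℂ) (E : ℕ → ℝ → ℂ) (n : ℕ) (ξ : ℝ → ℝ → ℝ) (lam x : ℝ) : ℂ :=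
  (cutoffError V E n (ξ lam) lam x + expansionError V E n (ξ lam) lam x)
    + W x * pseudomode V n ξ lam x

/-- The exponent of `ρ` is `1/(2(γ'+1)) · (1/2 - 1/r) - 1/(4(γ+1))`, from the bound for `W f` and
the lower bound for `‖f‖`. -/
theorem rpow_div_le_rhoRate {γ γ' r lam c C e F : ℝ} (hγ : 0 ≤ γ) (hγ' : 0 ≤ γ') (hlam : 0 < lam)
    (hc : 0 < c) (hC : 0 ≤ C) (he : e = 1 / (2 * (γ' + 1)) * (1 / 2 - 1 / r))
    (hF : c * lam ^ (1 / (4 * (γ + 1))) ≤ F) :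
    C * lam ^ e / F ≤ C / c * rhoRate γ γ' r lam := by
  have h0 : 0 < lam ^ (1 / (4 * (γ + 1))) := Real.rpow_pos_of_pos hlam _
  have h1 : 0 ≤ lam ^ e := Real.rpow_nonneg hlam.le _
  have h2 : rhoRate γ γ' r lam = lam ^ e / lam ^ (1 / (4 * (γ + 1))) := by
    rw [rhoRate, ← Real.rpow_sub hlam, he]
    congr 1
    field_simp
    ring
  calc C * lam ^ e / F ≤ C * lam ^ e / (c * lam ^ (1 / (4 * (γ + 1)))) := by gcongr
    _ = _ := by rw [h2]; field_simp

/-- Each contribution is divided by `‖f‖` in its own way: the cut-off error needs only `‖f‖ ≥ c`,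
the expansion error already contains `‖f‖` as a factor, and the perturbation error uses the full
lower bound. -/
theorem exists_error_bound (hE : IsClassicalJet n V E) (hV : Continuous V)
    (hm : EndData n V E (-1) Um νm ε₁ ε₂) (hp : EndData n V E 1 Up νp ε₁ ε₂)
    (hξ : IsCutoffFamily (cutRadius Um νm ε₁ ε₂) (cutWidth Um νm ε₁ ε₂) (cutRadius Up νp ε₁ ε₂)
      (cutWidth Up νp ε₁ ε₂) ξ)
    {γ γm γp : ℝ} (hγ : 0 ≤ γ) (hγm : 0 ≤ γm) (hγp : 0 ≤ γp)
    (hlm : (fun x => |x| ^ γm) =O[atTop] fun x => (Um x).im)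
    (hlp : (fun x => |x| ^ γp) =O[atTop] fun x => (Up x).im)
    {rm rp : ℝ} (hrm : 2 ≤ rm) (hrp : 2 ≤ rp)
    (hWm : MemLp W (ENNReal.ofReal rm) (volume.restrict (Iio 0)))
    (hWp : MemLp W (ENNReal.ofReal rp) (volume.restrict (Ioi 0)))
    (hlow : ∃ c > 0, ∀ᶠ lam in atTop, ENNReal.ofReal (c * lam ^ (1 / (4 * (γ + 1))))
      ≤ eLpNorm (pseudomode V n ξ lam) 2 volume) :
    ∃ cm > 0, ∃ cp > 0, ∃ C : ℝ, 0 ≤ C ∧ ∀ᶠ lam in atTop,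
      0 < l2norm (pseudomode V n ξ lam) ∧
      IsSchrodingerImage (fun x => V x + W x) (pseudomode V n ξ lam)
        (fun x => lam * pseudomode V n ξ lam x + pseudomodeError V W E n ξ lam x) ∧
      l2norm (pseudomodeError V W E n ξ lam) / l2norm (pseudomode V n ξ lam)
        ≤ C * (kappaRate Um νm ε₁ ε₂ cm lam + kappaRate Up νp ε₁ ε₂ cp lam
          + (sigmaRate Um n νm ε₁ ε₂ lam + sigmaRate Up n νp ε₁ ε₂ lam)
          + (rhoRate γ γm rm lam + rhoRate γ γp rp lam)) := by
  have hUm : Continuous Um := by rw [funext hm.profile]; fun_prop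
  have hUp : Continuous Up := by rw [funext hp.profile]; fun_prop
  obtain ⟨K, hK, hcut⟩ := exists_endCutoff hm hp hξ
  obtain ⟨cm, hcm, Cκm, hCκm, hκm⟩ := hm.cutoffError_le hE hUm hK
  obtain ⟨cp, hcp, Cκp, hCκp, hκp⟩ := hp.cutoffError_le hE hUp hK
  obtain ⟨Cσm, hCσm, hσm⟩ := hm.expansionError_le hE hUm (K := K)
  obtain ⟨Cσp, hCσp, hσp⟩ := hp.expansionError_le hE hUp (K := K)
  obtain ⟨Cρm, hCρm, hρm⟩ := hm.perturbation_le hE hUm hγm hrm hlm (K := K)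
    (memLp_comp_neg_one_mul hWm)
  obtain ⟨Cρp, hCρp, hρp⟩ := hp.perturbation_le hE hUp hγp hrp hlp (K := K) (W := W)
    (by simpa using hWp)
  obtain ⟨c, hc, hlow⟩ := hlow
  obtain ⟨Bm, -, hsm⟩ := hm.control.size
  obtain ⟨Bp, -, hsp⟩ := hp.control.size
  refine ⟨cm, hcm, cp, hcp,
    Cκm / c + Cκp / c + (Cσm + Cσp) + (Cρm / c + Cρp / c), by positivity, ?_⟩
  filter_upwards [hcut, hκm, hκp, hσm, hσp, hρm, hρp, hlow, hsm, hsp, hξ.smooth, hξ.eq_zero,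
    eventually_ge_atTop 1, hm.control.tendsto.eventually_gt_atTop 0,
    hp.control.tendsto.eventually_gt_atTop 0] with lam hcut hκm hκp hσm hσp hρm hρp hlow hsm hsp
    hsmooth hzero hlam1 hδm hδp
  have hlam0 : 0 < lam := by linarith
  obtain ⟨F, hF⟩ : ∃ F, F = l2norm (pseudomode V n ξ lam) := ⟨_, rfl⟩
  have hre : ∀ x ∈ Icc (-cutRadius Um νm ε₁ ε₂ lam) (cutRadius Up νp ε₁ ε₂ lam),
      (V x).re < lam := by
    intro x hx
    rcases le_total 0 x with h0 | h0
    · have := (hsp x h0 hx.2).1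
      rw [hp.profile, one_mul] at this
      linarith
    · have := (hsm (-x) (by linarith) (by linarith [hx.1])).1
      rw [hm.profile, neg_mul_neg, one_mul] at this
      linarith
  obtain ⟨m1, m2, m3, m4, m5⟩ := isSchrodingerImage_pseudomode (f := pseudomode V n ξ lam) hE hlam0
    (by linarith) hδp hre hsmooth.1 hzero hrm hrp hWm hWp fun x => rfl
  replace hlow : c * lam ^ (1 / (4 * (γ + 1))) ≤ l2norm (pseudomode V n ξ lam) :=
    (ENNReal.ofReal_le_iff_le_toReal m1.2.ne).1 hlow
  have hF0 : 0 < F := by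
    rw [hF]
    exact lt_of_lt_of_le (mul_pos hc (Real.rpow_pos_of_pos hlam0 _)) hlow
  have hcF : c ≤ F := by
    rw [hF]
    refine le_trans (le_mul_of_one_le_right hc.le (Real.one_le_rpow hlam1 ?_)) hlow
    positivity
  have hFe : eLpNorm (fun x => ((ξ lam x : ℝ) : ℂ) * wkbG V n lam x) 2 volume
      = ENNReal.ofReal F := by
    rw [hF, l2norm, ENNReal.ofReal_toReal m1.2.ne]; rfl
  refine ⟨hF ▸ hF0, ?_, ?_⟩
  · refine (congrArg (IsSchrodingerImage _ _) ?_).mp m5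
    funext x
    rw [pseudomodeError]; ring
  have km := hκm _ hcut.1
  have kp := hκp _ hcut.2
  have sm := hσm _ hcut.1
  have sp := hσp _ hcut.2
  have pm := hρm _ hcut.1
  have pp := hρp _ hcut.2
  have nκm : 0 ≤ kappaRate Um νm ε₁ ε₂ cm lam := by rw [kappaRate_eq]; positivity
  have nκp : 0 ≤ kappaRate Up νp ε₁ ε₂ cp lam := by rw [kappaRate_eq]; positivity
  have nσm : 0 ≤ sigmaRate Um n νm ε₁ ε₂ lam := sigmaRate_nonneg hlam0.le
  have nσp : 0 ≤ sigmaRate Up n νp ε₁ ε₂ lam := sigmaRate_nonneg hlam0.le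
  have nρm : 0 ≤ rhoRate γ γm rm lam := Real.rpow_nonneg hlam0.le _
  have nρp : 0 ≤ rhoRate γ γp rp lam := Real.rpow_nonneg hlam0.le _
  have rρm := rpow_div_le_rhoRate hγ hγm hlam0 hc hCρm (r := rm) rfl (hF ▸ hlow)
  have rρp := rpow_div_le_rhoRate hγ hγp hlam0 hc hCρp (r := rp) rfl (hF ▸ hlow)
  rw [hFe, ← ENNReal.ofReal_mul (by positivity)] at sm sp
  have hlam_m : 0 ≤ lam ^ (1 / (2 * (γm + 1)) * (1 / 2 - 1 / rm)) := Real.rpow_nonneg hlam0.le _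
  have hlam_p : 0 ≤ lam ^ (1 / (2 * (γp + 1)) * (1 / 2 - 1 / rp)) := Real.rpow_nonneg hlam0.le _
  have tκ := (eLpNorm_le_add_halfLines m2.1).trans (add_le_add km kp)
  have tσ := (eLpNorm_le_add_halfLines m3.1).trans (add_le_add sm sp)
  have tρ := (eLpNorm_le_add_halfLines m4.1).trans (add_le_add pm pp)
  rw [← ENNReal.ofReal_add (by positivity) (by positivity)] at tκ tσ tρ
  have tall : eLpNorm (pseudomodeError V W E n ξ lam) 2 volume
      ≤ ENNReal.ofReal ((Cκm * kappaRate Um νm ε₁ ε₂ cm lam + Cκp * kappaRate Up νp ε₁ ε₂ cp lam)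
        + (Cσm * sigmaRate Um n νm ε₁ ε₂ lam * F + Cσp * sigmaRate Up n νp ε₁ ε₂ lam * F)
        + (Cρm * lam ^ (1 / (2 * (γm + 1)) * (1 / 2 - 1 / rm))
          + Cρp * lam ^ (1 / (2 * (γp + 1)) * (1 / 2 - 1 / rp)))) := by
    rw [ENNReal.ofReal_add (by positivity) (by positivity),
      ENNReal.ofReal_add (by positivity) (by positivity)]
    refine (eLpNorm_add_le (m2.1.add m3.1) m4.1 (by norm_num)).trans ?_
    exact add_le_add ((eLpNorm_add_le m2.1 m3.1 (by norm_num)).trans (add_le_add tκ tσ)) tρ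
  have treal := ENNReal.toReal_le_of_le_ofReal (by positivity) tall
  rw [← hF]
  have rκ : ∀ A k : ℝ, 0 ≤ A → 0 ≤ k → A * k / F ≤ A / c * k := fun A k hA hk => by
    rw [div_mul_eq_mul_div]; gcongr
  have rκm := rκ _ _ hCκm nκm
  have rκp := rκ _ _ hCκp nκp
  calc l2norm (pseudomodeError V W E n ξ lam) / F
      ≤ ((Cκm * kappaRate Um νm ε₁ ε₂ cm lam + Cκp * kappaRate Up νp ε₁ ε₂ cp lam)
        + (Cσm * sigmaRate Um n νm ε₁ ε₂ lam * F + Cσp * sigmaRate Up n νp ε₁ ε₂ lam * F)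
        + (Cρm * lam ^ (1 / (2 * (γm + 1)) * (1 / 2 - 1 / rm))
          + Cρp * lam ^ (1 / (2 * (γp + 1)) * (1 / 2 - 1 / rp)))) / F :=
        div_le_div_of_nonneg_right treal hF0.le
    _ = Cκm * kappaRate Um νm ε₁ ε₂ cm lam / F + Cκp * kappaRate Up νp ε₁ ε₂ cp lam / F
        + (Cσm * sigmaRate Um n νm ε₁ ε₂ lam + Cσp * sigmaRate Up n νp ε₁ ε₂ lam)
        + (Cρm * lam ^ (1 / (2 * (γm + 1)) * (1 / 2 - 1 / rm)) / F
          + Cρp * lam ^ (1 / (2 * (γp + 1)) * (1 / 2 - 1 / rp)) / F) := by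
        field_simp
    _ ≤ Cκm / c * kappaRate Um νm ε₁ ε₂ cm lam + Cκp / c * kappaRate Up νp ε₁ ε₂ cp lam
        + (Cσm * sigmaRate Um n νm ε₁ ε₂ lam + Cσp * sigmaRate Up n νp ε₁ ε₂ lam)
        + (Cρm / c * rhoRate γ γm rm lam + Cρp / c * rhoRate γ γp rp lam) := by
        linarith
    _ ≤ _ := by
        obtain ⟨a1, h1⟩ : ∃ a, a = Cκm / c := ⟨_, rfl⟩
        obtain ⟨a2, h2⟩ : ∃ a, a = Cκp / c := ⟨_, rfl⟩
        obtain ⟨a3, h3⟩ : ∃ a, a = Cρm / c := ⟨_, rfl⟩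
        obtain ⟨a4, h4⟩ : ∃ a, a = Cρp / c := ⟨_, rfl⟩
        have g1 : 0 ≤ a1 := h1 ▸ by positivity
        have g2 : 0 ≤ a2 := h2 ▸ by positivity
        have g3 : 0 ≤ a3 := h3 ▸ by positivity
        have g4 : 0 ≤ a4 := h4 ▸ by positivity
        rw [← h1, ← h2, ← h3, ← h4]
        simp only [mul_add]
        gcongr <;> linarith

theorem exists_im_ge_of_liminf {u : ℝ → ℝ} (h : 0 < liminf (fun x => ((u x : ℝ) : EReal)) atTop) :
    ∃ c > 0, ∃ X : ℝ, ∀ x, X ≤ x → c ≤ u x := by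
  obtain ⟨c, hc0, hc⟩ := EReal.lt_iff_exists_real_btwn.1 h
  obtain ⟨X, hX⟩ := eventually_atTop.1 (eventually_lt_of_lt_liminf hc)
  exact ⟨c, by exact_mod_cast hc0, X, fun x hx => by exact_mod_cast (hX x hx).le⟩

theorem exists_im_le_of_limsup {u : ℝ → ℝ} (h : limsup (fun x => ((u x : ℝ) : EReal)) atBot < 0) :
    ∃ c > 0, ∃ X : ℝ, ∀ x, X ≤ x → c ≤ -1 * u (-x) := by
  obtain ⟨c, hc, hc0⟩ := EReal.lt_iff_exists_real_btwn.1 h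
  obtain ⟨X, hX⟩ := eventually_atBot.1 (eventually_lt_of_limsup_lt hc)
  have hc0' : c < 0 := by exact_mod_cast hc0
  refine ⟨-c, by linarith, -X, fun x hx => ?_⟩
  have : u (-x) < c := by exact_mod_cast hX (-x) (by linarith)
  linarith

end

end Pseudomode

end

/-! ### Proof of the theorem -/

theorem mainTheorem4
    (N n : ℕ) (hN : 1 ≤ N) (hn : n = N - 1)
    (V W : ℝ → ℂ) (νm νp ε₁ ε₂ : ℝ) (hε₁ : 0 < ε₁) (hε₂ : 0 < ε₂)
    (hV : Pseudomode.BasicAssumption N V νm νp ε₁)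
    (hε₂m : Pseudomode.BoundedAtInfty (Pseudomode.reflect V) → ε₂ < 1 - νm)
    (hε₂p : Pseudomode.BoundedAtInfty V → ε₂ < 1 - νp)
    (γ γm γp : ℝ) (hγ : 0 ≤ γ) (hγm : 0 ≤ γm) (hγp : 0 ≤ γp)
    -- the upper power bound on the imaginary part holds at one of the two ends
    (hupper : (fun x => (V x).im) =O[atTop] (fun x => |x| ^ γ) ∨
      (fun x => (V x).im) =O[atBot] (fun x => |x| ^ γ))
    -- the lower power bounds on the imaginary part hold at both ends
    (hlower_p : (fun x => |x| ^ γp) =O[atTop] (fun x => (V x).im))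
    (hlower_m : (fun x => |x| ^ γm) =O[atBot] (fun x => (V x).im))
    (rm rp : ℝ) (hrm : 2 ≤ rm) (hrp : 2 ≤ rp)
    (hWm : MemLp W (ENNReal.ofReal rm) (volume.restrict (Iio 0)))
    (hWp : MemLp W (ENNReal.ofReal rp) (volume.restrict (Ioi 0)))
    (ξ : ℝ → ℝ → ℝ)
    (hξ : Pseudomode.IsCutoffFamily
      (Pseudomode.cutRadius (Pseudomode.reflect V) νm ε₁ ε₂)
      (Pseudomode.cutWidth (Pseudomode.reflect V) νm ε₁ ε₂)
      (Pseudomode.cutRadius V νp ε₁ ε₂)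
      (Pseudomode.cutWidth V νp ε₁ ε₂) ξ) :
    ∃ κm κp σm σp ρm ρp : ℝ → ℝ,
      (∃ c > 0, κm =O[atTop] Pseudomode.kappaRate (Pseudomode.reflect V) νm ε₁ ε₂ c) ∧
      (∃ c > 0, κp =O[atTop] Pseudomode.kappaRate V νp ε₁ ε₂ c) ∧
      σm =O[atTop] Pseudomode.sigmaRate (Pseudomode.reflect V) n νm ε₁ ε₂ ∧
      σp =O[atTop] Pseudomode.sigmaRate V n νp ε₁ ε₂ ∧
      ρm =O[atTop] Pseudomode.rhoRate γ γm rm ∧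
      ρp =O[atTop] Pseudomode.rhoRate γ γp rp ∧
      ∀ᶠ lam in atTop,
        0 < Pseudomode.l2norm (Pseudomode.pseudomode V n ξ lam) ∧
        ∃ h : ℝ → ℂ,
          Pseudomode.IsSchrodingerImage (fun x => V x + W x)
            (Pseudomode.pseudomode V n ξ lam) h ∧
          Pseudomode.l2norm (fun x => h x - (lam : ℂ) * Pseudomode.pseudomode V n ξ lam x)
              / Pseudomode.l2norm (Pseudomode.pseudomode V n ξ lam)
            = (κm lam + κp lam) + (σm lam + σp lam) + (ρm lam + ρp lam) := by
  obtain ⟨k, rfl⟩ : ∃ k, N = k + 1 := ⟨N - 1, by omega⟩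
  obtain rfl : n = k := by omega
  obtain ⟨D, hD, hDm, hDp⟩ := hV.exists_derivs
  obtain ⟨E, hE, hED⟩ := hD.exists_jet hV.continuous
  have him_m := Pseudomode.exists_im_le_of_limsup hV.limsup_neg
  have him_p : ∃ c > 0, ∃ X : ℝ, ∀ x, X ≤ x → c ≤ 1 * (V x).im := by
    simpa using Pseudomode.exists_im_ge_of_liminf hV.liminf_pos
  have hprof_m : ∀ x, Pseudomode.reflect V x = V (-1 * x) := fun x => by
    rw [neg_one_mul]; rfl
  have hprof_p : ∀ x, V x = V (1 * x) := fun x => by rw [one_mul]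
  have hDm' : Pseudomode.EndAssumption (n + 1) (Pseudomode.reflect V)
      (fun m x => D m (-1 * x)) νm ε₁ := by
    simpa [Pseudomode.reflect, funext_iff] using! hDm
  have hDp' : Pseudomode.EndAssumption (n + 1) V (fun m x => D m (1 * x)) νp ε₁ := by
    simpa using hDp
  have hypm := Pseudomode.endHyp_of_endAssumption hE hED (Or.inr rfl) hprof_m him_m hDm'
  have hypp := Pseudomode.endHyp_of_endAssumption hE hED (Or.inl rfl) hprof_p him_p hDp'
  have hm := Pseudomode.endData_of_endAssumption hE hED (Or.inr rfl) hprof_m him_m hDm' hε₁ hε₂ hε₂m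
  have hp := Pseudomode.endData_of_endAssumption hE hED (Or.inl rfl) hprof_p him_p hDp' hε₁ hε₂ hε₂p
  have hcm : Continuous (Pseudomode.reflect V) := hV.continuous.comp continuous_neg
  have hlm : (fun x => |x| ^ γm) =O[atTop] fun x => (Pseudomode.reflect V x).im := by
    simpa [Function.comp_def, Pseudomode.reflect] using hlower_m.comp_tendsto tendsto_neg_atTop_atBot
  obtain ⟨K, -, hcut⟩ := Pseudomode.exists_endCutoff hm hp hξ
  -- A lower bound for `‖f‖` on one half-line is enough, so the upper power bound is needed at one
  -- end only.
  have hlow : ∃ c > 0, ∀ᶠ lam in atTop, ENNReal.ofReal (c * lam ^ (1 / (4 * (γ + 1))))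
      ≤ eLpNorm (Pseudomode.pseudomode V n ξ lam) 2 volume := by
    rcases hupper with hup | hup
    · obtain ⟨c0, hc0, hrad⟩ := hypp.cutRadius_ge (ε₂ := ε₂) hε₁ hε₂ hγ hup
      obtain ⟨c, hc, h⟩ := hp.le_eLpNorm hE hV.continuous (K := K) hγ hup hc0 hrad
      refine ⟨c, hc, ?_⟩
      filter_upwards [h, hcut] with lam h1 h2 using h1 _ h2.2
    · have hup' : (fun x => (Pseudomode.reflect V x).im) =O[atTop] fun x => |x| ^ γ := by
        simpa [Function.comp_def, Pseudomode.reflect] using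
          hup.comp_tendsto tendsto_neg_atTop_atBot
      obtain ⟨c0, hc0, hrad⟩ := hypm.cutRadius_ge (ε₂ := ε₂) hε₁ hε₂ hγ hup'
      obtain ⟨c, hc, h⟩ := hm.le_eLpNorm hE hcm (K := K) hγ hup' hc0 hrad
      refine ⟨c, hc, ?_⟩
      filter_upwards [h, hcut] with lam h1 h2 using h1 _ h2.1
  obtain ⟨cm, hcm0, cp, hcp0, C, hC, hbound⟩ := Pseudomode.exists_error_bound (W := W) hE
    hV.continuous hm hp hξ hγ hγm hγp hlm hlower_p hrm hrp hWm hWp hlow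
  obtain ⟨Q, hQ⟩ : ∃ Q : ℝ → ℝ, Q = fun lam =>
      Pseudomode.l2norm (Pseudomode.pseudomodeError V W E n ξ lam)
        / Pseudomode.l2norm (Pseudomode.pseudomode V n ξ lam) := ⟨_, rfl⟩
  obtain ⟨A, hA⟩ : ∃ A : Fin 6 → ℝ → ℝ, A = ![
      Pseudomode.kappaRate (Pseudomode.reflect V) νm ε₁ ε₂ cm,
      Pseudomode.kappaRate V νp ε₁ ε₂ cp,
      Pseudomode.sigmaRate (Pseudomode.reflect V) n νm ε₁ ε₂,
      Pseudomode.sigmaRate V n νp ε₁ ε₂,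
      Pseudomode.rhoRate γ γm rm, Pseudomode.rhoRate γ γp rp] := ⟨_, rfl⟩
  -- The estimates give an inequality; the asserted equality results from distributing the quotient
  -- among the six rates.
  obtain ⟨q, hq, hsum⟩ := Pseudomode.exists_isBigO_sum_eq (Q := Q) (A := fun i lam => C * A i lam)
    (fun i => by
      filter_upwards [eventually_ge_atTop 0] with lam hlam
      refine mul_nonneg hC ?_
      rw [hA]
      fin_cases i
      · simpa [Pseudomode.kappaRate_eq] using (Real.exp_pos _).le
      · simpa [Pseudomode.kappaRate_eq] using (Real.exp_pos _).le
      · exact Pseudomode.sigmaRate_nonneg hlam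
      · exact Pseudomode.sigmaRate_nonneg hlam
      · exact Real.rpow_nonneg hlam _
      · exact Real.rpow_nonneg hlam _)
    (by
      filter_upwards [hbound] with lam h
      have hQ0 : 0 ≤ Q lam := by
        rw [hQ]; exact div_nonneg ENNReal.toReal_nonneg ENNReal.toReal_nonneg
      rw [abs_of_nonneg hQ0, hQ, ← Finset.mul_sum, Fin.sum_univ_six, hA]
      refine h.2.2.trans (le_of_eq ?_)
      simp only [Matrix.cons_val]
      ring)
  have hqA : ∀ i, q i =O[atTop] A i := fun i =>
    (hq i).trans ((isBigO_refl _ _).const_mul_left C)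
  rw [hA] at hqA
  refine ⟨q 0, q 1, q 2, q 3, q 4, q 5, ⟨cm, hcm0, hqA 0⟩, ⟨cp, hcp0, hqA 1⟩, hqA 2, hqA 3, hqA 4,
    hqA 5, ?_⟩
  filter_upwards [hbound, hsum] with lam h hs
  refine ⟨h.1, _, h.2.1, ?_⟩
  rw [Fin.sum_univ_six, hQ] at hs
  simp only [add_sub_cancel_left]
  refine hs.trans ?_
  ring
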